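/- Let $S$ be a $d$-dimensional $C^2$ manifold (Hausdorff), $T\subseteq\mathbb R$ a connected open set, and let $a_t$ (a positive definite metric), $b_t$ (a 1-form), $U$ (a scalar) and $\psi>0$ (a scalar) be time dependent fields on $S$, $t\in T$, of class $C^1$ in $(t,q)$. Put $E=T\times S$ and let $M=E\times\mathbb R$, with points $(t,q,y)$, carry the (Eisenhart) metric $$g=a_t+n\otimes(dy-b_t)+(dy-b_t)\otimes n-(2U+1)\,n\otimes n,\qquad n=-\psi\,dt,$$ where $a_t,b_t$ are pulled back from $S$ to $M$. The 1-form $n$ is metrically equivalent to the vector field $n=\partial/\partial y$. For $\frac1\mu\in[0,+\infty)$, $t_0<t_1$, $[t_0,t_1]\subset T$ and a $C^1$ curve $q:[t_0,t_1]\to S$ put $$E_{1/\mu}[q]=\int_{t_0}^{t_1}\Big[\tfrac1{2\psi}a_t(\dot q,\dot q)+b_t(\dot q)-\psi\big(\tfrac1{2\mu^2}+\tfrac12+U\big)\Big]dt ,$$ and, for $y_0\in\mathbb R$, call the $\frac1\mu$-lift of $(t,q(t))$ starting at $y_0$ the curve $(t,q(t),y(t))$ with $$y(t)=y_0+\int_{t_0}^{t}\Big[\tfrac1{2\psi}a_{t'}(\dot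 q,\dot q)+b_{t'}(\dot q)+\psi\big(\tfrac1{2\mu^2}-\tfrac12-U\big)\Big]dt' .$$ A $C^1$ curve $q$ is a stationary point of $E_{1/\mu}$ if the derivative of $E_{1/\mu}$ at $q$ vanishes along every continuously differentiable one-parameter family, through $q$, in the set of $C^1$ curves $[t_0,t_1]\to S$ with the same endpoints as $q$. (1) Let $x(\lambda)$ be a causal geodesic of $(M,g)$, defined on a nondegenerate interval and not contained in a flow line of $n$, with tangent vector $V$. Then $g(n,V)$ never vanishes, $t$ is strictly monotone along $x$, and $\frac1\mu:=\sqrt{-g(V,V)}/|g(n,V)|\in[0,+\infty)$ is constant along $x$. The projection of $x$ to $E$ is, parametrized by $t$, a curve $(t,q(t))$ with $q$ of class $C^2$, and for all $t_0<t_1$ in the range of $t$ along $x$ the restriction of $q$ to $[t_0,t_1]$ is a stationary point of $E_{1/\mu}$. (2) Let $\frac1\mu\in[0,+\infty)$, $t_0<t_1$ with $[t_0,t_1]\subset T$, $y_0\in\mathbb R$, and let $q:[t_0,t_1]\to S$ be a $C^1$ curve. Then $q$ is of class $C^2$ and a stationary point of $E_{1/\mu}$ if and only if the $\frac1\mu$-lift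 of $(t,q(t))$ starting at $y_0$ is an unparametrized geodesic of $(M,g)$. In this case, if $\frac1\mu\neq0$ the geodesic is timelike and becomes a geodesic parametrized by proper time ($g(x',x')=-1$) under any parameter $\tau$ with $d\tau=\frac{\psi}{\mu}\,dt$; if $\frac1\mu=0$ it is lightlike and becomes an affinely parametrized geodesic under any parameter $\lambda$ with $d\lambda=\psi\,dt$. -/

import Mathlib

open Set Manifold
open scoped ContDiff Topology

noncomputable section

section SemiRiemannian

variable {E : Type*} [NormedAddCommGroup E] [NormedSpace ℝ E]
  {H : Type*} [TopologicalSpace H] (I : ModelWithCorners ℝ E H) [I.Boundaryless]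
  {M : Type*} [TopologicalSpace M] [ChartedSpace H M]

/-- The velocity `x'(s)` of a curve `x` defined on an interval `J`. -/
def curveVelocity (J : Set ℝ) (x : ℝ → M) (s : ℝ) : TangentSpace I (x s) :=
  mfderivWithin 𝓘(ℝ, ℝ) I x J s (1 : ℝ)

/-- The tangent vector at the point with coordinates `z` in the chart around `p` whose
components in this chart are `v`. -/
def chartVector (p : M) (z : E) (v : E) : TangentSpace I ((extChartAt I p).symm z) :=
  mfderiv 𝓘(ℝ, E) I (extChartAt I p).symm z v

/-- The components of a covariant 2-tensor field `g` in the chart around `p`. -/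
def metricInChart (g : ∀ x : M, LinearMap.BilinForm ℝ (TangentSpace I x))
    (p : M) (z : E) (v w : E) : ℝ :=
  g ((extChartAt I p).symm z) (chartVector I p z v) (chartVector I p z w)

/-- Christoffel symbols of the first kind in the chart around `p`:
`Γ(u, w; v) = ½ (∂_u g(w, v) + ∂_w g(u, v) - ∂_v g(u, w))`. -/
def christoffelFirst (g : ∀ x : M, LinearMap.BilinForm ℝ (TangentSpace I x))
    (p : M) (z : E) (u w v : E) : ℝ :=
  (1 / 2) *
    (fderiv ℝ (fun z' => metricInChart I g p z' w v) z u
      + fderiv ℝ (fun z' => metricInChart I g p z' u v) z w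
      - fderiv ℝ (fun z' => metricInChart I g p z' u w) z v)

/-- `x` is a (parametrized) geodesic of the nondegenerate metric `g` on the interval `J`: it is
`C²` and, in every chart `φ_p`, the equation `∇_{x'} x' = 0` holds. The latter is written with
its index lowered: `g(c'', v) + Γ(c', c'; v) = 0` for all `v`, where `c = φ_p ∘ x`. -/
def IsGeodesicOn (g : ∀ x : M, LinearMap.BilinForm ℝ (TangentSpace I x))
    (J : Set ℝ) (x : ℝ → M) : Prop :=
  ContMDiffOn 𝓘(ℝ, ℝ) I 2 x J ∧
  ∀ p : M, ∀ s ∈ J, x s ∈ (chartAt H p).source → ∀ v : E,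
    metricInChart I g p (extChartAt I p (x s))
        (derivWithin (derivWithin (fun s' => extChartAt I p (x s')) J) J s) v
      + christoffelFirst I g p (extChartAt I p (x s))
        (derivWithin (fun s' => extChartAt I p (x s')) J s)
        (derivWithin (fun s' => extChartAt I p (x s')) J s) v = 0

/-- The curve `γ` on the interval `J` is an unparametrized geodesic: up to a regular, increasing
change of parameter `σ` it is a geodesic. -/
def IsUnparamGeodesicOn (g : ∀ x : M, LinearMap.BilinForm ℝ (TangentSpace I x))
    (J : Set ℝ) (γ : ℝ → M) : Prop :=
  ∃ (σ : ℝ → ℝ) (x : ℝ → M), ContDiffOn ℝ 1 σ J ∧ (∀ s ∈ J, 0 < derivWithin σ J s) ∧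
    (∀ s ∈ J, x (σ s) = γ s) ∧ IsGeodesicOn I g (σ '' J) x

end SemiRiemannian

section Eisenhart

/-- The data of an Eisenhart spacetime over the `C²` manifold `S`: an open connected set `T ⊆ ℝ` of
times, a time dependent Riemannian metric `a`, 1-form `b`, scalar `U` and positive scalar `ψ`
on `S`, all of class `C¹` in `(t, q)` on `T × S`. Values at times outside `T` play no role. -/
structure EisenhartData (d : ℕ) (S : Type*) [TopologicalSpace S]
    [ChartedSpace (EuclideanSpace ℝ (Fin d)) S] where
  T : Set ℝ
  isOpen_T : IsOpen T
  isConnected_T : IsConnected T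
  a : ℝ → ∀ q : S, LinearMap.BilinForm ℝ (TangentSpace (𝓡 d) q)
  b : ℝ → ∀ q : S, Module.Dual ℝ (TangentSpace (𝓡 d) q)
  U : ℝ → S → ℝ
  ψ : ℝ → S → ℝ
  a_symm : ∀ t ∈ T, ∀ q v w, a t q v w = a t q w v
  a_pos : ∀ t ∈ T, ∀ q v, v ≠ 0 → 0 < a t q v v
  ψ_pos : ∀ t ∈ T, ∀ q, 0 < ψ t q
  contDiffOn_a : ∀ (p : S) (v w : EuclideanSpace ℝ (Fin d)),
    ContDiffOn ℝ 1 (fun z : ℝ × EuclideanSpace ℝ (Fin d) => metricInChart (𝓡 d) (a z.1) p z.2 v w)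
      (T ×ˢ (extChartAt (𝓡 d) p).target)
  contDiffOn_b : ∀ (p : S) (v : EuclideanSpace ℝ (Fin d)),
    ContDiffOn ℝ 1
      (fun z : ℝ × EuclideanSpace ℝ (Fin d) =>
        b z.1 ((extChartAt (𝓡 d) p).symm z.2) (chartVector (𝓡 d) p z.2 v))
      (T ×ˢ (extChartAt (𝓡 d) p).target)
  contMDiffOn_U :
    ContMDiffOn (𝓘(ℝ, ℝ).prod (𝓡 d)) 𝓘(ℝ, ℝ) 1 (fun e : ℝ × S => U e.1 e.2) (T ×ˢ univ)
  contMDiffOn_ψ :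
    ContMDiffOn (𝓘(ℝ, ℝ).prod (𝓡 d)) 𝓘(ℝ, ℝ) 1 (fun e : ℝ × S => ψ e.1 e.2) (T ×ˢ univ)

/-- The model of the product manifold `ℝ × S × ℝ`, whose open subset `T × S × ℝ` is the
Eisenhart spacetime; points are written `(t, q, y)`. -/
abbrev eisModel (d : ℕ) :
    ModelWithCorners ℝ (ℝ × EuclideanSpace ℝ (Fin d) × ℝ)
      (ModelProd ℝ (ModelProd (EuclideanSpace ℝ (Fin d)) ℝ)) :=
  𝓘(ℝ, ℝ).prod ((𝓡 d).prod 𝓘(ℝ, ℝ))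

variable {d : ℕ} {S : Type*} [TopologicalSpace S] [ChartedSpace (EuclideanSpace ℝ (Fin d)) S]

/-- The differential `dt` at the event `x`. -/
def dT (x : ℝ × S × ℝ) : Module.Dual ℝ (TangentSpace (eisModel d) x) :=
  (mfderiv (eisModel d) 𝓘(ℝ, ℝ) (fun x' : ℝ × S × ℝ => x'.1) x).toLinearMap

/-- The differential of the projection `π_S : (t, q, y) ↦ q` at the event `x`. -/
def dπS (x : ℝ × S × ℝ) : TangentSpace (eisModel d) x →ₗ[ℝ] TangentSpace (𝓡 d) x.2.1 :=
  (mfderiv (eisModel d) (𝓡 d) (fun x' : ℝ × S × ℝ => x'.2.1) x).toLinearMap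

/-- The differential `dy` at the event `x`. -/
def dY (x : ℝ × S × ℝ) : Module.Dual ℝ (TangentSpace (eisModel d) x) :=
  (mfderiv (eisModel d) 𝓘(ℝ, ℝ) (fun x' : ℝ × S × ℝ => x'.2.2) x).toLinearMap

/-- The lightlike Killing field `n = ∂/∂y`: the velocity of the curve `r ↦ (t, q, y + r)`. -/
def killingN (x : ℝ × S × ℝ) : TangentSpace (eisModel d) x :=
  mfderiv 𝓘(ℝ, ℝ) (eisModel d) (fun y : ℝ => (x.1, x.2.1, y)) x.2.2 (1 : ℝ)

namespace EisenhartData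

variable (D : EisenhartData d S)

/-- The 1-form `n = -ψ dt`. -/
def nForm (x : ℝ × S × ℝ) : Module.Dual ℝ (TangentSpace (eisModel d) x) :=
  -(D.ψ x.1 x.2.1 • dT x)

/-- The 1-form `dy - π_S^* b_t`. -/
def connForm (x : ℝ × S × ℝ) : Module.Dual ℝ (TangentSpace (eisModel d) x) :=
  dY x - (D.b x.1 x.2.1).comp (dπS x)

/-- The Eisenhart metric
`g = π_S^* a_t + n ⊗ (dy - π_S^* b_t) + (dy - π_S^* b_t) ⊗ n - (2U + 1) n ⊗ n`. -/
def metric (x : ℝ × S × ℝ) : LinearMap.BilinForm ℝ (TangentSpace (eisModel d) x) :=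
  (D.a x.1 x.2.1).compl₁₂ (dπS x) (dπS x)
    + LinearMap.BilinForm.linMulLin (D.nForm x) (D.connForm x)
    + LinearMap.BilinForm.linMulLin (D.connForm x) (D.nForm x)
    - (2 * D.U x.1 x.2.1 + 1) • LinearMap.BilinForm.linMulLin (D.nForm x) (D.nForm x)

/-- `x` is a causal geodesic of the spacetime `T × S × ℝ`, on the interval `J`: a regular geodesic
whose velocity is nowhere spacelike. -/
def IsCausalGeodesicOn (J : Set ℝ) (x : ℝ → ℝ × S × ℝ) : Prop :=
  (∀ s ∈ J, (x s).1 ∈ D.T) ∧ IsGeodesicOn (eisModel d) D.metric J x ∧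
  ∀ s ∈ J, curveVelocity (eisModel d) J x s ≠ 0 ∧
    D.metric (x s) (curveVelocity (eisModel d) J x s) (curveVelocity (eisModel d) J x s) ≤ 0

/-- The functional `E_κ[q]`, where `κ = 1/μ`. -/
def action (κ t₀ t₁ : ℝ) (q : ℝ → S) : ℝ :=
  ∫ t in t₀..t₁,
    ((1 / (2 * D.ψ t (q t))) *
        D.a t (q t) (curveVelocity (𝓡 d) (Icc t₀ t₁) q t) (curveVelocity (𝓡 d) (Icc t₀ t₁) q t)
      + D.b t (q t) (curveVelocity (𝓡 d) (Icc t₀ t₁) q t)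
      - D.ψ t (q t) * (κ ^ 2 / 2 + 1 / 2 + D.U t (q t)))

/-- The `κ`-lift (`κ = 1/μ`) of the curve `(t, q(t))`, `t ∈ [t₀, t₁]`, starting at
`(t₀, q(t₀), y₀)`. -/
def lift (κ t₀ t₁ y₀ : ℝ) (q : ℝ → S) (t : ℝ) : ℝ × S × ℝ :=
  (t, q t, y₀ + ∫ t' in t₀..t,
    ((1 / (2 * D.ψ t' (q t'))) *
        D.a t' (q t') (curveVelocity (𝓡 d) (Icc t₀ t₁) q t')
          (curveVelocity (𝓡 d) (Icc t₀ t₁) q t')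
      + D.b t' (q t') (curveVelocity (𝓡 d) (Icc t₀ t₁) q t')
      + D.ψ t' (q t') * (κ ^ 2 / 2 - 1 / 2 - D.U t' (q t'))))

end EisenhartData

/-- The set of `C¹` curves `q : [t₀, t₁] → S` with `q(t₀) = q₀`, `q(t₁) = q₁`. -/
def C1Curves (d : ℕ) {S : Type*} [TopologicalSpace S] [ChartedSpace (EuclideanSpace ℝ (Fin d)) S]
    (t₀ t₁ : ℝ) (q₀ q₁ : S) : Set (ℝ → S) :=
  {q | ContMDiffOn 𝓘(ℝ, ℝ) (𝓡 d) 1 q (Icc t₀ t₁) ∧ q t₀ = q₀ ∧ q t₁ = q₁}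

/-- `Q` is a continuously differentiable one-parameter family (`|r| < ε`) in the space of `C¹`
curves with the endpoints of `q`, with `Q 0 = q`: the map `(r, t) ↦ Q r t` is continuous and in
every chart its derivatives `u = ∂_t`, `v = ∂_r` and `w = ∂_r ∂_t` exist and are jointly
continuous. -/
def IsVariation (t₀ t₁ : ℝ) (q : ℝ → S) (ε : ℝ) (Q : ℝ → ℝ → S) : Prop :=
  0 < ε ∧ (∀ t ∈ Icc t₀ t₁, Q 0 t = q t) ∧
  (∀ r ∈ Ioo (-ε) ε, Q r ∈ C1Curves d t₀ t₁ (q t₀) (q t₁)) ∧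
  ContinuousOn (fun z : ℝ × ℝ => Q z.1 z.2) (Ioo (-ε) ε ×ˢ Icc t₀ t₁) ∧
  ∀ p : S, ∃ u v w : ℝ × ℝ → EuclideanSpace ℝ (Fin d),
    let Ω : Set (ℝ × ℝ) := {z | z ∈ Ioo (-ε) ε ×ˢ Icc t₀ t₁ ∧
      Q z.1 z.2 ∈ (chartAt (EuclideanSpace ℝ (Fin d)) p).source}
    ContinuousOn u Ω ∧ ContinuousOn v Ω ∧ ContinuousOn w Ω ∧
    ∀ z ∈ Ω,
      HasDerivWithinAt (fun t => extChartAt (𝓡 d) p (Q z.1 t)) (u z) (Icc t₀ t₁) z.2 ∧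
      HasDerivAt (fun r => extChartAt (𝓡 d) p (Q r z.2)) (v z) z.1 ∧
      HasDerivAt (fun r => u (r, z.2)) (w z) z.1

/-- `q` is a stationary point of `E_κ` on the set of `C¹` curves on `[t₀, t₁]` with the endpoints
of `q`: it belongs to this set and the derivative of `E_κ` along every variation vanishes. -/
def EisenhartData.IsStationary (D : EisenhartData d S) (κ t₀ t₁ : ℝ) (q : ℝ → S) : Prop :=
  q ∈ C1Curves d t₀ t₁ (q t₀) (q t₁) ∧
  ∀ (ε : ℝ) (Q : ℝ → ℝ → S), IsVariation (d := d) t₀ t₁ q ε Q →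
    HasDerivAt (fun r => D.action κ t₀ t₁ (Q r)) 0 0

end Eisenhart

end

open Set Manifold
open scoped ContDiff Topology

noncomputable section

section IntervalCalculus

theorem Set.OrdConnected.uniqueDiffOn_real {J : Set ℝ} (hJ : J.OrdConnected) (hn : J.Nontrivial) :
    UniqueDiffOn ℝ J :=
  uniqueDiffOn_convex hJ.convex (hJ.convex.nontrivial_iff_nonempty_interior.1 hn)

theorem eqOn_const_of_hasDerivWithinAt_zero {J : Set ℝ} (hJ : J.OrdConnected) {f : ℝ → ℝ}
    (hf : ∀ s ∈ J, HasDerivWithinAt f 0 J s) {s s' : ℝ} (hs : s ∈ J) (hs' : s' ∈ J) :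
    f s = f s' := by
  have h := hJ.convex.norm_image_sub_le_of_norm_hasDerivWithin_le (f := f) (f' := fun _ => 0)
    (C := 0) hf (by simp) hs' hs
  simpa [sub_eq_zero] using h

theorem Set.OrdConnected.strictMonoOn_of_hasDerivWithinAt_pos {J : Set ℝ} (hJ : J.OrdConnected) {f f' : ℝ → ℝ}
    (hf : ∀ s ∈ J, HasDerivWithinAt f (f' s) J s) (hpos : ∀ s ∈ J, 0 < f' s) :
    StrictMonoOn f J := by
  refine strictMonoOn_of_deriv_pos hJ.convex (fun s hs => (hf s hs).continuousWithinAt) ?_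
  intro s hs
  have hs' := interior_subset hs
  rw [((hf s hs').hasDerivAt (mem_interior_iff_mem_nhds.1 hs)).deriv]
  exact hpos s hs'

theorem Set.OrdConnected.image_of_continuousOn {J : Set ℝ} (hJ : J.OrdConnected) {f : ℝ → ℝ}
    (hf : ContinuousOn f J) : (f '' J).OrdConnected :=
  (hJ.isPreconnected.image f hf).ordConnected

theorem StrictMonoOn.continuousOn_leftInverse {J : Set ℝ} (hJ : J.OrdConnected) {f g : ℝ → ℝ}
    (hf : ContinuousOn f J) (hm : StrictMonoOn f J) (hg : ∀ s ∈ J, g (f s) = s) :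
    ContinuousOn g (f '' J) := by
  have hI := hJ.image_of_continuousOn hf
  rw [continuousOn_iff_continuous_domRestrict]
  have h : (f '' J).domRestrict g = fun u => (((hm.orderIso f J).symm u : J) : ℝ) := by
    funext u
    obtain ⟨v, rfl⟩ := (hm.orderIso f J).surjective u
    simp only [domRestrict_apply, OrderIso.symm_apply_apply]
    exact hg v v.2
  rw [h]
  exact continuous_subtype_val.comp (hm.orderIso f J).symm.continuous

theorem hasDerivWithinAt_leftInverse {J : Set ℝ} {f g : ℝ → ℝ}
    (hc : ContinuousOn g (f '' J)) (hg : ∀ s ∈ J, g (f s) = s) {s f' : ℝ} (hs : s ∈ J)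
    (hf : HasDerivWithinAt f f' J s) (hf' : f' ≠ 0) :
    HasDerivWithinAt g f'⁻¹ (f '' J) (f s) := by
  rw [← hg s hs] at hf
  have ht : Filter.Tendsto g (𝓝[f '' J] f s) (𝓝[J] (g (f s))) := by
    refine tendsto_nhdsWithin_iff.2 ⟨hc _ (mem_image_of_mem f hs), ?_⟩
    filter_upwards [self_mem_nhdsWithin]
    rintro _ ⟨u, hu, rfl⟩
    rwa [hg u hu]
  have hF : HasFDerivWithinAt f
      ((ContinuousLinearEquiv.unitsEquivAut ℝ (Units.mk0 f' hf') : ℝ ≃L[ℝ] ℝ) : ℝ →L[ℝ] ℝ)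
      J (g (f s)) := by
    refine hf.hasFDerivWithinAt.congr_fderiv ?_
    ext; simp
  have := HasFDerivWithinAt.of_local_left_inverse ht hF (mem_image_of_mem f hs) ?_
  · refine this.hasDerivWithinAt.congr_deriv ?_
    simp
  · filter_upwards [self_mem_nhdsWithin]
    rintro _ ⟨u, hu, rfl⟩
    rw [hg u hu]

theorem contDiffOn_leftInverse {J : Set ℝ} (hJ : J.OrdConnected) (hn : J.Nontrivial)
    {f g f' : ℝ → ℝ} (hI : (f '' J).OrdConnected) (hIn : (f '' J).Nontrivial)
    (hc : ContinuousOn g (f '' J)) (hg : ∀ s ∈ J, g (f s) = s)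
    (hf : ∀ s ∈ J, HasDerivWithinAt f (f' s) J s) (hf' : ∀ s ∈ J, f' s ≠ 0) :
    ∀ n : ℕ, ContDiffOn ℝ n f J → ContDiffOn ℝ n g (f '' J) := by
  have hmaps : MapsTo g (f '' J) J := by
    rintro _ ⟨u, hu, rfl⟩
    rwa [hg u hu]
  have hJu := hJ.uniqueDiffOn_real hn
  have hIu := hI.uniqueDiffOn_real hIn
  intro n
  induction n with
  | zero => intro _; exact contDiffOn_zero.2 hc
  | succ n ih =>
    intro h
    rw [Nat.cast_succ, contDiffOn_succ_iff_derivWithin hJu] at h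
    rw [Nat.cast_succ, contDiffOn_succ_iff_derivWithin hIu]
    have hd : ∀ s ∈ J, HasDerivWithinAt g (f' s)⁻¹ (f '' J) (f s) := fun s hs =>
      hasDerivWithinAt_leftInverse hc hg hs (hf s hs) (hf' s hs)
    refine ⟨?_, by simp, ?_⟩
    · rintro _ ⟨s, hs, rfl⟩
      exact (hd s hs).differentiableWithinAt
    · have hfn : ContDiffOn ℝ n f J := by
        have : ContDiffOn ℝ ((n : ℕ∞ω) + 1) f J := (contDiffOn_succ_iff_derivWithin hJu).2 h
        exact this.of_le le_self_add
      have h1 : ContDiffOn ℝ n (fun t => (derivWithin f J (g t))⁻¹) (f '' J) := by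
        refine (h.2.2.comp (ih hfn) hmaps).inv ?_
        intro t ht
        have := hmaps ht
        simp only [Function.comp_apply]
        rw [(hf _ this).derivWithin (hJu _ this)]
        exact hf' _ this
      refine h1.congr ?_
      rintro _ ⟨s, hs, rfl⟩
      rw [(hd s hs).derivWithin (hIu _ (mem_image_of_mem f hs)), hg s hs,
        (hf s hs).derivWithin (hJu s hs)]

/-- A function with nonvanishing derivative of constant sign on an interval is a diffeomorphism
onto an interval. -/
theorem interval_inverse {J : Set ℝ} (hJ : J.OrdConnected) (hn : J.Nontrivial)
    {f f' : ℝ → ℝ} (hf : ∀ s ∈ J, HasDerivWithinAt f (f' s) J s)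
    (hsign : (∀ s ∈ J, 0 < f' s) ∨ (∀ s ∈ J, f' s < 0)) :
    (StrictMonoOn f J ∨ StrictAntiOn f J) ∧ (f '' J).OrdConnected ∧ (f '' J).Nontrivial ∧
      ∀ g : ℝ → ℝ, (∀ s ∈ J, g (f s) = s) →
        (∀ s ∈ J, HasDerivWithinAt g (f' s)⁻¹ (f '' J) (f s)) ∧
        ∀ n : ℕ, ContDiffOn ℝ n f J → ContDiffOn ℝ n g (f '' J) := by
  have hcf : ContinuousOn f J := fun s hs => (hf s hs).continuousWithinAt
  have hf0 : ∀ s ∈ J, f' s ≠ 0 := fun s hs => by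
    rcases hsign with h | h
    · exact (h s hs).ne'
    · exact (h s hs).ne
  have hI := hJ.image_of_continuousOn hcf
  have hmono : StrictMonoOn f J ∨ StrictAntiOn f J := by
    rcases hsign with h | h
    · exact Or.inl (Set.OrdConnected.strictMonoOn_of_hasDerivWithinAt_pos hJ hf h)
    · refine Or.inr ?_
      have := Set.OrdConnected.strictMonoOn_of_hasDerivWithinAt_pos hJ (fun s hs => (hf s hs).neg)
        (fun s hs => neg_pos.2 (h s hs))
      intro a ha b hb hab
      simpa using this ha hb hab
  have hinj : InjOn f J := hmono.elim StrictMonoOn.injOn StrictAntiOn.injOn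
  have hIn := hn.image_of_injOn hinj
  refine ⟨hmono, hI, hIn, fun g hg => ?_⟩
  have hc : ContinuousOn g (f '' J) := by
    rcases hmono with h | h
    · exact h.continuousOn_leftInverse hJ hcf hg
    · have hm : StrictMonoOn (fun s => -f s) J := fun a ha b hb hab => neg_lt_neg (h ha hb hab)
      have h1 := hm.continuousOn_leftInverse hJ hcf.neg (g := fun u => g (-u))
        (fun s hs => by simpa using hg s hs)
      have h2 : ContinuousOn ((fun u => g (-u)) ∘ fun u => -u) (f '' J) := by
        refine h1.comp continuous_neg.continuousOn ?_
        rintro _ ⟨s, hs, rfl⟩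
        exact ⟨s, hs, rfl⟩
      refine h2.congr ?_
      intro u _
      simp
  exact ⟨fun s hs => hasDerivWithinAt_leftInverse hc hg hs (hf s hs) (hf0 s hs),
    contDiffOn_leftInverse hJ hn hI hIn hc hg hf hf0⟩

variable {G : Type*} [NormedAddCommGroup G] [NormedSpace ℝ G]

theorem hasDerivWithinAt_integral_of_continuousOn [CompleteSpace G] {a b : ℝ} {f : ℝ → G} (hab : a < b)
    (hf : ContinuousOn f (Icc a b)) {t : ℝ} (ht : t ∈ Icc a b) :
    HasDerivWithinAt (fun t => ∫ s in a..t, f s) (f t) (Icc a b) t := by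
  have hc : Continuous (IccExtend hab.le ((Icc a b).domRestrict f)) :=
    (continuousOn_iff_continuous_domRestrict.1 hf).Icc_extend'
  have h := (hc.integral_hasStrictDerivAt a t).hasDerivAt.hasDerivWithinAt (s := Icc a b)
  have heq : ∀ s ∈ Icc a b, IccExtend hab.le ((Icc a b).domRestrict f) s = f s := fun s hs => by
    rw [IccExtend_of_mem hab.le _ hs]; rfl
  rw [heq t ht] at h
  refine h.congr_of_mem (fun u hu => ?_) ht
  refine intervalIntegral.integral_congr fun s hs => (heq s ?_).symm
  rw [uIcc_of_le hu.1] at hs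
  exact ⟨hs.1, hs.2.trans hu.2⟩

theorem integral_eq_sub_of_hasDerivWithinAt_Icc [CompleteSpace G] {a b : ℝ} {f f' : ℝ → G} (hab : a ≤ b)
    (hf : ∀ t ∈ Icc a b, HasDerivWithinAt f (f' t) (Icc a b) t)
    (hf' : ContinuousOn f' (Icc a b)) : ∫ t in a..b, f' t = f b - f a := by
  refine intervalIntegral.integral_eq_sub_of_hasDerivAt_of_le hab
    (fun t ht => (hf t ht).continuousWithinAt)
    (fun t ht => (hf t (Ioo_subset_Icc_self ht)).hasDerivAt (Icc_mem_nhds ht.1 ht.2)) ?_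
  exact ContinuousOn.intervalIntegrable (by rwa [uIcc_of_le hab])

theorem hasDerivAt_integral_param {a b δ : ℝ} (hab : a ≤ b) (hδ : 0 < δ) {f f' : ℝ × ℝ → G}
    (hf : ContinuousOn f (Ioo (-δ) δ ×ˢ Icc a b))
    (hf' : ContinuousOn f' (Ioo (-δ) δ ×ˢ Icc a b))
    (hd : ∀ z ∈ Ioo (-δ) δ ×ˢ Icc a b, HasDerivAt (fun r => f (r, z.2)) (f' z) z.1) :
    HasDerivAt (fun r => ∫ t in a..b, f (r, t)) (∫ t in a..b, f' (0, t)) 0 := by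
  have hsub : Icc (-(δ / 2)) (δ / 2) ×ˢ Icc a b ⊆ Ioo (-δ) δ ×ˢ Icc a b :=
    prod_mono (fun r hr => ⟨by linarith [hr.1], by linarith [hr.2]⟩) Subset.rfl
  obtain ⟨C, hC⟩ := (isCompact_Icc.prod isCompact_Icc).exists_bound_of_continuousOn
    (hf'.mono hsub)
  have hint : ∀ g : ℝ × ℝ → G, ContinuousOn g (Ioo (-δ) δ ×ˢ Icc a b) → ∀ r ∈ Ioo (-δ) δ,
      IntervalIntegrable (fun t => g (r, t)) MeasureTheory.volume a b := by
    intro g hg r hr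
    refine ContinuousOn.intervalIntegrable ?_
    rw [uIcc_of_le hab]
    exact hg.comp (by fun_prop) fun t ht => ⟨hr, ht⟩
  have h0 : (0 : ℝ) ∈ Ioo (-δ) δ := ⟨by linarith, hδ⟩
  refine (intervalIntegral.hasDerivAt_integral_of_dominated_loc_of_deriv_le
    (F := fun r t => f (r, t)) (F' := fun r t => f' (r, t)) (bound := fun _ => C)
    (s := Icc (-(δ / 2)) (δ / 2)) (Icc_mem_nhds (by linarith) (by linarith)) ?_ (hint f hf 0 h0)
    ?_ ?_ ?_ ?_).2
  · filter_upwards [Ioo_mem_nhds h0.1 h0.2] with r hr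
    exact (hint f hf r hr).def'.aestronglyMeasurable
  · exact (hint f' hf' 0 h0).def'.aestronglyMeasurable
  · refine Filter.Eventually.of_forall fun t ht r hr => hC (r, t) ⟨hr, ?_⟩
    rw [uIoc_of_le hab] at ht
    exact Ioc_subset_Icc_self ht
  · exact intervalIntegrable_const
  · refine Filter.Eventually.of_forall fun t ht r hr => ?_
    rw [uIoc_of_le hab] at ht
    exact hd (r, t) (hsub ⟨hr, Ioc_subset_Icc_self ht⟩)

end IntervalCalculus

section ChartCurves

theorem DifferentiableAt.hasDerivWithinAt_comp {E F : Type*} [NormedAddCommGroup E]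
    [NormedSpace ℝ E] [NormedAddCommGroup F] [NormedSpace ℝ F]
    {G : E → F} {J : Set ℝ} {s : ℝ} {c : ℝ → E} {c' : E} (h : DifferentiableAt ℝ G (c s)) (hc : HasDerivWithinAt c c' J s) :
    HasDerivWithinAt (fun s' => G (c s')) (fderiv ℝ G (c s) c') J s :=
  h.hasFDerivAt.comp_hasDerivWithinAt s hc

variable {E : Type*} [NormedAddCommGroup E] [NormedSpace ℝ E]
  {H : Type*} [TopologicalSpace H] (I : ModelWithCorners ℝ E H)
  {M : Type*} [TopologicalSpace M] [ChartedSpace H M]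

variable {I} in
theorem contMDiffWithinAt_curve_iff {n : ℕ∞ω} [IsManifold I n M] {x : ℝ → M} {J : Set ℝ} {s : ℝ}
    {p : M} (hs : x s ∈ (chartAt H p).source) :
    ContMDiffWithinAt 𝓘(ℝ, ℝ) I n x J s ↔
      ContinuousWithinAt x J s ∧ ContDiffWithinAt ℝ n (fun s' => extChartAt I p (x s')) J s := by
  rw [contMDiffWithinAt_iff_target_of_mem_source hs, contMDiffWithinAt_iff_contDiffWithinAt]
  rfl

theorem eventually_mem_chart_source {x : ℝ → M} {J : Set ℝ} {s : ℝ} {p : M}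
    (hc : ContinuousWithinAt x J s) (hs : x s ∈ (chartAt H p).source) :
    ∀ᶠ s' in 𝓝[J] s, x s' ∈ (chartAt H p).source :=
  hc ((chartAt H p).open_source.mem_nhds hs)

theorem bilinForm_congr_point (g : ∀ x : M, LinearMap.BilinForm ℝ (TangentSpace I x)) {x x' : M}
    (h : x = x') (v w : E) : @Eq ℝ (g x v w) (g x' v w) := by
  subst h; rfl

theorem chartVector_add (p : M) (z u v : E) :
    chartVector I p z (u + v) = chartVector I p z u + chartVector I p z v :=
  ContinuousLinearMap.map_add _ u v

theorem chartVector_smul (p : M) (z : E) (c : ℝ) (u : E) :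
    chartVector I p z (c • u) = c • chartVector I p z u :=
  ContinuousLinearMap.map_smul _ c u

theorem metricInChart_eq_of_mem (g : ∀ x : M, LinearMap.BilinForm ℝ (TangentSpace I x)) {x p : M}
    (hx : x ∈ (chartAt H p).source) {V W : TangentSpace I x} {v w : E}
    (hV : @Eq E V (chartVector I p (extChartAt I p x) v))
    (hW : @Eq E W (chartVector I p (extChartAt I p x) w)) :
    metricInChart I g p (extChartAt I p x) v w = g x V W := by
  have h : (extChartAt I p).symm (extChartAt I p x) = x :=
    (extChartAt I p).left_inv (by rwa [extChartAt_source])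
  have h1 := bilinForm_congr_point I g h V W
  rw [← h1]
  unfold metricInChart
  congr 1
  · congr 1
    exact hV.symm
  · exact hW.symm

variable [I.Boundaryless]

theorem hasMFDerivAt_chart_symm [IsManifold I 1 M] {p : M} {z : E}
    (hz : z ∈ (extChartAt I p).target) :
    HasMFDerivAt 𝓘(ℝ, E) I (extChartAt I p).symm z
      (mfderiv 𝓘(ℝ, E) I (extChartAt I p).symm z) := by
  have h := (mdifferentiableOn_extChartAt_symm (I := I) (x := p)) z hz
  exact (h.mdifferentiableAt ((isOpen_extChartAt_target p).mem_nhds hz)).hasMFDerivAt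

theorem hasMFDerivWithinAt_of_chart [IsManifold I 1 M] {x : ℝ → M} {J : Set ℝ} {s : ℝ} {p : M}
    {c' : E} (hc : ContinuousWithinAt x J s) (hs : x s ∈ (chartAt H p).source)
    (hd : HasDerivWithinAt (fun s' => extChartAt I p (x s')) c' J s) :
    HasMFDerivWithinAt 𝓘(ℝ, ℝ) I x J s
      ((mfderiv 𝓘(ℝ, E) I (extChartAt I p).symm (extChartAt I p (x s)) : E →L[ℝ] E).comp
        (ContinuousLinearMap.toSpanSingleton ℝ c')) := by
  have hs' : x s ∈ (extChartAt I p).source := by rwa [extChartAt_source]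
  have h1 := hasMFDerivAt_chart_symm I ((extChartAt I p).map_source hs')
  have h2 := HasMFDerivAt.comp_hasMFDerivWithinAt s h1 hd.hasFDerivWithinAt.hasMFDerivWithinAt
  refine h2.congr_of_eventuallyEq ?_ ?_
  · filter_upwards [eventually_mem_chart_source hc hs] with s' hs'
    exact ((extChartAt I p).left_inv (by rwa [extChartAt_source])).symm
  · exact ((extChartAt I p).left_inv hs').symm

theorem curveVelocity_eq_chartVector [IsManifold I 1 M] {x : ℝ → M} {J : Set ℝ} {s : ℝ} {p : M}
    {c' : E} (hc : ContinuousWithinAt x J s) (hs : x s ∈ (chartAt H p).source)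
    (hd : HasDerivWithinAt (fun s' => extChartAt I p (x s')) c' J s)
    (hu : UniqueDiffWithinAt ℝ J s) :
    @Eq E (curveVelocity I J x s) (chartVector I p (extChartAt I p (x s)) c') := by
  have h := (hasMFDerivWithinAt_of_chart I hc hs hd).mfderivWithin
    (uniqueMDiffWithinAt_iff_uniqueDiffWithinAt.2 hu)
  have h' := DFunLike.congr_fun h (1 : ℝ)
  refine Eq.trans h' ?_
  change mfderiv 𝓘(ℝ, E) I (extChartAt I p).symm (extChartAt I p (x s)) ((1 : ℝ) • c') = _
  rw [one_smul]
  rfl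

end ChartCurves

section Geodesics

variable {E : Type*} [NormedAddCommGroup E] [NormedSpace ℝ E] [FiniteDimensional ℝ E]
  {H : Type*} [TopologicalSpace H] (I : ModelWithCorners ℝ E H)
  {M : Type*} [TopologicalSpace M] [ChartedSpace H M]
  (g : ∀ x : M, LinearMap.BilinForm ℝ (TangentSpace I x)) (p : M)

/-- The components of a covariant 2-tensor in a chart, as a continuous bilinear map. -/
def metricCLM (z : E) : E →L[ℝ] E →L[ℝ] ℝ :=
  LinearMap.toContinuousLinearMap
    ((LinearMap.toContinuousLinearMap : (E →ₗ[ℝ] ℝ) ≃ₗ[ℝ] (E →L[ℝ] ℝ)).toLinearMap ∘ₗ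
      LinearMap.mk₂ ℝ (metricInChart I g p z)
        (fun u v w => by simp only [metricInChart, chartVector_add, map_add, LinearMap.add_apply])
        (fun c u v => by
          simp only [metricInChart, chartVector_smul, map_smul, LinearMap.smul_apply])
        (fun u v w => by simp only [metricInChart, chartVector_add, map_add])
        (fun c u v => by simp only [metricInChart, chartVector_smul, map_smul]))

@[simp]
theorem metricCLM_apply (z v w : E) : metricCLM I g p z v w = metricInChart I g p z v w := rfl

/-- The components of the covariant acceleration, with the index lowered. -/
def geodesicResidual (z c₁ c₂ v : E) : ℝ :=
  metricInChart I g p z c₂ v + christoffelFirst I g p z c₁ c₁ v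

variable {g p} {z : E}

theorem HasFDerivAt.metricInChart {G' : E →L[ℝ] E →L[ℝ] E →L[ℝ] ℝ}
    (h : HasFDerivAt (metricCLM I g p) G' z) (v w : E) :
    HasFDerivAt (fun z' => metricInChart I g p z' v w) ((G'.flip v).flip w) z := by
  have h1 := (h.clm_apply (hasFDerivAt_const v z)).clm_apply (hasFDerivAt_const w z)
  refine h1.congr_fderiv ?_
  ext u
  simp

theorem geodesicResidual_eq {G' : E →L[ℝ] E →L[ℝ] E →L[ℝ] ℝ}
    (h : HasFDerivAt (metricCLM I g p) G' z) (c₁ c₂ v : E) :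
    geodesicResidual I g p z c₁ c₂ v =
      metricCLM I g p z c₂ v + G' c₁ c₁ v - 1 / 2 * G' v c₁ c₁ := by
  unfold geodesicResidual christoffelFirst
  rw [(h.metricInChart I c₁ v).fderiv, (h.metricInChart I c₁ c₁).fderiv]
  simp only [metricCLM_apply, ContinuousLinearMap.flip_apply]
  ring

variable {J : Set ℝ} {s : ℝ} {c c₁ : ℝ → E} {c₂ : E}

theorem hasDerivWithinAt_metricInChart_velocity
    (h : DifferentiableAt ℝ (metricCLM I g p) (c s)) (hc : HasDerivWithinAt c (c₁ s) J s)
    (hc₁ : HasDerivWithinAt c₁ c₂ J s) (v : E) :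
    HasDerivWithinAt (fun s' => metricInChart I g p (c s') (c₁ s') v)
      (geodesicResidual I g p (c s) (c₁ s) c₂ v
        + 1 / 2 * fderiv ℝ (fun z => metricInChart I g p z (c₁ s) (c₁ s)) (c s) v) J s := by
  have hG := h.hasFDerivAt
  have h0 := h.hasDerivWithinAt_comp (F := E →L[ℝ] E →L[ℝ] ℝ) hc
  have h1 : HasDerivWithinAt (fun s' => metricCLM I g p (c s') (c₁ s') v) _ J s :=
    (h0.clm_apply hc₁).clm_apply (hasDerivWithinAt_const s J v)
  refine h1.congr_deriv ?_
  rw [geodesicResidual_eq I hG, (hG.metricInChart I _ _).fderiv, map_zero]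
  simp
  ring

theorem hasDerivWithinAt_metricInChart_energy
    (h : DifferentiableAt ℝ (metricCLM I g p) (c s)) (hc : HasDerivWithinAt c (c₁ s) J s)
    (hc₁ : HasDerivWithinAt c₁ c₂ J s)
    (hsymm : metricInChart I g p (c s) (c₁ s) c₂ = metricInChart I g p (c s) c₂ (c₁ s)) :
    HasDerivWithinAt (fun s' => metricInChart I g p (c s') (c₁ s') (c₁ s'))
      (2 * geodesicResidual I g p (c s) (c₁ s) c₂ (c₁ s)) J s := by
  have hG := h.hasFDerivAt
  have h0 := h.hasDerivWithinAt_comp (F := E →L[ℝ] E →L[ℝ] ℝ) hc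
  have h1 : HasDerivWithinAt (fun s' => metricCLM I g p (c s') (c₁ s') (c₁ s')) _ J s :=
    (h0.clm_apply hc₁).clm_apply hc₁
  refine h1.congr_deriv ?_
  rw [geodesicResidual_eq I hG]
  simp [hsymm]
  ring

end Geodesics

section EisenhartChart

variable {d : ℕ} {S : Type*} [TopologicalSpace S] [ChartedSpace (EuclideanSpace ℝ (Fin d)) S]

theorem extChartAt_eisModel (p x : ℝ × S × ℝ) :
    extChartAt (eisModel d) p x = (x.1, extChartAt (𝓡 d) p.2.1 x.2.1, x.2.2) := by
  simp
  exact ⟨rfl, rfl⟩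

theorem extChartAt_eisModel_symm (p : ℝ × S × ℝ) (z : ℝ × EuclideanSpace ℝ (Fin d) × ℝ) :
    (extChartAt (eisModel d) p).symm z = (z.1, (extChartAt (𝓡 d) p.2.1).symm z.2.1, z.2.2) := by
  simp
  rfl

theorem mem_chartAt_source_eisModel {p x : ℝ × S × ℝ} :
    x ∈ (chartAt (ModelProd ℝ (ModelProd (EuclideanSpace ℝ (Fin d)) ℝ)) p).source ↔
      x.2.1 ∈ (chartAt (EuclideanSpace ℝ (Fin d)) p.2.1).source := by
  simp only [prodChartedSpace_chartAt, OpenPartialHomeomorph.prod_source, mem_prod]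
  exact ⟨fun h => h.2.1, fun h => ⟨trivial, h, trivial⟩⟩

theorem dT_apply (x : ℝ × S × ℝ) (V : ℝ × EuclideanSpace ℝ (Fin d) × ℝ) :
    @Eq ℝ (dT (d := d) x V) V.1 := by
  unfold dT
  rw [mfderiv_fst]
  rfl

theorem dπS_apply (x : ℝ × S × ℝ) (V : ℝ × EuclideanSpace ℝ (Fin d) × ℝ) :
    @Eq (EuclideanSpace ℝ (Fin d)) (dπS (d := d) x V) V.2.1 := by
  unfold dπS
  have h := (hasMFDerivAt_fst (I := 𝓡 d) (I' := 𝓘(ℝ, ℝ)) x.2).comp x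
    (hasMFDerivAt_snd (I := 𝓘(ℝ, ℝ)) (I' := (𝓡 d).prod 𝓘(ℝ, ℝ)) x)
  have h' := h.mfderiv
  change (mfderiv (eisModel d) (𝓡 d) (fun x' : ℝ × S × ℝ => x'.2.1) x) V = _
  erw [h']
  rfl

theorem dY_apply (x : ℝ × S × ℝ) (V : ℝ × EuclideanSpace ℝ (Fin d) × ℝ) :
    @Eq ℝ (dY (d := d) x V) V.2.2 := by
  unfold dY
  have h := (hasMFDerivAt_snd (I := 𝓡 d) (I' := 𝓘(ℝ, ℝ)) x.2).comp x
    (hasMFDerivAt_snd (I := 𝓘(ℝ, ℝ)) (I' := (𝓡 d).prod 𝓘(ℝ, ℝ)) x)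
  have h' := h.mfderiv
  change (mfderiv (eisModel d) 𝓘(ℝ, ℝ) (fun x' : ℝ × S × ℝ => x'.2.2) x) V = _
  erw [h']
  rfl

theorem killingN_eq (x : ℝ × S × ℝ) :
    @Eq (ℝ × EuclideanSpace ℝ (Fin d) × ℝ) (killingN (d := d) x) (0, 0, 1) := by
  unfold killingN
  have h := (hasMFDerivAt_const (I := 𝓘(ℝ, ℝ)) (I' := 𝓘(ℝ, ℝ)) x.1 x.2.2).prodMk
    ((hasMFDerivAt_const (I := 𝓘(ℝ, ℝ)) (I' := 𝓡 d) x.2.1 x.2.2).prodMk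
      (hasMFDerivAt_id (I := 𝓘(ℝ, ℝ)) x.2.2))
  have h' := h.mfderiv
  erw [h']
  rfl

theorem chartVector_eisModel [IsManifold (𝓡 d) 1 S] (p : ℝ × S × ℝ)
    {z : ℝ × EuclideanSpace ℝ (Fin d) × ℝ} (hz : z.2.1 ∈ (extChartAt (𝓡 d) p.2.1).target)
    (V : ℝ × EuclideanSpace ℝ (Fin d) × ℝ) :
    @Eq (ℝ × EuclideanSpace ℝ (Fin d) × ℝ) (chartVector (eisModel d) p z V)
      (V.1, chartVector (𝓡 d) p.2.1 z.2.1 V.2.1, V.2.2) := by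
  have hfun : ((extChartAt (eisModel d) p).symm : ℝ × EuclideanSpace ℝ (Fin d) × ℝ → ℝ × S × ℝ) =
      fun z => (z.1, (extChartAt (𝓡 d) p.2.1).symm z.2.1, z.2.2) := by
    funext z
    rw [extChartAt_eisModel_symm]
  have h1 := (hasFDerivAt_fst (𝕜 := ℝ) (p := z)).hasMFDerivAt
  have h2 := (hasFDerivAt_snd (𝕜 := ℝ) (p := z)).fst.hasMFDerivAt
  have h3 := (hasFDerivAt_snd (𝕜 := ℝ) (p := z)).snd.hasMFDerivAt
  have h := h1.prodMk (((hasMFDerivAt_chart_symm (𝓡 d) hz).comp z h2).prodMk h3)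
  have h' := DFunLike.congr_fun h.mfderiv V
  unfold chartVector
  rw [hfun]
  exact h'

end EisenhartChart

namespace EisenhartData

variable {d : ℕ} {S : Type*} [TopologicalSpace S] [ChartedSpace (EuclideanSpace ℝ (Fin d)) S]
  (D : EisenhartData d S)

/-- The components of `a` in the chart around `p`. -/
def aChart (p : S) (e : ℝ × EuclideanSpace ℝ (Fin d)) :
    EuclideanSpace ℝ (Fin d) →L[ℝ] EuclideanSpace ℝ (Fin d) →L[ℝ] ℝ :=
  metricCLM (𝓡 d) (D.a e.1) p e.2

/-- The components of `b` in the chart around `p`. -/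
def bChart (p : S) (e : ℝ × EuclideanSpace ℝ (Fin d)) : EuclideanSpace ℝ (Fin d) →L[ℝ] ℝ :=
  LinearMap.toContinuousLinearMap ((D.b e.1 ((extChartAt (𝓡 d) p).symm e.2)).comp
    (mfderiv 𝓘(ℝ, EuclideanSpace ℝ (Fin d)) (𝓡 d) (extChartAt (𝓡 d) p).symm e.2).toLinearMap)

/-- The scalar `U` in the chart around `p`. -/
def uChart (p : S) (e : ℝ × EuclideanSpace ℝ (Fin d)) : ℝ :=
  D.U e.1 ((extChartAt (𝓡 d) p).symm e.2)

/-- The scalar `ψ` in the chart around `p`. -/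
def ψChart (p : S) (e : ℝ × EuclideanSpace ℝ (Fin d)) : ℝ :=
  D.ψ e.1 ((extChartAt (𝓡 d) p).symm e.2)

/-- The domain of the chart representations of the fields. -/
def chartDomain (p : S) : Set (ℝ × EuclideanSpace ℝ (Fin d)) :=
  D.T ×ˢ (extChartAt (𝓡 d) p).target

theorem isOpen_chartDomain (p : S) : IsOpen (D.chartDomain p) :=
  D.isOpen_T.prod (isOpen_extChartAt_target p)

variable {D} in
theorem mem_chartDomain {p : S} {t : ℝ} {q : S} (ht : t ∈ D.T)
    (hq : q ∈ (chartAt (EuclideanSpace ℝ (Fin d)) p).source) :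
    (t, extChartAt (𝓡 d) p q) ∈ D.chartDomain p :=
  ⟨ht, (extChartAt (𝓡 d) p).map_source (by rwa [extChartAt_source])⟩

theorem contDiffOn_aChart (p : S) : ContDiffOn ℝ 1 (D.aChart p) (D.chartDomain p) := by
  rw [contDiffOn_clm_apply]
  intro v
  rw [contDiffOn_clm_apply]
  exact fun w => D.contDiffOn_a p v w

theorem contDiffOn_bChart (p : S) : ContDiffOn ℝ 1 (D.bChart p) (D.chartDomain p) := by
  rw [contDiffOn_clm_apply]
  exact fun v => D.contDiffOn_b p v

theorem contDiffOn_chart_of_contMDiffOn [IsManifold (𝓡 d) 1 S] {f : ℝ × S → ℝ}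
    (hf : ContMDiffOn (𝓘(ℝ, ℝ).prod (𝓡 d)) 𝓘(ℝ, ℝ) 1 f (D.T ×ˢ univ)) (p : S) :
    ContDiffOn ℝ 1 (fun e : ℝ × EuclideanSpace ℝ (Fin d) =>
      f (e.1, (extChartAt (𝓡 d) p).symm e.2)) (D.chartDomain p) := by
  rw [← contMDiffOn_iff_contDiffOn]
  have h1 : ContMDiffOn 𝓘(ℝ, ℝ × EuclideanSpace ℝ (Fin d)) (𝓡 d) 1
      (fun e : ℝ × EuclideanSpace ℝ (Fin d) => (extChartAt (𝓡 d) p).symm e.2)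
      (D.chartDomain p) :=
    (contMDiffOn_extChartAt_symm p).comp contDiff_snd.contMDiff.contMDiffOn fun e he => he.2
  have h2 : ContMDiffOn 𝓘(ℝ, ℝ × EuclideanSpace ℝ (Fin d)) 𝓘(ℝ, ℝ) 1
      (fun e : ℝ × EuclideanSpace ℝ (Fin d) => e.1) (D.chartDomain p) :=
    contDiff_fst.contMDiff.contMDiffOn
  exact hf.comp (h2.prodMk h1) fun e he => ⟨he.1, trivial⟩

theorem contDiffOn_uChart [IsManifold (𝓡 d) 1 S] (p : S) :
    ContDiffOn ℝ 1 (D.uChart p) (D.chartDomain p) :=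
  D.contDiffOn_chart_of_contMDiffOn D.contMDiffOn_U p

theorem contDiffOn_ψChart [IsManifold (𝓡 d) 1 S] (p : S) :
    ContDiffOn ℝ 1 (D.ψChart p) (D.chartDomain p) :=
  D.contDiffOn_chart_of_contMDiffOn D.contMDiffOn_ψ p

variable {D} in
theorem ψChart_pos {p : S} {e : ℝ × EuclideanSpace ℝ (Fin d)} (he : e ∈ D.chartDomain p) :
    0 < D.ψChart p e := D.ψ_pos _ he.1 _

variable {D} in
theorem aChart_symm {p : S} {e : ℝ × EuclideanSpace ℝ (Fin d)} (he : e ∈ D.chartDomain p)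
    (v w : EuclideanSpace ℝ (Fin d)) : D.aChart p e v w = D.aChart p e w v :=
  D.a_symm _ he.1 _ _ _

theorem metric_apply (x : ℝ × S × ℝ) (V W : ℝ × EuclideanSpace ℝ (Fin d) × ℝ) :
    @Eq ℝ (D.metric x V W)
      (D.a x.1 x.2.1 V.2.1 W.2.1
        - D.ψ x.1 x.2.1 * V.1 * (W.2.2 - D.b x.1 x.2.1 W.2.1)
        - D.ψ x.1 x.2.1 * W.1 * (V.2.2 - D.b x.1 x.2.1 V.2.1)
        - (2 * D.U x.1 x.2.1 + 1) * D.ψ x.1 x.2.1 ^ 2 * V.1 * W.1) := by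
  have h : @Eq ℝ (D.metric x V W)
      (D.a x.1 x.2.1 (dπS x V) (dπS x W)
        + -(D.ψ x.1 x.2.1 * dT (d := d) x V) * (dY (d := d) x W - D.b x.1 x.2.1 (dπS x W))
        + (dY (d := d) x V - D.b x.1 x.2.1 (dπS x V)) * -(D.ψ x.1 x.2.1 * dT (d := d) x W)
        - (2 * D.U x.1 x.2.1 + 1) * (-(D.ψ x.1 x.2.1 * dT (d := d) x V)
          * -(D.ψ x.1 x.2.1 * dT (d := d) x W))) := rfl
  rw [h, dT_apply, dT_apply, dY_apply, dY_apply, dπS_apply, dπS_apply]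
  ring

/-- The Eisenhart metric in adapted coordinates. -/
theorem metricInChart_metric [IsManifold (𝓡 d) 1 S] (p : ℝ × S × ℝ)
    {z : ℝ × EuclideanSpace ℝ (Fin d) × ℝ} (hz : z.2.1 ∈ (extChartAt (𝓡 d) p.2.1).target)
    (V W : ℝ × EuclideanSpace ℝ (Fin d) × ℝ) :
    metricInChart (eisModel d) D.metric p z V W =
      D.aChart p.2.1 (z.1, z.2.1) V.2.1 W.2.1
        - D.ψChart p.2.1 (z.1, z.2.1) * V.1 * (W.2.2 - D.bChart p.2.1 (z.1, z.2.1) W.2.1)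
        - D.ψChart p.2.1 (z.1, z.2.1) * W.1 * (V.2.2 - D.bChart p.2.1 (z.1, z.2.1) V.2.1)
        - (2 * D.uChart p.2.1 (z.1, z.2.1) + 1) * D.ψChart p.2.1 (z.1, z.2.1) ^ 2
          * V.1 * W.1 := by
  have h0 : ∀ V', @Eq (ℝ × EuclideanSpace ℝ (Fin d) × ℝ) (chartVector (eisModel d) p z V') _ :=
    chartVector_eisModel p hz
  have h1 : metricInChart (eisModel d) D.metric p z V W = D.metric
      (z.1, (extChartAt (𝓡 d) p.2.1).symm z.2.1, z.2.2)
      (V.1, chartVector (𝓡 d) p.2.1 z.2.1 V.2.1, V.2.2)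
      (W.1, chartVector (𝓡 d) p.2.1 z.2.1 W.2.1, W.2.2) := by
    refine Eq.trans ?_ (bilinForm_congr_point (eisModel d) D.metric
      (extChartAt_eisModel_symm (d := d) p z) _ _)
    unfold metricInChart
    rw [← h0 V, ← h0 W]
  rw [h1]
  exact D.metric_apply _ _ _

theorem contDiffOn_metricCLM [IsManifold (𝓡 d) 1 S] (p : ℝ × S × ℝ) :
    ContDiffOn ℝ 1 (metricCLM (eisModel d) D.metric p)
      ((fun z : ℝ × EuclideanSpace ℝ (Fin d) × ℝ => (z.1, z.2.1)) ⁻¹' D.chartDomain p.2.1) := by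
  rw [contDiffOn_clm_apply]
  intro V
  rw [contDiffOn_clm_apply]
  intro W
  have hmaps : MapsTo (fun z : ℝ × EuclideanSpace ℝ (Fin d) × ℝ => (z.1, z.2.1))
    ((fun z : ℝ × EuclideanSpace ℝ (Fin d) × ℝ => (z.1, z.2.1)) ⁻¹' D.chartDomain p.2.1)
    (D.chartDomain p.2.1) := fun z hz => hz
  have hpr : ContDiffOn ℝ 1 (fun z : ℝ × EuclideanSpace ℝ (Fin d) × ℝ => (z.1, z.2.1))
    ((fun z : ℝ × EuclideanSpace ℝ (Fin d) × ℝ => (z.1, z.2.1)) ⁻¹' D.chartDomain p.2.1) := by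
    fun_prop
  have hA := (((D.contDiffOn_aChart p.2.1).comp hpr hmaps).clm_apply
    (contDiffOn_const (c := V.2.1))).clm_apply (contDiffOn_const (c := W.2.1))
  have hbV := ((D.contDiffOn_bChart p.2.1).comp hpr hmaps).clm_apply
    (contDiffOn_const (c := V.2.1))
  have hbW := ((D.contDiffOn_bChart p.2.1).comp hpr hmaps).clm_apply
    (contDiffOn_const (c := W.2.1))
  have hψ := (D.contDiffOn_ψChart p.2.1).comp hpr hmaps
  have hU := (D.contDiffOn_uChart p.2.1).comp hpr hmaps
  refine ContDiffOn.congr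
    (((hA.sub ((hψ.mul (contDiffOn_const (c := V.1))).mul
      ((contDiffOn_const (c := W.2.2)).sub hbW))).sub
      ((hψ.mul (contDiffOn_const (c := W.1))).mul ((contDiffOn_const (c := V.2.2)).sub hbV))).sub
      ((((((contDiffOn_const (c := (2 : ℝ))).mul hU).add (contDiffOn_const (c := (1 : ℝ)))).mul
        (hψ.pow 2)).mul (contDiffOn_const (c := V.1))).mul (contDiffOn_const (c := W.1)))) ?_
  intro z hz
  exact D.metricInChart_metric p hz.2 V W

theorem differentiableAt_metricCLM [IsManifold (𝓡 d) 1 S] (p : ℝ × S × ℝ)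
    {z : ℝ × EuclideanSpace ℝ (Fin d) × ℝ} (hz : (z.1, z.2.1) ∈ D.chartDomain p.2.1) :
    DifferentiableAt ℝ (metricCLM (eisModel d) D.metric p) z := by
  refine ((D.contDiffOn_metricCLM p).differentiableOn one_ne_zero).differentiableAt ?_
  exact ((D.isOpen_chartDomain p.2.1).preimage (by fun_prop)).mem_nhds hz

/-- The Lagrangian in the chart around `p`, as a function of `((t, z), u)`. -/
def lagrangian (c : ℝ) (p : S)
    (w : (ℝ × EuclideanSpace ℝ (Fin d)) × EuclideanSpace ℝ (Fin d)) : ℝ :=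
  (1 / (2 * D.ψChart p w.1)) * D.aChart p w.1 w.2 w.2 + D.bChart p w.1 w.2
    - D.ψChart p w.1 * (c + 1 / 2 + D.uChart p w.1)

/-- The momentum conjugate to the velocity, in the chart around `p`. -/
def momentum (p : S) (w : (ℝ × EuclideanSpace ℝ (Fin d)) × EuclideanSpace ℝ (Fin d)) :
    EuclideanSpace ℝ (Fin d) →L[ℝ] ℝ :=
  (D.ψChart p w.1)⁻¹ • D.aChart p w.1 w.2 + D.bChart p w.1

/-- The derivative of the Lagrangian with respect to the position, in the chart around `p`. -/
def force (c : ℝ) (p : S)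
    (w : (ℝ × EuclideanSpace ℝ (Fin d)) × EuclideanSpace ℝ (Fin d)) :
    EuclideanSpace ℝ (Fin d) →L[ℝ] ℝ :=
  fderiv ℝ (fun z => D.lagrangian c p ((w.1.1, z), w.2)) w.1.2

/-- The domain of the chart representation of the Lagrangian. -/
def lagrangianDomain (p : S) :
    Set ((ℝ × EuclideanSpace ℝ (Fin d)) × EuclideanSpace ℝ (Fin d)) :=
  Prod.fst ⁻¹' D.chartDomain p

theorem isOpen_lagrangianDomain (p : S) : IsOpen (D.lagrangianDomain p) :=
  (D.isOpen_chartDomain p).preimage continuous_fst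

section Smoothness

variable [IsManifold (𝓡 d) 1 S]

theorem contDiffOn_lagrangian (c : ℝ) (p : S) :
    ContDiffOn ℝ 1 (D.lagrangian c p) (D.lagrangianDomain p) := by
  have hpr : ContDiffOn ℝ 1 (Prod.fst : (ℝ × EuclideanSpace ℝ (Fin d)) ×
    EuclideanSpace ℝ (Fin d) → _) (D.lagrangianDomain p) := contDiff_fst.contDiffOn
  have hsn : ContDiffOn ℝ 1 (Prod.snd : (ℝ × EuclideanSpace ℝ (Fin d)) ×
    EuclideanSpace ℝ (Fin d) → _) (D.lagrangianDomain p) := contDiff_snd.contDiffOn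
  have hm : MapsTo (Prod.fst : (ℝ × EuclideanSpace ℝ (Fin d)) ×
    EuclideanSpace ℝ (Fin d) → _) (D.lagrangianDomain p) (D.chartDomain p) := fun _ h => h
  have hA := (((D.contDiffOn_aChart p).comp hpr hm).clm_apply hsn).clm_apply hsn
  have hb := ((D.contDiffOn_bChart p).comp hpr hm).clm_apply hsn
  have hψ := (D.contDiffOn_ψChart p).comp hpr hm
  have hU := (D.contDiffOn_uChart p).comp hpr hm
  exact (((contDiffOn_const.div ((contDiffOn_const (c := (2 : ℝ))).mul hψ)
    (fun w hw => mul_ne_zero two_ne_zero (ψChart_pos hw).ne')).mul hA).add hb).sub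
    (hψ.mul ((contDiffOn_const (c := c + 1 / 2)).add hU))

theorem contDiffOn_momentum (p : S) :
    ContDiffOn ℝ 1 (D.momentum p) (D.lagrangianDomain p) := by
  have hpr : ContDiffOn ℝ 1 (Prod.fst : (ℝ × EuclideanSpace ℝ (Fin d)) ×
    EuclideanSpace ℝ (Fin d) → _) (D.lagrangianDomain p) := contDiff_fst.contDiffOn
  have hsn : ContDiffOn ℝ 1 (Prod.snd : (ℝ × EuclideanSpace ℝ (Fin d)) ×
    EuclideanSpace ℝ (Fin d) → _) (D.lagrangianDomain p) := contDiff_snd.contDiffOn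
  have hm : MapsTo (Prod.fst : (ℝ × EuclideanSpace ℝ (Fin d)) ×
    EuclideanSpace ℝ (Fin d) → _) (D.lagrangianDomain p) (D.chartDomain p) := fun _ h => h
  exact ((((D.contDiffOn_ψChart p).comp hpr hm).inv (fun w hw => (ψChart_pos hw).ne')).smul
    (((D.contDiffOn_aChart p).comp hpr hm).clm_apply hsn)).add
    ((D.contDiffOn_bChart p).comp hpr hm)

variable {D} {p : S} {w : (ℝ × EuclideanSpace ℝ (Fin d)) × EuclideanSpace ℝ (Fin d)} {c : ℝ}

theorem differentiableAt_lagrangian (hw : w ∈ D.lagrangianDomain p) :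
    DifferentiableAt ℝ (D.lagrangian c p) w :=
  ((D.contDiffOn_lagrangian c p).differentiableOn one_ne_zero).differentiableAt
    ((D.isOpen_lagrangianDomain p).mem_nhds hw)

theorem hasFDerivAt_lagrangian_position (hw : w ∈ D.lagrangianDomain p) :
    HasFDerivAt (fun z => D.lagrangian c p ((w.1.1, z), w.2))
      ((fderiv ℝ (D.lagrangian c p) w).comp
        ((ContinuousLinearMap.inl ℝ (ℝ × EuclideanSpace ℝ (Fin d)) (EuclideanSpace ℝ (Fin d))).comp
          (ContinuousLinearMap.inr ℝ ℝ (EuclideanSpace ℝ (Fin d))))) w.1.2 := by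
  have h1 : HasFDerivAt (fun z : EuclideanSpace ℝ (Fin d) => ((w.1.1, z), w.2))
      ((ContinuousLinearMap.inl ℝ (ℝ × EuclideanSpace ℝ (Fin d)) (EuclideanSpace ℝ (Fin d))).comp
        (ContinuousLinearMap.inr ℝ ℝ (EuclideanSpace ℝ (Fin d)))) w.1.2 :=
    (((hasFDerivAt_const w.1.1 w.1.2).prodMk (hasFDerivAt_id w.1.2)).prodMk
      (hasFDerivAt_const w.2 w.1.2)).congr_fderiv (by ext <;> simp)
  exact (differentiableAt_lagrangian (c := c) hw).hasFDerivAt.comp w.1.2 h1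

theorem force_eq (hw : w ∈ D.lagrangianDomain p) :
    D.force c p w = (fderiv ℝ (D.lagrangian c p) w).comp
        ((ContinuousLinearMap.inl ℝ (ℝ × EuclideanSpace ℝ (Fin d)) (EuclideanSpace ℝ (Fin d))).comp
          (ContinuousLinearMap.inr ℝ ℝ (EuclideanSpace ℝ (Fin d)))) :=
  (hasFDerivAt_lagrangian_position hw).fderiv

theorem continuousOn_force : ContinuousOn (D.force c p) (D.lagrangianDomain p) := by
  have h := (D.contDiffOn_lagrangian c p).continuousOn_fderiv_of_isOpen
    (D.isOpen_lagrangianDomain p) le_rfl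
  exact (h.clm_comp continuousOn_const).congr fun w hw => force_eq hw

theorem fderiv_lagrangian_apply (hw : w ∈ D.lagrangianDomain p)
    (v u : EuclideanSpace ℝ (Fin d)) :
    fderiv ℝ (D.lagrangian c p) w ((0, v), u) = D.force c p w v + D.momentum p w u := by
  have h1 : fderiv ℝ (D.lagrangian c p) w ((0, v), 0) = D.force c p w v := by
    rw [force_eq hw]; rfl
  have h2 : fderiv ℝ (D.lagrangian c p) w ((0, 0), u) = D.momentum p w u := by
    have h3 : HasFDerivAt (fun u : EuclideanSpace ℝ (Fin d) => (w.1, u))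
      (ContinuousLinearMap.inr ℝ (ℝ × EuclideanSpace ℝ (Fin d)) (EuclideanSpace ℝ (Fin d))) w.2 :=
      (hasFDerivAt_const w.1 w.2).prodMk (hasFDerivAt_id w.2)
    have h4 := (differentiableAt_lagrangian (c := c) hw).hasFDerivAt.comp w.2 h3
    have h5 : HasFDerivAt (fun u => D.lagrangian c p (w.1, u)) (D.momentum p w) w.2 := by
      have hA := (((D.aChart p w.1).hasFDerivAt (x := w.2)).clm_apply (hasFDerivAt_id w.2))
      have hb := (D.bChart p w.1).hasFDerivAt (x := w.2)
      refine (((hA.const_mul (1 / (2 * D.ψChart p w.1))).add hb).sub_const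
        (D.ψChart p w.1 * (c + 1 / 2 + D.uChart p w.1))).congr_fderiv ?_
      ext u
      have := (ψChart_pos (p := p) (D := D) (e := w.1) hw).ne'
      simp only [momentum, add_apply, smul_apply,
        ContinuousLinearMap.comp_apply, ContinuousLinearMap.flip_apply, id_eq, smul_eq_mul,
        ContinuousLinearMap.id_apply]
      rw [aChart_symm (p := p) (D := D) (e := w.1) hw u w.2]
      field_simp
      ring
    exact DFunLike.congr_fun (h4.unique h5) u
  rw [← h1, ← h2, ← map_add]
  simp

end Smoothness

end EisenhartData

namespace EisenhartData

variable {d : ℕ} {S : Type*} [TopologicalSpace S] [ChartedSpace (EuclideanSpace ℝ (Fin d)) S]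
  [IsManifold (𝓡 d) 1 S] {D : EisenhartData d S} {p : ℝ × S × ℝ}
  {z : ℝ × EuclideanSpace ℝ (Fin d) × ℝ}

theorem metricInChart_symm (hz : (z.1, z.2.1) ∈ D.chartDomain p.2.1)
    (V W : ℝ × EuclideanSpace ℝ (Fin d) × ℝ) :
    metricInChart (eisModel d) D.metric p z V W = metricInChart (eisModel d) D.metric p z W V := by
  rw [D.metricInChart_metric p hz.2, D.metricInChart_metric p hz.2, aChart_symm hz]
  ring

theorem metricInChart_killing (hz : (z.1, z.2.1) ∈ D.chartDomain p.2.1)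
    (V : ℝ × EuclideanSpace ℝ (Fin d) × ℝ) :
    metricInChart (eisModel d) D.metric p z V (0, 0, 1) = -(D.ψChart p.2.1 (z.1, z.2.1) * V.1) := by
  rw [D.metricInChart_metric p hz.2]
  simp

variable {V : ℝ × EuclideanSpace ℝ (Fin d) × ℝ} {u : EuclideanSpace ℝ (Fin d)} {k κ2 : ℝ}

theorem metricInChart_momentum (hz : (z.1, z.2.1) ∈ D.chartDomain p.2.1)
    (h1 : V.1 = k / D.ψChart p.2.1 (z.1, z.2.1))
    (h2 : V.2.1 = (k / D.ψChart p.2.1 (z.1, z.2.1)) • u) (v : EuclideanSpace ℝ (Fin d)) :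
    metricInChart (eisModel d) D.metric p z V (0, v, 0)
      = k * D.momentum p.2.1 ((z.1, z.2.1), u) v := by
  have hψ := (ψChart_pos hz).ne'
  rw [D.metricInChart_metric p hz.2, h1, h2]
  simp [momentum]
  field_simp

theorem metricInChart_energy (hz : (z.1, z.2.1) ∈ D.chartDomain p.2.1) (hk : k ≠ 0)
    (h1 : V.1 = k / D.ψChart p.2.1 (z.1, z.2.1))
    (h2 : V.2.1 = (k / D.ψChart p.2.1 (z.1, z.2.1)) • u) :
    metricInChart (eisModel d) D.metric p z V V = -κ2 * k ^ 2 ↔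
      V.2.2 = (k / D.ψChart p.2.1 (z.1, z.2.1)) *
        D.lagrangian (-κ2 / 2) p.2.1 ((z.1, z.2.1), u) := by
  have hψ := (ψChart_pos hz).ne'
  rw [D.metricInChart_metric p hz.2, h1, h2]
  simp only [lagrangian, map_smul, smul_apply, smul_eq_mul]
  constructor
  · intro h
    field_simp at h ⊢
    linear_combination -h
  · intro h
    rw [h]
    field_simp
    ring

theorem hasDerivAt_metricInChart_line (hz : (z.1, z.2.1) ∈ D.chartDomain p.2.1)
    (V W : ℝ × EuclideanSpace ℝ (Fin d) × ℝ) :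
    HasDerivAt (fun r : ℝ => metricInChart (eisModel d) D.metric p (z + r • W) V V)
      (fderiv ℝ (fun z => metricInChart (eisModel d) D.metric p z V V) z W) 0 := by
  have h := (D.differentiableAt_metricCLM p hz).hasFDerivAt.metricInChart (eisModel d) V V
  exact h.differentiableAt.hasFDerivAt.hasLineDerivAt W

theorem fderiv_metricInChart_killing (hz : (z.1, z.2.1) ∈ D.chartDomain p.2.1) :
    fderiv ℝ (fun z => metricInChart (eisModel d) D.metric p z V V) z (0, 0, 1) = 0 := by
  refine (hasDerivAt_metricInChart_line hz V (0, 0, 1)).unique ?_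
  refine (hasDerivAt_const 0 (metricInChart (eisModel d) D.metric p z V V)).congr_of_eventuallyEq
    (Filter.Eventually.of_forall fun r => ?_)
  dsimp only
  rw [D.metricInChart_metric p hz.2, D.metricInChart_metric p (by simpa using hz.2)]
  simp

theorem fderiv_metricInChart_force (hz : (z.1, z.2.1) ∈ D.chartDomain p.2.1)
    (h1 : V.1 = k / D.ψChart p.2.1 (z.1, z.2.1))
    (h2 : V.2.1 = (k / D.ψChart p.2.1 (z.1, z.2.1)) • u)
    (h3 : V.2.2 = (k / D.ψChart p.2.1 (z.1, z.2.1)) *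
        D.lagrangian (-κ2 / 2) p.2.1 ((z.1, z.2.1), u)) (v : EuclideanSpace ℝ (Fin d)) :
    1 / 2 * fderiv ℝ (fun z => metricInChart (eisModel d) D.metric p z V V) z (0, v, 0)
      = k ^ 2 / D.ψChart p.2.1 (z.1, z.2.1) * D.force (κ2 / 2) p.2.1 ((z.1, z.2.1), u) v := by
  have hψ := (ψChart_pos hz).ne'
  have hL := hasDerivAt_metricInChart_line hz V (0, v, 0)
  have hw : ((z.1, z.2.1), u) ∈ D.lagrangianDomain p.2.1 := hz
  have hF : HasDerivAt (fun r : ℝ => D.lagrangian (κ2 / 2) p.2.1 ((z.1, z.2.1 + r • v), u))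
      (D.force (κ2 / 2) p.2.1 ((z.1, z.2.1), u) v) 0 :=
    (hasFDerivAt_lagrangian_position (c := κ2 / 2) hw).differentiableAt.hasFDerivAt.hasLineDerivAt v
  have hopen : ∀ᶠ r : ℝ in 𝓝 0, (z.1, z.2.1 + r • v) ∈ D.chartDomain p.2.1 := by
    have hc : ContinuousAt (fun r : ℝ => (z.1, z.2.1 + r • v)) 0 := by fun_prop
    exact hc ((D.isOpen_chartDomain p.2.1).mem_nhds (by simpa using hz))
  have hline : HasDerivAt (fun r : ℝ => (z.1, z.2.1 + r • v)) (0, v) 0 := by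
    refine (hasDerivAt_const _ _).prodMk ?_
    simpa using ((hasDerivAt_id (0 : ℝ)).smul_const v).const_add z.2.1
  have hd : ∀ {G : Type} [NormedAddCommGroup G] [NormedSpace ℝ G]
      {f : ℝ × EuclideanSpace ℝ (Fin d) → G}, ContDiffOn ℝ 1 f (D.chartDomain p.2.1) →
      HasDerivAt (fun r : ℝ => f (z.1, z.2.1 + r • v)) (fderiv ℝ f (z.1, z.2.1) (0, v)) 0 := by
    intro G _ _ f hf
    have h := ((hf.differentiableOn one_ne_zero).differentiableAt
      ((D.isOpen_chartDomain p.2.1).mem_nhds hz)).hasFDerivAt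
    have h' : HasFDerivAt f (fderiv ℝ f (z.1, z.2.1)) (z.1, z.2.1 + (0 : ℝ) • v) := by
      simpa using h
    exact h'.comp_hasDerivAt (0 : ℝ) hline
  have hA := ((hd ((D.contDiffOn_aChart p.2.1).clm_apply (contDiffOn_const (c := u)))).clm_apply
    (hasDerivAt_const (0 : ℝ) u))
  have hb := hd ((D.contDiffOn_bChart p.2.1).clm_apply (contDiffOn_const (c := u)))
  have hψ' := hd (D.contDiffOn_ψChart p.2.1)
  have hU := hd (D.contDiffOn_uChart p.2.1)
  have hF' := ((((hasDerivAt_const (0 : ℝ) (1 : ℝ)).fun_div (hψ'.const_mul 2)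
    (by simpa using hψ)).fun_mul hA).fun_add hb).fun_sub
      (hψ'.fun_mul (hU.const_add (κ2 / 2 + 1 / 2)))
  have hG' := (((hA.const_mul ((k / D.ψChart p.2.1 (z.1, z.2.1)) ^ 2)).fun_sub
    (((hψ'.mul_const (V.1)).fun_mul
      ((hb.const_mul (k / D.ψChart p.2.1 (z.1, z.2.1))).const_sub V.2.2)).const_mul 2)).fun_sub
    ((((hU.const_mul 2).add_const 1).fun_mul (hψ'.fun_pow 2)).mul_const (V.1 ^ 2)))
  have e1 := hF.unique hF'
  have e2 := hL.unique (hG'.congr_of_eventuallyEq ?_)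
  · rw [e1, e2, h1, h3]
    simp only [lagrangian, zero_smul, add_zero]
    field_simp
    ring
  · filter_upwards [hopen] with r hr
    rw [D.metricInChart_metric p (by simpa using hr.2), h2]
    simp
    ring

end EisenhartData

section ChartDerivatives

theorem ContDiffWithinAt.derivWithin_one {F : Type*} [NormedAddCommGroup F] [NormedSpace ℝ F]
    {J : Set ℝ} {c : ℝ → F} {s : ℝ} (hc : ContDiffWithinAt ℝ 2 c J s) (hu : UniqueDiffOn ℝ J)
    (hs : s ∈ J) : ContDiffWithinAt ℝ 1 (derivWithin c J) J s :=
  (hc.fderivWithin_right hu (m := 1) (by norm_num) hs).clm_apply contDiffWithinAt_const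

theorem contDiffOn_two_of_hasDerivWithinAt {F : Type*} [NormedAddCommGroup F] [NormedSpace ℝ F]
    {J : Set ℝ} {c c' : ℝ → F} (hu : UniqueDiffOn ℝ J)
    (hc : ∀ s ∈ J, HasDerivWithinAt c (c' s) J s) (hc' : ContDiffOn ℝ 1 c' J) :
    ContDiffOn ℝ 2 c J := by
  have h : ContDiffOn ℝ ((1 : ℕ∞ω) + 1) c J := by
    rw [contDiffOn_succ_iff_derivWithin hu]
    exact ⟨fun s hs => (hc s hs).differentiableWithinAt, by simp,
      hc'.congr fun s hs => (hc s hs).derivWithin (hu s hs)⟩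
  rwa [one_add_one_eq_two] at h

variable {E : Type*} [NormedAddCommGroup E] [NormedSpace ℝ E]
  {H : Type*} [TopologicalSpace H] {I : ModelWithCorners ℝ E H}
  {M : Type*} [TopologicalSpace M] [ChartedSpace H M] {x : ℝ → M} {J : Set ℝ} {s : ℝ} {p : M}

theorem ContMDiffOn.hasDerivWithinAt_chart [IsManifold I 1 M]
    (hx : ContMDiffOn 𝓘(ℝ, ℝ) I 1 x J) (hs : s ∈ J) (hp : x s ∈ (chartAt H p).source) :
    HasDerivWithinAt (fun s' => extChartAt I p (x s'))
      (derivWithin (fun s' => extChartAt I p (x s')) J s) J s :=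
  (((contMDiffWithinAt_curve_iff hp).1 (hx s hs)).2.differentiableWithinAt
    one_ne_zero).hasDerivWithinAt

theorem ContMDiffOn.hasDerivWithinAt_chart_two [IsManifold I 2 M] (hu : UniqueDiffOn ℝ J)
    (hx : ContMDiffOn 𝓘(ℝ, ℝ) I 2 x J) (hs : s ∈ J) (hp : x s ∈ (chartAt H p).source) :
    HasDerivWithinAt (derivWithin (fun s' => extChartAt I p (x s')) J)
      (derivWithin (derivWithin (fun s' => extChartAt I p (x s')) J) J s) J s :=
  ((((contMDiffWithinAt_curve_iff hp).1 (hx s hs)).2.derivWithin_one hu hs).differentiableWithinAt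
    one_ne_zero).hasDerivWithinAt

theorem ContMDiffOn.curveVelocity_eq [IsManifold I 1 M] [I.Boundaryless] (hu : UniqueDiffOn ℝ J)
    (hx : ContMDiffOn 𝓘(ℝ, ℝ) I 1 x J) (hs : s ∈ J) (hp : x s ∈ (chartAt H p).source) :
    @Eq E (curveVelocity I J x s) (chartVector I p (extChartAt I p (x s))
      (derivWithin (fun s' => extChartAt I p (x s')) J s)) :=
  curveVelocity_eq_chartVector I (hx s hs).continuousWithinAt hp (hx.hasDerivWithinAt_chart hs hp)
    (hu s hs)

end ChartDerivatives

namespace EisenhartData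

variable {d : ℕ} {S : Type*} [TopologicalSpace S] [ChartedSpace (EuclideanSpace ℝ (Fin d)) S]

/-- The 1-jet of a curve in the chart around `p`. -/
def chartJet (p : S) (J : Set ℝ) (q : ℝ → S) (t : ℝ) :
    (ℝ × EuclideanSpace ℝ (Fin d)) × EuclideanSpace ℝ (Fin d) :=
  ((t, extChartAt (𝓡 d) p (q t)), derivWithin (fun t' => extChartAt (𝓡 d) p (q t')) J t)

/-- The Euler–Lagrange equations, in all charts. -/
def IsEulerLagrange (D : EisenhartData d S) (c : ℝ) (J : Set ℝ) (q : ℝ → S) : Prop :=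
  ∀ p : S, ∀ t ∈ J, q t ∈ (chartAt (EuclideanSpace ℝ (Fin d)) p).source →
    HasDerivWithinAt (fun t' => D.momentum p (chartJet p J q t')) (D.force c p (chartJet p J q t))
      J t

variable {D : EisenhartData d S} {J : Set ℝ} {x : ℝ → ℝ × S × ℝ} {q : ℝ → S}

theorem chartJet_mem {p : S} {t : ℝ} (ht : t ∈ D.T)
    (hq : q t ∈ (chartAt (EuclideanSpace ℝ (Fin d)) p).source) :
    chartJet p J q t ∈ D.lagrangianDomain p := mem_chartDomain ht hq

variable [IsManifold (𝓡 d) 2 S]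

theorem contDiffWithinAt_chartJet (hu : UniqueDiffOn ℝ J) (hq : ContMDiffOn 𝓘(ℝ, ℝ) (𝓡 d) 2 q J)
    {p : S} {t : ℝ} (ht : t ∈ J) (hp : q t ∈ (chartAt (EuclideanSpace ℝ (Fin d)) p).source) :
    ContDiffWithinAt ℝ 1 (chartJet (d := d) p J q) J t := by
  have h := ((contMDiffWithinAt_curve_iff hp).1 (hq t ht)).2
  exact (contDiffWithinAt_id.prodMk (h.of_le (by norm_num))).prodMk (h.derivWithin_one hu ht)

theorem _root_.ContDiffOn.comp_chartJet {F : Type*} [NormedAddCommGroup F] [NormedSpace ℝ F]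
    {p : S} {f : (ℝ × EuclideanSpace ℝ (Fin d)) × EuclideanSpace ℝ (Fin d) → F}
    (hf : ContDiffOn ℝ 1 f (D.lagrangianDomain p)) (hu : UniqueDiffOn ℝ J)
    (hq : ContMDiffOn 𝓘(ℝ, ℝ) (𝓡 d) 2 q J) {t : ℝ} (ht : t ∈ J) (hT : t ∈ D.T)
    (hp : q t ∈ (chartAt (EuclideanSpace ℝ (Fin d)) p).source) :
    ContDiffWithinAt ℝ 1 (fun t' => f (chartJet p J q t')) J t :=
  (hf.contDiffAt ((D.isOpen_lagrangianDomain p).mem_nhds (chartJet_mem hT hp))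
    ).comp_contDiffWithinAt t (contDiffWithinAt_chartJet hu hq ht hp)

/-- The coordinate velocity of a spacetime curve. -/
theorem metric_velocity_velocity (hu : UniqueDiffOn ℝ J)
    (hx : ContMDiffOn 𝓘(ℝ, ℝ) (eisModel d) 2 x J) {p : ℝ × S × ℝ} {s : ℝ} (hs : s ∈ J)
    (hp : x s ∈ (chartAt (ModelProd ℝ (ModelProd (EuclideanSpace ℝ (Fin d)) ℝ)) p).source) :
    D.metric (x s) (curveVelocity (eisModel d) J x s) (curveVelocity (eisModel d) J x s) =
      metricInChart (eisModel d) D.metric p (extChartAt (eisModel d) p (x s))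
        (derivWithin (fun s' => extChartAt (eisModel d) p (x s')) J s)
        (derivWithin (fun s' => extChartAt (eisModel d) p (x s')) J s) := by
  have h := (hx.of_le (by norm_num : (1 : ℕ∞ω) ≤ 2)).curveVelocity_eq hu hs hp
  exact (metricInChart_eq_of_mem (eisModel d) D.metric hp h h).symm

theorem metric_killing_velocity (hu : UniqueDiffOn ℝ J) (hT : ∀ s ∈ J, (x s).1 ∈ D.T)
    (hx : ContMDiffOn 𝓘(ℝ, ℝ) (eisModel d) 2 x J) {p : ℝ × S × ℝ} {s : ℝ} (hs : s ∈ J)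
    (hp : x s ∈ (chartAt (ModelProd ℝ (ModelProd (EuclideanSpace ℝ (Fin d)) ℝ)) p).source) :
    D.metric (x s) (killingN (x s)) (curveVelocity (eisModel d) J x s) =
      metricInChart (eisModel d) D.metric p (extChartAt (eisModel d) p (x s))
        (derivWithin (fun s' => extChartAt (eisModel d) p (x s')) J s) (0, 0, 1) := by
  have h := (hx.of_le (by norm_num : (1 : ℕ∞ω) ≤ 2)).curveVelocity_eq hu hs hp
  have hp' := mem_chartAt_source_eisModel.1 hp
  have hz : ((extChartAt (eisModel d) p (x s)).1, (extChartAt (eisModel d) p (x s)).2.1) ∈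
      D.chartDomain p.2.1 := by
    rw [extChartAt_eisModel]
    exact mem_chartDomain (hT s hs) hp'
  rw [metricInChart_symm hz]
  refine (metricInChart_eq_of_mem (eisModel d) D.metric hp ?_ h).symm
  rw [killingN_eq, chartVector_eisModel p hz.2]
  have h0 : chartVector (𝓡 d) p.2.1 (extChartAt (eisModel d) p (x s)).2.1 0 = 0 :=
    ContinuousLinearMap.map_zero _
  exact Prod.ext rfl (Prod.ext h0.symm rfl)

theorem eq_const_of_geodesic (hJ : J.OrdConnected) (hn : J.Nontrivial)
    (hT : ∀ s ∈ J, (x s).1 ∈ D.T) (hg : IsGeodesicOn (eisModel d) D.metric J x) :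
    ∃ h m : ℝ, ∀ s ∈ J,
      D.metric (x s) (killingN (x s)) (curveVelocity (eisModel d) J x s) = h ∧
      D.metric (x s) (curveVelocity (eisModel d) J x s) (curveVelocity (eisModel d) J x s) = m := by
  have hu := hJ.uniqueDiffOn_real hn
  have hx := hg.1
  have hx1 := hx.of_le (by norm_num : (1 : ℕ∞ω) ≤ 2)
  have key : ∀ s ∈ J,
      HasDerivWithinAt (fun s => (D.metric (x s) (killingN (x s))
        (curveVelocity (eisModel d) J x s) : ℝ)) 0 J s ∧
      HasDerivWithinAt (fun s => (D.metric (x s) (curveVelocity (eisModel d) J x s)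
        (curveVelocity (eisModel d) J x s) : ℝ)) 0 J s := by
    intro s hs
    have hp : x s ∈ (chartAt (ModelProd ℝ (ModelProd (EuclideanSpace ℝ (Fin d)) ℝ)) (x s)).source :=
      mem_chart_source _ _
    have hz : ((extChartAt (eisModel d) (x s) (x s)).1, (extChartAt (eisModel d) (x s) (x s)).2.1) ∈
        D.chartDomain (x s).2.1 := by
      rw [extChartAt_eisModel]
      exact mem_chartDomain (hT s hs) (mem_chart_source _ _)
    have hc := hx1.hasDerivWithinAt_chart hs hp
    have hc₁ := hx.hasDerivWithinAt_chart_two hu hs hp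
    have hdiff := D.differentiableAt_metricCLM (x s) hz
    have hev := eventually_mem_chart_source (hx s hs).continuousWithinAt hp
    have hres := hg.2 (x s) s hs hp
    constructor
    · have h1 := hasDerivWithinAt_metricInChart_velocity (eisModel d) hdiff hc hc₁ (0, 0, 1)
      rw [fderiv_metricInChart_killing hz, geodesicResidual, hres] at h1
      refine (h1.congr_of_eventuallyEq_of_mem ?_ hs).congr_deriv (by ring)
      filter_upwards [hev, self_mem_nhdsWithin] with s' hs' hs'J
      exact metric_killing_velocity hu hT hx hs'J hs'
    · have h1 := hasDerivWithinAt_metricInChart_energy (eisModel d) hdiff hc hc₁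
        (metricInChart_symm hz _ _)
      rw [geodesicResidual, hres] at h1
      refine (h1.congr_of_eventuallyEq_of_mem ?_ hs).congr_deriv (by ring)
      filter_upwards [hev, self_mem_nhdsWithin] with s' hs' hs'J
      exact metric_velocity_velocity hu hx hs'J hs'
  obtain ⟨s₀, hs₀⟩ := hn.nonempty
  refine ⟨D.metric (x s₀) (killingN (x s₀)) (curveVelocity (eisModel d) J x s₀),
    D.metric (x s₀) (curveVelocity (eisModel d) J x s₀) (curveVelocity (eisModel d) J x s₀),
    fun s hs => ⟨?_, ?_⟩⟩
  · exact eqOn_const_of_hasDerivWithinAt_zero hJ (fun s hs => (key s hs).1) hs hs₀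
  · exact eqOn_const_of_hasDerivWithinAt_zero hJ (fun s hs => (key s hs).2) hs hs₀

theorem hasDerivWithinAt_components (hx : ContMDiffOn 𝓘(ℝ, ℝ) (eisModel d) 2 x J)
    {p : ℝ × S × ℝ} {s : ℝ} (hs : s ∈ J)
    (hp : (x s).2.1 ∈ (chartAt (EuclideanSpace ℝ (Fin d)) p.2.1).source) :
    HasDerivWithinAt (fun s => (x s).1)
      (derivWithin (fun s' => extChartAt (eisModel d) p (x s')) J s).1 J s ∧
    HasDerivWithinAt (fun s => extChartAt (𝓡 d) p.2.1 (x s).2.1)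
      (derivWithin (fun s' => extChartAt (eisModel d) p (x s')) J s).2.1 J s ∧
    HasDerivWithinAt (fun s => (x s).2.2)
      (derivWithin (fun s' => extChartAt (eisModel d) p (x s')) J s).2.2 J s := by
  have hc := (hx.of_le (by norm_num : (1 : ℕ∞ω) ≤ 2)).hasDerivWithinAt_chart hs
    (mem_chartAt_source_eisModel.2 hp)
  have e : (fun s' => extChartAt (eisModel d) p (x s')) =
    fun s' => ((x s').1, extChartAt (𝓡 d) p.2.1 (x s').2.1, (x s').2.2) := by
    funext s'
    rw [extChartAt_eisModel]
  generalize derivWithin (fun s' => extChartAt (eisModel d) p (x s')) J s = c' at hc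
  rw [e] at hc
  have hf := hc.hasFDerivWithinAt
  exact ⟨by simpa using hf.fst.hasDerivWithinAt, by simpa using hf.snd.fst.hasDerivWithinAt,
    by simpa using hf.snd.snd.hasDerivWithinAt⟩

end EisenhartData

theorem HasDerivWithinAt.const_mul_clm_comp_apply {F : Type*} [NormedAddCommGroup F]
    [NormedSpace ℝ F] {M : ℝ → F →L[ℝ] ℝ} {M' : F →L[ℝ] ℝ} {θ : ℝ → ℝ} {θ' s : ℝ} {I J : Set ℝ}
    (hM : HasDerivWithinAt M M' I (θ s)) (hθ : HasDerivWithinAt θ θ' J s) (hm : MapsTo θ J I)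
    (k : ℝ) (v : F) :
    HasDerivWithinAt (fun s' => k * M (θ s') v) (k * (θ' * M' v)) J s := by
  have h1 := hM.scomp s hθ hm
  have h2 := h1.clm_apply (hasDerivWithinAt_const s J v)
  refine (h2.const_mul k).congr_deriv ?_
  simp

namespace EisenhartData

variable {d : ℕ} {S : Type*} [TopologicalSpace S] [ChartedSpace (EuclideanSpace ℝ (Fin d)) S]
  {D : EisenhartData d S} {J : Set ℝ} {x : ℝ → ℝ × S × ℝ} {q : ℝ → S}

theorem ψChart_extChartAt {p q : S} (hq : q ∈ (chartAt (EuclideanSpace ℝ (Fin d)) p).source)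
    (t : ℝ) : D.ψChart p (t, extChartAt (𝓡 d) p q) = D.ψ t q := by
  rw [ψChart, (extChartAt (𝓡 d) p).left_inv (by rwa [extChartAt_source])]

variable [IsManifold (𝓡 d) 2 S]

theorem hasDerivWithinAt_time (hJ : J.OrdConnected) (hn : J.Nontrivial)
    (hT : ∀ s ∈ J, (x s).1 ∈ D.T) (hx : ContMDiffOn 𝓘(ℝ, ℝ) (eisModel d) 2 x J) {k : ℝ}
    (hk : ∀ s ∈ J, D.metric (x s) (killingN (x s)) (curveVelocity (eisModel d) J x s) = -k) :
    ∀ s ∈ J, HasDerivWithinAt (fun s => (x s).1) (k / D.ψ (x s).1 (x s).2.1) J s := by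
  intro s hs
  have hu := hJ.uniqueDiffOn_real hn
  have hp := mem_chart_source (EuclideanSpace ℝ (Fin d)) (x s).2.1
  have hz : ((extChartAt (eisModel d) (x s) (x s)).1, (extChartAt (eisModel d) (x s) (x s)).2.1) ∈
      D.chartDomain (x s).2.1 := by
    rw [extChartAt_eisModel]
    exact mem_chartDomain (hT s hs) hp
  have h1 := hk s hs
  rw [metric_killing_velocity hu hT hx hs (mem_chartAt_source_eisModel.2 hp),
    metricInChart_killing hz] at h1
  refine (hasDerivWithinAt_components hx hs hp).1.congr_deriv ?_
  have h2 : D.ψChart (x s).2.1 ((extChartAt (eisModel d) (x s) (x s)).1,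
      (extChartAt (eisModel d) (x s) (x s)).2.1) = D.ψ (x s).1 (x s).2.1 := by
    rw [extChartAt_eisModel, ψChart, (extChartAt (𝓡 d) (x s).2.1).left_inv (mem_extChartAt_source _)]
  have h3 := (ψChart_pos hz).ne'
  rw [← h2]
  field_simp
  linarith

/-- A geodesic which is not tangent to the hypersurfaces of constant `t` projects to a solution
of the Euler–Lagrange equations. -/
theorem isEulerLagrange_of_geodesic (hJ : J.OrdConnected) (hn : J.Nontrivial)
    (hT : ∀ s ∈ J, (x s).1 ∈ D.T) (hg : IsGeodesicOn (eisModel d) D.metric J x) {k κ2 : ℝ}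
    (hk0 : k ≠ 0)
    (hk : ∀ s ∈ J, D.metric (x s) (killingN (x s)) (curveVelocity (eisModel d) J x s) = -k)
    (hm : ∀ s ∈ J, D.metric (x s) (curveVelocity (eisModel d) J x s)
      (curveVelocity (eisModel d) J x s) = -κ2 * k ^ 2)
    (hq : ∀ s ∈ J, q (x s).1 = (x s).2.1) :
    ContMDiffOn 𝓘(ℝ, ℝ) (𝓡 d) 2 q ((fun s => (x s).1) '' J) ∧
      D.IsEulerLagrange (κ2 / 2) ((fun s => (x s).1) '' J) q := by
  have hu := hJ.uniqueDiffOn_real hn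
  have hx := hg.1
  have hθ := hasDerivWithinAt_time hJ hn hT hx hk
  have hsign : (∀ s ∈ J, 0 < k / D.ψ (x s).1 (x s).2.1) ∨
      (∀ s ∈ J, k / D.ψ (x s).1 (x s).2.1 < 0) := by
    rcases hk0.lt_or_gt with h | h
    · exact Or.inr fun s hs => div_neg_of_neg_of_pos h (D.ψ_pos _ (hT s hs) _)
    · exact Or.inl fun s hs => div_pos h (D.ψ_pos _ (hT s hs) _)
  obtain ⟨hmono, hI, hIn, hinv⟩ := interval_inverse hJ hn hθ hsign
  have hinj : InjOn (fun s => (x s).1) J := hmono.elim StrictMonoOn.injOn StrictAntiOn.injOn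
  have hgl : ∀ s ∈ J, Function.invFunOn (fun s => (x s).1) J (x s).1 = s :=
    fun s hs => hinj.leftInvOn_invFunOn hs
  have hIu := hI.uniqueDiffOn_real hIn
  have hθ2 : ContDiffOn ℝ 2 (fun s => (x s).1) J :=
    contMDiffOn_iff_contDiffOn.1 (contMDiff_fst.comp_contMDiffOn hx)
  have hxq : ContMDiffOn 𝓘(ℝ, ℝ) (𝓡 d) 2 (fun s => (x s).2.1) J :=
    (contMDiff_fst.comp contMDiff_snd).comp_contMDiffOn hx
  have hinv2 : ContDiffOn ℝ 2 (Function.invFunOn (fun s => (x s).1) J)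
      ((fun s => (x s).1) '' J) := (hinv _ hgl).2 2 hθ2
  have hq2 : ContMDiffOn 𝓘(ℝ, ℝ) (𝓡 d) 2 q ((fun s => (x s).1) '' J) := by
    refine (hxq.comp hinv2.contMDiffOn ?_).congr ?_
    · rintro _ ⟨s, hs, rfl⟩
      change Function.invFunOn (fun s => (x s).1) J (x s).1 ∈ J
      rwa [hgl s hs]
    · rintro _ ⟨s, hs, rfl⟩
      simp only [Function.comp_apply]
      rw [hgl s hs, hq s hs]
  refine ⟨hq2, ?_⟩
  rintro p _ ⟨s, hs, rfl⟩ hp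
  dsimp only at hp ⊢
  have hxp : (x s).2.1 ∈ (chartAt (EuclideanSpace ℝ (Fin d)) p).source := by rwa [← hq s hs]
  set P : ℝ × S × ℝ := (0, p, 0) with hP
  have hdom : ∀ s' ∈ J, (x s').2.1 ∈ (chartAt (EuclideanSpace ℝ (Fin d)) p).source →
      ((extChartAt (eisModel d) P (x s')).1, (extChartAt (eisModel d) P (x s')).2.1) ∈
        D.chartDomain p := by
    intro s' hs' hp'
    rw [extChartAt_eisModel]
    exact mem_chartDomain (hT s' hs') hp'
  have hjet : ∀ s' ∈ J, chartJet p ((fun s => (x s).1) '' J) q (x s').1 =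
      (((extChartAt (eisModel d) P (x s')).1, (extChartAt (eisModel d) P (x s')).2.1),
        derivWithin (fun t' => extChartAt (𝓡 d) p (q t')) ((fun s => (x s).1) '' J) (x s').1) := by
    intro s' hs'
    rw [extChartAt_eisModel, chartJet, hq s' hs']
  have hψ : ∀ s' ∈ J, (x s').2.1 ∈ (chartAt (EuclideanSpace ℝ (Fin d)) p).source →
      D.ψChart p ((extChartAt (eisModel d) P (x s')).1, (extChartAt (eisModel d) P (x s')).2.1)
        = D.ψ (x s').1 (x s').2.1 := by
    intro s' hs' hp'
    rw [extChartAt_eisModel]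
    exact ψChart_extChartAt hp' _
  have hvel : ∀ s' ∈ J, (x s').2.1 ∈ (chartAt (EuclideanSpace ℝ (Fin d)) p).source →
      (derivWithin (fun s' => extChartAt (eisModel d) P (x s')) J s').1 =
        k / D.ψ (x s').1 (x s').2.1 ∧
      (derivWithin (fun s' => extChartAt (eisModel d) P (x s')) J s').2.1 =
        (k / D.ψ (x s').1 (x s').2.1) •
        derivWithin (fun t' => extChartAt (𝓡 d) p (q t')) ((fun s => (x s).1) '' J) (x s').1 := by
    intro s' hs' hp'
    obtain ⟨h1, h2, -⟩ := hasDerivWithinAt_components (p := P) hx hs' hp'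
    refine ⟨(hu s' hs').eq_deriv _ h1 (hθ s' hs'), (hu s' hs').eq_deriv _ h2 ?_⟩
    have h3 := (hq2.of_le (by norm_num : (1 : ℕ∞ω) ≤ 2)).hasDerivWithinAt_chart (p := p)
      (mem_image_of_mem _ hs') (by rwa [hq s' hs'])
    have h4 := h3.scomp s' (hθ s' hs') (mapsTo_image _ _)
    refine h4.congr (fun r hr => ?_) ?_
    · simp only [Function.comp_apply]; rw [hq r hr]
    · simp only [Function.comp_apply]; rw [hq s' hs']
  have hsP := mem_chartAt_source_eisModel (p := P) (x := x s).2 hxp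
  have hev : ∀ᶠ s' in 𝓝[J] s, s' ∈ J ∧
      (x s').2.1 ∈ (chartAt (EuclideanSpace ℝ (Fin d)) p).source := by
    filter_upwards [eventually_mem_chart_source (hx s hs).continuousWithinAt hsP,
      self_mem_nhdsWithin] with s' h1 h2
    exact ⟨h2, mem_chartAt_source_eisModel.1 h1⟩
  have hM : DifferentiableWithinAt ℝ
      (fun t' => D.momentum p (chartJet p ((fun s => (x s).1) '' J) q t'))
      ((fun s => (x s).1) '' J) (x s).1 :=
    ((D.contDiffOn_momentum p).comp_chartJet hIu hq2 (mem_image_of_mem _ hs) (hT s hs)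
      hp).differentiableWithinAt one_ne_zero
  refine hM.hasDerivWithinAt.congr_deriv ?_
  ext v
  set c₁ := derivWithin (fun s' => extChartAt (eisModel d) P (x s')) J with hc₁
  have hz := hdom s hs hxp
  obtain ⟨hv1, hv2⟩ := hvel s hs hxp
  rw [← hψ s hs hxp] at hv1 hv2
  have hv3 := (metricInChart_energy (p := P) hz hk0 hv1 hv2 (κ2 := κ2)).1
    ((metric_velocity_velocity hu hx hs hsP).symm.trans (hm s hs))
  have hres := hasDerivWithinAt_metricInChart_velocity (eisModel d)
    (D.differentiableAt_metricCLM P hz)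
    ((hx.of_le (by norm_num : (1 : ℕ∞ω) ≤ 2)).hasDerivWithinAt_chart hs hsP)
    (hx.hasDerivWithinAt_chart_two hu hs hsP) (0, v, 0)
  rw [fderiv_metricInChart_force (p := P) hz hv1 hv2 hv3, geodesicResidual, hg.2 P s hs hsP] at hres
  have hmom : HasDerivWithinAt (fun s' => k *
      D.momentum p (chartJet p ((fun s => (x s).1) '' J) q (x s').1) v)
      (k * (k / D.ψ (x s).1 (x s).2.1 * derivWithin
        (fun t' => D.momentum p (chartJet p ((fun s => (x s).1) '' J) q t'))
        ((fun s => (x s).1) '' J) (x s).1 v)) J s :=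
    hM.hasDerivWithinAt.const_mul_clm_comp_apply (hθ s hs) (mapsTo_image _ _) k v
  have heq := (hu s hs).eq_deriv _ hmom (hres.congr_of_eventuallyEq_of_mem ?_ hs)
  · rw [← hjet s hs] at heq
    rw [show P.2.1 = p from rfl, hψ s hs hxp] at heq
    have h0 := (D.ψ_pos _ (hT s hs) (x s).2.1).ne'
    field_simp at heq
    rw [mul_zero, zero_add] at heq
    exact mul_left_cancel₀ (pow_ne_zero 2 hk0) heq
  · filter_upwards [hev] with s' hs'
    obtain ⟨hw1, hw2⟩ := hvel s' hs'.1 hs'.2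
    rw [← hψ s' hs'.1 hs'.2] at hw1 hw2
    rw [metricInChart_momentum (p := P) (hdom s' hs'.1 hs'.2) hw1 hw2, hjet s' hs'.1]

end EisenhartData

section ResidualLinear

variable {E : Type*} [NormedAddCommGroup E] [NormedSpace ℝ E] [FiniteDimensional ℝ E]
  {H : Type*} [TopologicalSpace H] {I : ModelWithCorners ℝ E H}
  {M : Type*} [TopologicalSpace M] [ChartedSpace H M]
  {g : ∀ x : M, LinearMap.BilinForm ℝ (TangentSpace I x)} {p : M} {z : E}

theorem geodesicResidual_add (h : DifferentiableAt ℝ (metricCLM I g p) z) (c₁ c₂ v w : E) :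
    geodesicResidual I g p z c₁ c₂ (v + w) =
      geodesicResidual I g p z c₁ c₂ v + geodesicResidual I g p z c₁ c₂ w := by
  have hG := h.hasFDerivAt
  simp only [geodesicResidual_eq I hG, map_add, add_apply]
  ring

theorem geodesicResidual_smul (h : DifferentiableAt ℝ (metricCLM I g p) z) (c₁ c₂ v : E) (r : ℝ) :
    geodesicResidual I g p z c₁ c₂ (r • v) = r * geodesicResidual I g p z c₁ c₂ v := by
  have hG := h.hasFDerivAt
  simp only [geodesicResidual_eq I hG, map_smul, smul_apply, smul_eq_mul]
  ring

end ResidualLinear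

namespace EisenhartData

variable {d : ℕ} {S : Type*} [TopologicalSpace S] [ChartedSpace (EuclideanSpace ℝ (Fin d)) S]
  {D : EisenhartData d S} {I : Set ℝ} {x : ℝ → ℝ × S × ℝ} {q : ℝ → S}

theorem chartJet_time {p : ℝ × S × ℝ} {s : ℝ} (hs : (x s).2.1 = q (x s).1) :
    chartJet p.2.1 I q (x s).1 =
      (((extChartAt (eisModel d) p (x s)).1, (extChartAt (eisModel d) p (x s)).2.1),
        derivWithin (fun t' => extChartAt (𝓡 d) p.2.1 (q t')) I (x s).1) := by
  rw [extChartAt_eisModel, chartJet, hs]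

theorem ψChart_extChartAt_eisModel {p : ℝ × S × ℝ} {s : ℝ} (hs : (x s).2.1 = q (x s).1)
    (hp : q (x s).1 ∈ (chartAt (EuclideanSpace ℝ (Fin d)) p.2.1).source) :
    D.ψChart p.2.1 ((extChartAt (eisModel d) p (x s)).1, (extChartAt (eisModel d) p (x s)).2.1)
      = D.ψ (x s).1 (q (x s).1) := by
  rw [extChartAt_eisModel, hs]
  exact ψChart_extChartAt hp _

variable [IsManifold (𝓡 d) 2 S]

/-- The coordinate velocity of a curve of the form `(θ, q ∘ θ, Y ∘ θ)`. -/
theorem velocity_of_lift {J : Set ℝ} (hu : UniqueDiffOn ℝ J)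
    (hx2 : ContMDiffOn 𝓘(ℝ, ℝ) (eisModel d) 2 x J) (hmaps : MapsTo (fun s => (x s).1) J I)
    (hq : ContMDiffOn 𝓘(ℝ, ℝ) (𝓡 d) 1 q I) {c : ℝ} {Y ρ : ℝ → ℝ}
    (hY : ∀ (p : S), ∀ t ∈ I, q t ∈ (chartAt (EuclideanSpace ℝ (Fin d)) p).source →
      HasDerivWithinAt Y (D.lagrangian c p (chartJet p I q t)) I t)
    (hxJ : ∀ s ∈ J, x s = ((x s).1, q (x s).1, Y (x s).1))
    (hθ : ∀ s ∈ J, HasDerivWithinAt (fun s => (x s).1) (ρ s) J s)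
    (p : ℝ × S × ℝ) {s : ℝ} (hs : s ∈ J)
    (hp : q (x s).1 ∈ (chartAt (EuclideanSpace ℝ (Fin d)) p.2.1).source) :
    (derivWithin (fun s' => extChartAt (eisModel d) p (x s')) J s).1 = ρ s ∧
    (derivWithin (fun s' => extChartAt (eisModel d) p (x s')) J s).2.1 =
      ρ s • derivWithin (fun t' => extChartAt (𝓡 d) p.2.1 (q t')) I (x s).1 ∧
    (derivWithin (fun s' => extChartAt (eisModel d) p (x s')) J s).2.2 =
      ρ s * D.lagrangian c p.2.1
        (((extChartAt (eisModel d) p (x s)).1, (extChartAt (eisModel d) p (x s)).2.1),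
          derivWithin (fun t' => extChartAt (𝓡 d) p.2.1 (q t')) I (x s).1) := by
  have h21 : ∀ r ∈ J, (x r).2.1 = q (x r).1 := fun r hr => by rw [hxJ r hr]
  obtain ⟨h1, h2, h3⟩ := hasDerivWithinAt_components (p := p) hx2 hs (by rwa [h21 s hs])
  rw [← chartJet_time (h21 s hs)]
  refine ⟨(hu s hs).eq_deriv _ h1 (hθ s hs), (hu s hs).eq_deriv _ h2 ?_,
    (hu s hs).eq_deriv _ h3 ?_⟩
  · have h4 := hq.hasDerivWithinAt_chart (p := p.2.1) (hmaps hs) hp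
    refine (h4.scomp s (hθ s hs) hmaps).congr_of_mem (fun r hr => ?_) hs
    simp only [Function.comp_apply]
    rw [h21 r hr]
  · refine ((hY p.2.1 (x s).1 (hmaps hs) hp).scomp s (hθ s hs) hmaps).congr_of_mem
      (fun r hr => ?_) hs
    simp only [Function.comp_apply]
    rw [show (x r).2.2 = Y (x r).1 by rw [hxJ r hr]]

theorem contDiffOn_two_height (hIu : UniqueDiffOn ℝ I) (hT : I ⊆ D.T)
    (hq : ContMDiffOn 𝓘(ℝ, ℝ) (𝓡 d) 2 q I) {c : ℝ} {Y : ℝ → ℝ}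
    (hY : ∀ (p : S), ∀ t ∈ I, q t ∈ (chartAt (EuclideanSpace ℝ (Fin d)) p).source →
      HasDerivWithinAt Y (D.lagrangian c p (chartJet p I q t)) I t) : ContDiffOn ℝ 2 Y I := by
  have hY' : ∀ t ∈ I, HasDerivWithinAt Y (derivWithin Y I t) I t := fun t ht =>
    (hY (q t) t ht (mem_chart_source _ _)).differentiableWithinAt.hasDerivWithinAt
  refine contDiffOn_two_of_hasDerivWithinAt hIu hY' fun t ht => ?_
  have hp := mem_chart_source (EuclideanSpace ℝ (Fin d)) (q t)
  refine ((D.contDiffOn_lagrangian c (q t)).comp_chartJet hIu hq ht (hT ht)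
    hp).congr_of_eventuallyEq_of_mem ?_ ht
  filter_upwards [eventually_mem_chart_source (hq t ht).continuousWithinAt hp,
    self_mem_nhdsWithin] with t' ht' ht'I
  exact (hY (q t) t' ht'I ht').derivWithin (hIu t' ht'I)

set_option maxHeartbeats 800000 in
/-- Lifts of solutions of the Euler–Lagrange equations are geodesics. -/
theorem geodesic_of_isEulerLagrange (hI : I.OrdConnected) (hn : I.Nontrivial)
    (hT : I ⊆ D.T) {κ2 K : ℝ} (hK : 0 < K) (hq : ContMDiffOn 𝓘(ℝ, ℝ) (𝓡 d) 2 q I)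
    (hEL : D.IsEulerLagrange (κ2 / 2) I q) {Y σ : ℝ → ℝ}
    (hY : ∀ (p : S), ∀ t ∈ I, q t ∈ (chartAt (EuclideanSpace ℝ (Fin d)) p).source →
      HasDerivWithinAt Y (D.lagrangian (-κ2 / 2) p (chartJet p I q t)) I t)
    (hσ : ∀ t ∈ I, HasDerivWithinAt σ (K * D.ψ t (q t)) I t)
    (hx : ∀ t ∈ I, x (σ t) = (t, q t, Y t)) :
    IsGeodesicOn (eisModel d) D.metric (σ '' I) x ∧
      ∀ s ∈ σ '' I, D.metric (x s) (curveVelocity (eisModel d) (σ '' I) x s)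
        (curveVelocity (eisModel d) (σ '' I) x s) = -κ2 * K⁻¹ ^ 2 := by
  have hIu := hI.uniqueDiffOn_real hn
  obtain ⟨-, hJ, hJn, hinv⟩ := interval_inverse hI hn hσ
    (Or.inl fun t ht => mul_pos hK (D.ψ_pos t (hT ht) _))
  have hgl : ∀ t ∈ I, (fun s => (x s).1) (σ t) = t := fun t ht => by
    dsimp only; rw [hx t ht]
  obtain ⟨hθ, hθn⟩ := hinv (fun s => (x s).1) hgl
  set J := σ '' I with hJdef
  have hu := hJ.uniqueDiffOn_real hJn
  have hψ1 : ContDiffOn ℝ 1 (fun t => K * D.ψ t (q t)) I := by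
    intro t ht
    have hp := mem_chart_source (EuclideanSpace ℝ (Fin d)) (q t)
    have h1 : ContDiffOn ℝ 1 (fun w : (ℝ × EuclideanSpace ℝ (Fin d)) × EuclideanSpace ℝ (Fin d) =>
        K * D.ψChart (q t) w.1) (D.lagrangianDomain (q t)) :=
      contDiffOn_const.mul ((D.contDiffOn_ψChart (q t)).comp contDiff_fst.contDiffOn fun w hw => hw)
    refine (h1.comp_chartJet hIu hq ht (hT ht) hp).congr_of_eventuallyEq_of_mem ?_ ht
    filter_upwards [eventually_mem_chart_source (hq t ht).continuousWithinAt hp] with t' ht'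
    simp only [chartJet]
    rw [ψChart_extChartAt ht']
  have hσ2 := contDiffOn_two_of_hasDerivWithinAt hIu hσ hψ1
  have hY2 := contDiffOn_two_height hIu hT hq hY
  have hθ2 : ContDiffOn ℝ 2 (fun s => (x s).1) J := hθn 2 hσ2
  have hmaps : MapsTo (fun s => (x s).1) J I := by
    rintro _ ⟨t, ht, rfl⟩
    rwa [hgl t ht]
  have hxJ : ∀ s ∈ J, x s = ((x s).1, q (x s).1, Y (x s).1) := by
    rintro _ ⟨t, ht, rfl⟩
    rw [hx t ht]
  have hx2 : ContMDiffOn 𝓘(ℝ, ℝ) (eisModel d) 2 x J := by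
    refine ContMDiffOn.congr (f := fun s => ((x s).1, q (x s).1, Y (x s).1)) ?_ hxJ
    exact hθ2.contMDiffOn.prodMk ((hq.comp hθ2.contMDiffOn hmaps).prodMk
      (hY2.comp hθ2 hmaps).contMDiffOn)
  have hx1 := hx2.of_le (by norm_num : (1 : ℕ∞ω) ≤ 2)
  have hk0 : K⁻¹ ≠ 0 := (inv_pos.2 hK).ne'
  have hθ' : ∀ s ∈ J, HasDerivWithinAt (fun s => (x s).1)
      (K⁻¹ / D.ψ (x s).1 (q (x s).1)) J s := by
    rintro _ ⟨t, ht, rfl⟩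
    refine (hθ t ht).congr_deriv ?_
    rw [hx t ht, mul_inv]; rfl
  have hdom : ∀ p : ℝ × S × ℝ, ∀ s ∈ J,
      q (x s).1 ∈ (chartAt (EuclideanSpace ℝ (Fin d)) p.2.1).source →
      ((extChartAt (eisModel d) p (x s)).1, (extChartAt (eisModel d) p (x s)).2.1) ∈
        D.chartDomain p.2.1 := by
    intro p s hs hp
    rw [extChartAt_eisModel, hxJ s hs]
    exact mem_chartDomain (hT (hmaps hs)) hp
  have h21 : ∀ s ∈ J, (x s).2.1 = q (x s).1 := fun s hs => by rw [hxJ s hs]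
  have hjet := fun (p : ℝ × S × ℝ) (s : ℝ) (hs : s ∈ J) =>
    chartJet_time (d := d) (I := I) (p := p) (h21 s hs)
  have hψ := fun (p : ℝ × S × ℝ) (s : ℝ) (hs : s ∈ J) =>
    ψChart_extChartAt_eisModel (D := D) (p := p) (h21 s hs)
  have hsrc : ∀ p : ℝ × S × ℝ, ∀ s ∈ J,
      (x s ∈ (chartAt (ModelProd ℝ (ModelProd (EuclideanSpace ℝ (Fin d)) ℝ)) p).source ↔
      q (x s).1 ∈ (chartAt (EuclideanSpace ℝ (Fin d)) p.2.1).source) := by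
    intro p s hs
    rw [mem_chartAt_source_eisModel, show (x s).2.1 = q (x s).1 by rw [hxJ s hs]]
  have hvel : ∀ p : ℝ × S × ℝ, ∀ s ∈ J,
      q (x s).1 ∈ (chartAt (EuclideanSpace ℝ (Fin d)) p.2.1).source →
      (derivWithin (fun s' => extChartAt (eisModel d) p (x s')) J s).1 =
        K⁻¹ / D.ψChart p.2.1
          ((extChartAt (eisModel d) p (x s)).1, (extChartAt (eisModel d) p (x s)).2.1) ∧
      (derivWithin (fun s' => extChartAt (eisModel d) p (x s')) J s).2.1 =
        (K⁻¹ / D.ψChart p.2.1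
          ((extChartAt (eisModel d) p (x s)).1, (extChartAt (eisModel d) p (x s)).2.1)) •
        derivWithin (fun t' => extChartAt (𝓡 d) p.2.1 (q t')) I (x s).1 ∧
      (derivWithin (fun s' => extChartAt (eisModel d) p (x s')) J s).2.2 =
        (K⁻¹ / D.ψChart p.2.1
          ((extChartAt (eisModel d) p (x s)).1, (extChartAt (eisModel d) p (x s)).2.1)) *
        D.lagrangian (-κ2 / 2) p.2.1
          (((extChartAt (eisModel d) p (x s)).1, (extChartAt (eisModel d) p (x s)).2.1),
            derivWithin (fun t' => extChartAt (𝓡 d) p.2.1 (q t')) I (x s).1) := by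
    intro p s hs hp
    rw [hψ p s hs hp]
    exact velocity_of_lift hu hx2 hmaps (hq.of_le (by norm_num)) hY hxJ hθ' p hs hp
  have henergy : ∀ p : ℝ × S × ℝ, ∀ s ∈ J,
      q (x s).1 ∈ (chartAt (EuclideanSpace ℝ (Fin d)) p.2.1).source →
      metricInChart (eisModel d) D.metric p (extChartAt (eisModel d) p (x s))
        (derivWithin (fun s' => extChartAt (eisModel d) p (x s')) J s)
        (derivWithin (fun s' => extChartAt (eisModel d) p (x s')) J s) = -κ2 * K⁻¹ ^ 2 := by
    intro p s hs hp
    obtain ⟨h1, h2, h3⟩ := hvel p s hs hp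
    exact (metricInChart_energy (hdom p s hs hp) hk0 h1 h2).2 h3
  refine ⟨⟨hx2, fun p s hs hp v => ?_⟩, fun s hs => ?_⟩
  · have hqp := (hsrc p s hs).1 hp
    have hz := hdom p s hs hqp
    have hdiff := D.differentiableAt_metricCLM p hz
    have hc := hx1.hasDerivWithinAt_chart hs hp
    have hc₁ := hx2.hasDerivWithinAt_chart_two hu hs hp
    have hev : ∀ᶠ s' in 𝓝[J] s, s' ∈ J ∧
        q (x s').1 ∈ (chartAt (EuclideanSpace ℝ (Fin d)) p.2.1).source := by
      filter_upwards [eventually_mem_chart_source (hx2 s hs).continuousWithinAt hp,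
        self_mem_nhdsWithin] with s' h1 h2
      exact ⟨h2, (hsrc p s' h2).1 h1⟩
    obtain ⟨hv1, hv2, hv3⟩ := hvel p s hs hqp
    have hr1 : geodesicResidual (eisModel d) D.metric p (extChartAt (eisModel d) p (x s))
        (derivWithin (fun s' => extChartAt (eisModel d) p (x s')) J s)
        (derivWithin (derivWithin (fun s' => extChartAt (eisModel d) p (x s')) J) J s)
        (0, 0, 1) = 0 := by
      have h1 := hasDerivWithinAt_metricInChart_velocity (eisModel d) hdiff hc hc₁ (0, 0, 1)
      rw [fderiv_metricInChart_killing hz] at h1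
      have h2 := (hu s hs).eq_deriv _ h1
        ((hasDerivWithinAt_const s J (-K⁻¹)).congr_of_eventuallyEq_of_mem ?_ hs)
      · simpa using h2
      · filter_upwards [hev] with s' hs'
        have hz' := hdom p s' hs'.1 hs'.2
        rw [metricInChart_killing hz', (hvel p s' hs'.1 hs'.2).1,
          mul_div_cancel₀ _ (ψChart_pos hz').ne']
    have hr2 : ∀ v : EuclideanSpace ℝ (Fin d),
        geodesicResidual (eisModel d) D.metric p (extChartAt (eisModel d) p (x s))
        (derivWithin (fun s' => extChartAt (eisModel d) p (x s')) J s)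
        (derivWithin (derivWithin (fun s' => extChartAt (eisModel d) p (x s')) J) J s)
        (0, v, 0) = 0 := by
      intro v
      have h1 := hasDerivWithinAt_metricInChart_velocity (eisModel d) hdiff hc hc₁ (0, v, 0)
      rw [fderiv_metricInChart_force hz hv1 hv2 hv3] at h1
      have h3 := (hEL p.2.1 (x s).1 (hmaps hs) hqp).const_mul_clm_comp_apply (hθ' s hs) hmaps
        K⁻¹ v
      have h2 := (hu s hs).eq_deriv _ h1 (h3.congr_of_eventuallyEq_of_mem ?_ hs)
      · rw [← hjet p s hs, hψ p s hs hqp] at h2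
        have h4 : K⁻¹ * (K⁻¹ / D.ψ (x s).1 (q (x s).1) *
            D.force (κ2 / 2) p.2.1 (chartJet p.2.1 I q (x s).1) v) =
            K⁻¹ ^ 2 / D.ψ (x s).1 (q (x s).1) *
              D.force (κ2 / 2) p.2.1 (chartJet p.2.1 I q (x s).1) v := by ring
        linarith
      · filter_upwards [hev] with s' hs'
        obtain ⟨hw1, hw2, -⟩ := hvel p s' hs'.1 hs'.2
        rw [metricInChart_momentum (hdom p s' hs'.1 hs'.2) hw1 hw2, ← hjet p s' hs'.1]
    have hr3 : geodesicResidual (eisModel d) D.metric p (extChartAt (eisModel d) p (x s))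
        (derivWithin (fun s' => extChartAt (eisModel d) p (x s')) J s)
        (derivWithin (derivWithin (fun s' => extChartAt (eisModel d) p (x s')) J) J s)
        (derivWithin (fun s' => extChartAt (eisModel d) p (x s')) J s) = 0 := by
      have h1 := hasDerivWithinAt_metricInChart_energy (eisModel d) hdiff hc hc₁
        (metricInChart_symm hz _ _)
      have h2 := (hu s hs).eq_deriv _ h1
        ((hasDerivWithinAt_const s J (-κ2 * K⁻¹ ^ 2)).congr_of_eventuallyEq_of_mem ?_ hs)
      · linarith
      · filter_upwards [hev] with s' hs'
        exact henergy p s' hs'.1 hs'.2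
    change geodesicResidual (eisModel d) D.metric p (extChartAt (eisModel d) p (x s)) _ _ v = 0
    generalize derivWithin (fun s' => extChartAt (eisModel d) p (x s')) J s = c₁ at *
    generalize derivWithin (derivWithin (fun s' => extChartAt (eisModel d) p (x s')) J) J s = c₂
      at *
    have hc0 : c₁.1 ≠ 0 := by
      rw [hv1]
      exact div_ne_zero hk0 (ψChart_pos hz).ne'
    have hdec : v = (v.1 / c₁.1) • c₁ + ((0, v.2.1 - (v.1 / c₁.1) • c₁.2.1, 0) +
        (v.2.2 - (v.1 / c₁.1) * c₁.2.2) • (0, 0, 1)) := by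
      refine Prod.ext ?_ (Prod.ext ?_ ?_)
      · simp [hc0]
      · simp
      · simp
    rw [hdec, geodesicResidual_add hdiff, geodesicResidual_add hdiff, geodesicResidual_smul hdiff,
      geodesicResidual_smul hdiff, hr1, hr2, hr3]
    simp
  · have hp : x s ∈ (chartAt (ModelProd ℝ (ModelProd (EuclideanSpace ℝ (Fin d)) ℝ)) (x s)).source :=
      mem_chart_source _ _
    rw [metric_velocity_velocity hu hx2 hs hp]
    exact henergy (x s) s hs ((hsrc (x s) s hs).1 hp)

end EisenhartData

namespace EisenhartData

variable {d : ℕ} {S : Type*} [TopologicalSpace S] [ChartedSpace (EuclideanSpace ℝ (Fin d)) S]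

/-- The Lagrangian along a curve. -/
def lagrangianAlong (D : EisenhartData d S) (c : ℝ) (J : Set ℝ) (q : ℝ → S) (t : ℝ) : ℝ :=
  (1 / (2 * D.ψ t (q t))) * D.a t (q t) (curveVelocity (𝓡 d) J q t) (curveVelocity (𝓡 d) J q t)
    + D.b t (q t) (curveVelocity (𝓡 d) J q t) - D.ψ t (q t) * (c + 1 / 2 + D.U t (q t))

variable {D : EisenhartData d S} {J : Set ℝ} {q : ℝ → S} {p : S} {t c : ℝ}

theorem action_eq (D : EisenhartData d S) (κ t₀ t₁ : ℝ) (q : ℝ → S) :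
    D.action κ t₀ t₁ q = ∫ t in t₀..t₁, D.lagrangianAlong (κ ^ 2 / 2) (Icc t₀ t₁) q t := rfl

theorem lift_eq (D : EisenhartData d S) (κ t₀ t₁ y₀ : ℝ) (q : ℝ → S) (t : ℝ) :
    D.lift κ t₀ t₁ y₀ q t = (t, q t,
      y₀ + ∫ t' in t₀..t, D.lagrangianAlong (-κ ^ 2 / 2) (Icc t₀ t₁) q t') := by
  simp only [lift, lagrangianAlong]
  congr 4
  funext t'
  ring

theorem aChart_eq_of_mem (D : EisenhartData d S)
    (hp : q t ∈ (chartAt (EuclideanSpace ℝ (Fin d)) p).source)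
    {V W v w : EuclideanSpace ℝ (Fin d)}
    (hV : V = chartVector (𝓡 d) p (extChartAt (𝓡 d) p (q t)) v)
    (hW : W = chartVector (𝓡 d) p (extChartAt (𝓡 d) p (q t)) w) :
    D.aChart p (t, extChartAt (𝓡 d) p (q t)) v w = D.a t (q t) V W :=
  metricInChart_eq_of_mem (𝓡 d) (D.a t) hp hV hW

theorem bChart_eq_of_mem (D : EisenhartData d S)
    (hp : q t ∈ (chartAt (EuclideanSpace ℝ (Fin d)) p).source)
    {V v : EuclideanSpace ℝ (Fin d)}
    (hV : V = chartVector (𝓡 d) p (extChartAt (𝓡 d) p (q t)) v) :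
    D.bChart p (t, extChartAt (𝓡 d) p (q t)) v = D.b t (q t) V := by
  have h : (extChartAt (𝓡 d) p).symm (extChartAt (𝓡 d) p (q t)) = q t :=
    (extChartAt (𝓡 d) p).left_inv (by rwa [extChartAt_source])
  have h1 : ∀ {x x' : S} (_ : x = x') (v : EuclideanSpace ℝ (Fin d)),
      @Eq ℝ (D.b t x v) (D.b t x' v) := by
    intro x x' h v
    subst h; rfl
  rw [← h1 h V, hV]
  rfl

theorem uChart_extChartAt (hq : q t ∈ (chartAt (EuclideanSpace ℝ (Fin d)) p).source) :
    D.uChart p (t, extChartAt (𝓡 d) p (q t)) = D.U t (q t) := by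
  rw [uChart, (extChartAt (𝓡 d) p).left_inv (by rwa [extChartAt_source])]

section One

variable [IsManifold (𝓡 d) 1 S]

theorem lagrangianAlong_eq (hu : UniqueDiffOn ℝ J) (hq : ContMDiffOn 𝓘(ℝ, ℝ) (𝓡 d) 1 q J)
    (ht : t ∈ J) (hp : q t ∈ (chartAt (EuclideanSpace ℝ (Fin d)) p).source) :
    D.lagrangianAlong c J q t = D.lagrangian c p (chartJet p J q t) := by
  have h := hq.curveVelocity_eq hu ht hp
  rw [lagrangian, chartJet]
  dsimp only
  rw [D.aChart_eq_of_mem hp h h, D.bChart_eq_of_mem hp h, ψChart_extChartAt hp,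
    uChart_extChartAt hp]
  rfl

theorem continuousWithinAt_chartJet (hu : UniqueDiffOn ℝ J)
    (hq : ContMDiffOn 𝓘(ℝ, ℝ) (𝓡 d) 1 q J) (ht : t ∈ J)
    (hp : q t ∈ (chartAt (EuclideanSpace ℝ (Fin d)) p).source) :
    ContinuousWithinAt (chartJet (d := d) p J q) J t := by
  have h := ((contMDiffWithinAt_curve_iff hp).1 (hq t ht)).2
  have h1 : ContDiffWithinAt ℝ 0
      (derivWithin (fun t' => extChartAt (𝓡 d) p (q t')) J) J t :=
    (h.fderivWithin_right hu (m := 0) (by norm_num) ht).clm_apply contDiffWithinAt_const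
  exact (continuousWithinAt_id.prodMk h.continuousWithinAt).prodMk h1.continuousWithinAt

theorem continuousOn_lagrangianAlong (hu : UniqueDiffOn ℝ J) (hT : J ⊆ D.T)
    (hq : ContMDiffOn 𝓘(ℝ, ℝ) (𝓡 d) 1 q J) : ContinuousOn (D.lagrangianAlong c J q) J := by
  intro t ht
  have hp := mem_chart_source (EuclideanSpace ℝ (Fin d)) (q t)
  have h1 := ((D.contDiffOn_lagrangian c (q t)).continuousOn.continuousAt
    ((D.isOpen_lagrangianDomain (q t)).mem_nhds (chartJet_mem (J := J) (hT ht) hp))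
    ).comp_continuousWithinAt (continuousWithinAt_chartJet hu hq ht hp)
  refine h1.congr_of_eventuallyEq_of_mem ?_ ht
  filter_upwards [eventually_mem_chart_source (hq t ht).continuousWithinAt hp,
    self_mem_nhdsWithin] with t' h2 h3
  exact lagrangianAlong_eq hu hq h3 h2

theorem hasDerivWithinAt_lift {κ t₀ t₁ y₀ : ℝ} (h01 : t₀ < t₁) (hT : Icc t₀ t₁ ⊆ D.T)
    (hq : ContMDiffOn 𝓘(ℝ, ℝ) (𝓡 d) 1 q (Icc t₀ t₁)) (ht : t ∈ Icc t₀ t₁)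
    (hp : q t ∈ (chartAt (EuclideanSpace ℝ (Fin d)) p).source) :
    HasDerivWithinAt
      (fun t => y₀ + ∫ t' in t₀..t, D.lagrangianAlong (-κ ^ 2 / 2) (Icc t₀ t₁) q t')
      (D.lagrangian (-κ ^ 2 / 2) p (chartJet p (Icc t₀ t₁) q t)) (Icc t₀ t₁) t := by
  rw [← lagrangianAlong_eq (uniqueDiffOn_Icc h01) hq ht hp]
  exact (hasDerivWithinAt_integral_of_continuousOn h01
    (continuousOn_lagrangianAlong (uniqueDiffOn_Icc h01) hT hq) ht).const_add y₀

theorem chartJet_mono {I : Set ℝ} (hu : UniqueDiffOn ℝ J) (hI : J ⊆ I)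
    (hq : ContMDiffOn 𝓘(ℝ, ℝ) (𝓡 d) 1 q I) (ht : t ∈ J)
    (hp : q t ∈ (chartAt (EuclideanSpace ℝ (Fin d)) p).source) :
    chartJet (d := d) p J q t = chartJet p I q t := by
  rw [chartJet, chartJet, ((hq.hasDerivWithinAt_chart (hI ht) hp).mono hI).derivWithin (hu t ht)]

theorem IsEulerLagrange.mono {I : Set ℝ} (h : D.IsEulerLagrange c I q) (hu : UniqueDiffOn ℝ J)
    (hI : J ⊆ I) (hq : ContMDiffOn 𝓘(ℝ, ℝ) (𝓡 d) 1 q I) : D.IsEulerLagrange c J q := by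
  intro p t ht hp
  rw [chartJet_mono hu hI hq ht hp]
  refine ((h p t (hI ht) hp).mono hI).congr_of_eventuallyEq_of_mem ?_ ht
  filter_upwards [eventually_mem_chart_source ((hq.mono hI) t ht).continuousWithinAt hp,
    self_mem_nhdsWithin] with t' h2 h3
  rw [chartJet_mono hu hI hq h3 h2]

end One

/-- The first variation of the action on a piece of the curve contained in a chart. -/
theorem exists_firstVariation [IsManifold (𝓡 d) 1 S] {t₀ t₁ ε a b : ℝ} {Q : ℝ → ℝ → S}
    (hQ : IsVariation (d := d) t₀ t₁ q ε Q) (h01 : t₀ < t₁) (hT : Icc t₀ t₁ ⊆ D.T) (hab : a < b)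
    (hsub : Icc a b ⊆ Icc t₀ t₁)
    (hp : ∀ t ∈ Icc a b, q t ∈ (chartAt (EuclideanSpace ℝ (Fin d)) p).source) (c : ℝ) :
    ∃ v w : ℝ → EuclideanSpace ℝ (Fin d),
      (∀ t ∈ Icc a b, HasDerivAt (fun r => extChartAt (𝓡 d) p (Q r t)) (v t) 0) ∧
      (∀ t ∈ Icc a b, HasDerivWithinAt v (w t) (Icc a b) t) ∧
      ContinuousOn w (Icc a b) ∧
      HasDerivAt (fun r => ∫ t in a..b, D.lagrangianAlong c (Icc t₀ t₁) (Q r) t)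
        (∫ t in a..b, (D.force c p (chartJet p (Icc t₀ t₁) q t) (v t) +
          D.momentum p (chartJet p (Icc t₀ t₁) q t) (w t))) 0 := by
  obtain ⟨hε, hQ0, hQC, hQc, hQd⟩ := hQ
  obtain ⟨u, v, w, hu, hv, hw, huvw⟩ := hQd p
  have hUD := uniqueDiffOn_Icc h01
  have h0ε : (0 : ℝ) ∈ Ioo (-ε) ε := ⟨by linarith, hε⟩
  obtain ⟨δ, hδ, hδε, hδp⟩ : ∃ δ > 0, Ioo (-δ) δ ⊆ Ioo (-ε) ε ∧ ∀ r ∈ Ioo (-δ) δ, ∀ t ∈ Icc a b,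
      Q r t ∈ (chartAt (EuclideanSpace ℝ (Fin d)) p).source := by
    have h1 : ∀ᶠ r in 𝓝 (0 : ℝ), ∀ t ∈ Icc a b, r ∈ Ioo (-ε) ε → t ∈ Icc t₀ t₁ →
        Q r t ∈ (chartAt (EuclideanSpace ℝ (Fin d)) p).source := by
      refine isCompact_Icc.eventually_forall_of_forall_eventually
        (P := fun r t => r ∈ Ioo (-ε) ε → t ∈ Icc t₀ t₁ →
          Q r t ∈ (chartAt (EuclideanSpace ℝ (Fin d)) p).source) fun t ht => ?_
      have h2 := hQc (0, t) ⟨h0ε, hsub ht⟩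
      have h3 := h2 ((chartAt (EuclideanSpace ℝ (Fin d)) p).open_source.mem_nhds
        (by simp only []; rw [hQ0 t (hsub ht)]; exact hp t ht))
      have h4 := eventually_nhdsWithin_iff.1 h3
      filter_upwards [h4] with z hz hz1 hz2
      exact hz ⟨hz1, hz2⟩
    obtain ⟨δ, hδ, h2⟩ := Metric.eventually_nhds_iff.1
      (h1.and (Ioo_mem_nhds h0ε.1 h0ε.2))
    refine ⟨δ, hδ, fun r hr => (h2 ?_).2, fun r hr t ht => (h2 ?_).1 t ht (h2 ?_).2 (hsub ht)⟩ <;>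
    simpa [abs_lt] using hr
  have hR : Ioo (-δ) δ ×ˢ Icc a b ⊆ {z : ℝ × ℝ | z ∈ Ioo (-ε) ε ×ˢ Icc t₀ t₁ ∧
      Q z.1 z.2 ∈ (chartAt (EuclideanSpace ℝ (Fin d)) p).source} := fun z hz =>
    ⟨⟨hδε hz.1, hsub hz.2⟩, hδp z.1 hz.1 z.2 hz.2⟩
  have h0 : (0 : ℝ) ∈ Ioo (-δ) δ := ⟨by linarith, hδ⟩
  have huR := hu.mono hR
  have hvR := hv.mono hR
  have hwR := hw.mono hR
  have hzR : ContinuousOn (fun z : ℝ × ℝ => extChartAt (𝓡 d) p (Q z.1 z.2))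
      (Ioo (-δ) δ ×ˢ Icc a b) := by
    refine (continuousOn_extChartAt p).comp (hQc.mono fun z hz => (hR hz).1) fun z hz => ?_
    rw [extChartAt_source]
    exact (hR hz).2
  have hjetR : ContinuousOn (fun z : ℝ × ℝ => ((z.2, extChartAt (𝓡 d) p (Q z.1 z.2)), u z))
      (Ioo (-δ) δ ×ˢ Icc a b) := (continuousOn_snd.prodMk hzR).prodMk huR
  have hmem : MapsTo (fun z : ℝ × ℝ => ((z.2, extChartAt (𝓡 d) p (Q z.1 z.2)), u z))
      (Ioo (-δ) δ ×ˢ Icc a b) (D.lagrangianDomain p) := fun z hz =>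
    mem_chartDomain (hT (hsub hz.2)) (hR hz).2
  have hjet : ∀ r ∈ Ioo (-δ) δ, ∀ t ∈ Icc a b, chartJet p (Icc t₀ t₁) (Q r) t =
      ((t, extChartAt (𝓡 d) p (Q r t)), u (r, t)) := by
    intro r hr t ht
    rw [chartJet, (huvw (r, t) (hR ⟨hr, ht⟩)).1.derivWithin (hUD t (hsub ht))]
  have hjet0 : ∀ t ∈ Icc a b, chartJet p (Icc t₀ t₁) q t =
      ((t, extChartAt (𝓡 d) p (Q 0 t)), u (0, t)) := by
    intro t ht
    rw [← hjet 0 h0 t ht, chartJet, chartJet, hQ0 t (hsub ht)]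
    refine Prod.ext rfl ?_
    refine derivWithin_congr (fun t' ht' => ?_) ?_
    · rw [hQ0 t' ht']
    · rw [hQ0 t (hsub ht)]
  refine ⟨fun t => v (0, t), fun t => w (0, t), fun t ht => (huvw (0, t) (hR ⟨h0, ht⟩)).2.1,
    ?_, hwR.comp (by fun_prop) fun t ht => ⟨h0, ht⟩, ?_⟩
  · have hw0 : ContinuousOn (fun t => w (0, t)) (Icc a b) :=
      hwR.comp (by fun_prop) fun t ht => ⟨h0, ht⟩
    have key : ∀ t ∈ Icc a b, v (0, t) = v (0, a) + ∫ τ in a..t, w (0, τ) := by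
      intro t ht
      have hsubt : Icc a t ⊆ Icc a b := Icc_subset_Icc_right ht.2
      have hRt : Ioo (-δ) δ ×ˢ Icc a t ⊆ Ioo (-δ) δ ×ˢ Icc a b := prod_mono Subset.rfl hsubt
      have h1 := hasDerivAt_integral_param ht.1 hδ (huR.mono hRt) (hwR.mono hRt)
        fun z hz => (huvw z (hR (hRt hz))).2.2
      have h2 : HasDerivAt
          (fun r => extChartAt (𝓡 d) p (Q r t) - extChartAt (𝓡 d) p (Q r a))
          (v (0, t) - v (0, a)) 0 :=
        (huvw (0, t) (hR ⟨h0, ht⟩)).2.1.sub (huvw (0, a) (hR ⟨h0, left_mem_Icc.2 hab.le⟩)).2.1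
      have h3 := h1.unique (h2.congr_of_eventuallyEq ?_)
      · rw [h3]; abel
      · filter_upwards [Ioo_mem_nhds h0.1 h0.2] with r hr
        refine integral_eq_sub_of_hasDerivWithinAt_Icc (f := fun t => extChartAt (𝓡 d) p (Q r t))
          ht.1 (fun τ hτ => ?_) ?_
        · exact (huvw (r, τ) (hR ⟨hr, hsubt hτ⟩)).1.mono (hsubt.trans hsub)
        · exact huR.comp (by fun_prop) fun τ hτ => ⟨hr, hsubt hτ⟩
    intro t ht
    exact ((hasDerivWithinAt_integral_of_continuousOn hab hw0 ht).const_add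
      (v (0, a))).congr_of_mem key ht
  · have hf : ContinuousOn (fun z : ℝ × ℝ =>
        D.lagrangian c p ((z.2, extChartAt (𝓡 d) p (Q z.1 z.2)), u z))
        (Ioo (-δ) δ ×ˢ Icc a b) :=
      (D.contDiffOn_lagrangian c p).continuousOn.comp hjetR hmem
    have hf' : ContinuousOn (fun z : ℝ × ℝ =>
        D.force c p ((z.2, extChartAt (𝓡 d) p (Q z.1 z.2)), u z) (v z) +
          D.momentum p ((z.2, extChartAt (𝓡 d) p (Q z.1 z.2)), u z) (w z))
        (Ioo (-δ) δ ×ˢ Icc a b) :=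
      ((continuousOn_force.comp hjetR hmem).clm_apply hvR).add
        (((D.contDiffOn_momentum p).continuousOn.comp hjetR hmem).clm_apply hwR)
    have hd := hasDerivAt_integral_param hab.le hδ hf hf' fun z hz => by
      have h1 := huvw z (hR hz)
      have h2 : HasDerivAt (fun r => ((z.2, extChartAt (𝓡 d) p (Q r z.2)), u (r, z.2)))
          ((0, v z), w z) z.1 := ((hasDerivAt_const z.1 z.2).prodMk h1.2.1).prodMk h1.2.2
      have h3 := (differentiableAt_lagrangian (c := c) (hmem hz)).hasFDerivAt
      rw [← fderiv_lagrangian_apply (hmem hz)]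
      exact h3.comp_hasDerivAt z.1 h2
    refine (hd.congr_of_eventuallyEq ?_).congr_deriv ?_
    · filter_upwards [Ioo_mem_nhds h0.1 h0.2] with r hr
      refine intervalIntegral.integral_congr fun t ht => ?_
      rw [uIcc_of_le hab.le] at ht
      rw [← hjet r hr t ht]
      exact lagrangianAlong_eq hUD (hQC r (hδε hr)).1 (hsub ht) (hδp r hr t ht)
    · refine intervalIntegral.integral_congr fun t ht => ?_
      rw [uIcc_of_le hab.le] at ht
      rw [hjet0 t ht]

end EisenhartData

namespace EisenhartData

variable {d : ℕ} {S : Type*} [TopologicalSpace S] [ChartedSpace (EuclideanSpace ℝ (Fin d)) S]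
  {D : EisenhartData d S} {q : ℝ → S} {p : S} {t c : ℝ}

/-- The intrinsic pairing of the momentum of the velocity `V` with the tangent vector `W`. -/
def momentumPairing (D : EisenhartData d S) (t : ℝ) (x : S) (V W : TangentSpace (𝓡 d) x) : ℝ :=
  (D.ψ t x)⁻¹ * D.a t x V W + D.b t x W

/-- The variation vector field along the curve `Q 0`. -/
def variationVector (d : ℕ) {S : Type*} [TopologicalSpace S]
    [ChartedSpace (EuclideanSpace ℝ (Fin d)) S] (Q : ℝ → ℝ → S) (t : ℝ) :
    EuclideanSpace ℝ (Fin d) :=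
  curveVelocity (𝓡 d) univ (fun r => Q r t) 0

variable [IsManifold (𝓡 d) 1 S]

theorem momentum_chartJet_apply {J : Set ℝ} (hu : UniqueDiffOn ℝ J)
    (hq : ContMDiffOn 𝓘(ℝ, ℝ) (𝓡 d) 1 q J) (ht : t ∈ J)
    (hp : q t ∈ (chartAt (EuclideanSpace ℝ (Fin d)) p).source) {W w : EuclideanSpace ℝ (Fin d)}
    (hW : W = chartVector (𝓡 d) p (extChartAt (𝓡 d) p (q t)) w) :
    D.momentum p (chartJet p J q t) w =
      D.momentumPairing t (q t) (curveVelocity (𝓡 d) J q t) W := by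
  have h := hq.curveVelocity_eq hu ht hp
  unfold momentum momentumPairing chartJet
  simp only [add_apply, smul_apply, smul_eq_mul]
  rw [D.aChart_eq_of_mem hp h hW, D.bChart_eq_of_mem hp hW, ψChart_extChartAt hp]

theorem variationVector_eq {t₀ t₁ ε : ℝ} {Q : ℝ → ℝ → S}
    (hQ : IsVariation (d := d) t₀ t₁ q ε Q) (ht : t ∈ Icc t₀ t₁)
    (hp : q t ∈ (chartAt (EuclideanSpace ℝ (Fin d)) p).source) {v : EuclideanSpace ℝ (Fin d)}
    (hv : HasDerivAt (fun r => extChartAt (𝓡 d) p (Q r t)) v 0) :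
    variationVector d Q t = chartVector (𝓡 d) p (extChartAt (𝓡 d) p (q t)) v := by
  obtain ⟨hε, hQ0, -, hQc, -⟩ := hQ
  have h0ε : (0 : ℝ) ∈ Ioo (-ε) ε := ⟨by linarith, hε⟩
  have hc : ContinuousAt (fun r => Q r t) 0 := by
    have h1 : ContinuousOn (fun r => Q r t) (Ioo (-ε) ε) :=
      hQc.comp (f := fun r : ℝ => (r, t)) (by fun_prop) fun r hr => ⟨hr, ht⟩
    exact h1.continuousAt (Ioo_mem_nhds h0ε.1 h0ε.2)
  have h := curveVelocity_eq_chartVector (𝓡 d) (p := p) (x := fun r => Q r t) (J := univ) (s := 0)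
    hc.continuousWithinAt (by rwa [hQ0 t ht]) hv.hasDerivWithinAt uniqueDiffWithinAt_univ
  rw [hQ0 t ht] at h
  exact h

theorem isStationary_of_isEulerLagrange {κ t₀ t₁ : ℝ} (h01 : t₀ < t₁) (hT : Icc t₀ t₁ ⊆ D.T)
    (hq : ContMDiffOn 𝓘(ℝ, ℝ) (𝓡 d) 1 q (Icc t₀ t₁))
    (hEL : D.IsEulerLagrange (κ ^ 2 / 2) (Icc t₀ t₁) q) : D.IsStationary κ t₀ t₁ q := by
  refine ⟨⟨hq, rfl, rfl⟩, fun ε Q hQ => ?_⟩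
  have hu := uniqueDiffOn_Icc h01
  set m : ℝ → ℝ := fun t => D.momentumPairing t (q t) (curveVelocity (𝓡 d) (Icc t₀ t₁) q t)
    (variationVector d Q t) with hm
  have hε := hQ.1
  have h0ε : (0 : ℝ) ∈ Ioo (-ε) ε := ⟨by linarith, hε⟩
  have hpiece : ∀ a b : ℝ, a ≤ b → Icc a b ⊆ Icc t₀ t₁ → ∀ p : S,
      (∀ t ∈ Icc a b, q t ∈ (chartAt (EuclideanSpace ℝ (Fin d)) p).source) →
      HasDerivAt (fun r => ∫ t in a..b, D.lagrangianAlong (κ ^ 2 / 2) (Icc t₀ t₁) (Q r) t)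
        (m b - m a) 0 := by
    intro a b hab hsub p hp
    rcases hab.eq_or_lt with rfl | hab
    · simpa using hasDerivAt_const (0 : ℝ) (0 : ℝ)
    obtain ⟨v, w, hv, hvw, hwc, hd⟩ := exists_firstVariation hQ h01 hT hab hsub hp (κ ^ 2 / 2)
    refine hd.congr_deriv ?_
    have hjet : ContinuousOn (chartJet (d := d) p (Icc t₀ t₁) q) (Icc a b) := fun t ht =>
      (continuousWithinAt_chartJet hu hq (hsub ht) (hp t ht)).mono hsub
    have hmem : MapsTo (chartJet (d := d) p (Icc t₀ t₁) q) (Icc a b) (D.lagrangianDomain p) :=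
      fun t ht => chartJet_mem (hT (hsub ht)) (hp t ht)
    have hvc : ContinuousOn v (Icc a b) := fun t ht => (hvw t ht).continuousWithinAt
    rw [integral_eq_sub_of_hasDerivWithinAt_Icc
      (f := fun t => D.momentum p (chartJet p (Icc t₀ t₁) q t) (v t)) hab.le]
    · have hmt : ∀ t ∈ Icc a b, D.momentum p (chartJet p (Icc t₀ t₁) q t) (v t) = m t :=
        fun t ht => momentum_chartJet_apply hu hq (hsub ht) (hp t ht)
          (variationVector_eq hQ (hsub ht) (hp t ht) (hv t ht))
      rw [hmt a (left_mem_Icc.2 hab.le), hmt b (right_mem_Icc.2 hab.le)]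
    · intro t ht
      exact ((hEL p t (hsub ht) (hp t ht)).mono hsub).clm_apply (hvw t ht)
    · exact ((continuousOn_force.comp hjet hmem).clm_apply hvc).add
        (((D.contDiffOn_momentum p).continuousOn.comp hjet hmem).clm_apply hwc)
  have hend : ∀ t ∈ Icc t₀ t₁, (∀ r ∈ Ioo (-ε) ε, Q r t = q t) → m t = 0 := by
    intro t ht hr
    have hp := mem_chart_source (EuclideanSpace ℝ (Fin d)) (q t)
    have h1 : HasDerivAt (fun r => extChartAt (𝓡 d) (q t) (Q r t)) 0 0 := by
      refine (hasDerivAt_const (0 : ℝ) (extChartAt (𝓡 d) (q t) (q t))).congr_of_eventuallyEq ?_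
      filter_upwards [Ioo_mem_nhds h0ε.1 h0ε.2] with r h
      rw [hr r h]
    rw [hm]
    dsimp only
    rw [← momentum_chartJet_apply hu hq ht hp (variationVector_eq hQ ht hp h1), map_zero]
  obtain ⟨τ, hτ0, hτm, ⟨N, hN⟩, hτc⟩ := exists_monotone_Icc_subset_open_cover_Icc h01.le
    (c := fun p : S => (fun t : Icc t₀ t₁ => q t) ⁻¹'
      (chartAt (EuclideanSpace ℝ (Fin d)) p).source)
    (fun p => (chartAt (EuclideanSpace ℝ (Fin d)) p).open_source.preimage
      (continuousOn_iff_continuous_domRestrict.1 hq.continuousOn))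
    (fun t _ => mem_iUnion.2 ⟨q t, mem_chart_source _ _⟩)
  have hint : ∀ r ∈ Ioo (-ε) ε, ∀ a ∈ Icc t₀ t₁, ∀ b ∈ Icc t₀ t₁, IntervalIntegrable
      (D.lagrangianAlong (κ ^ 2 / 2) (Icc t₀ t₁) (Q r)) MeasureTheory.volume a b := by
    intro r hr a ha b hb
    refine ((continuousOn_lagrangianAlong hu hT (hQ.2.2.1 r hr).1).mono ?_).intervalIntegrable
    exact ordConnected_Icc.uIcc_subset ha hb
  have hind : ∀ n : ℕ, HasDerivAt
      (fun r => ∫ t in t₀..τ n, D.lagrangianAlong (κ ^ 2 / 2) (Icc t₀ t₁) (Q r) t)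
        (m (τ n) - m t₀) 0 := by
    intro n
    induction n with
    | zero => simpa [hτ0] using hasDerivAt_const (0 : ℝ) (0 : ℝ)
    | succ n ih =>
      obtain ⟨p, hp⟩ := hτc n
      have hsub : Icc (τ n : ℝ) (τ (n + 1)) ⊆ Icc t₀ t₁ :=
        Icc_subset_Icc (τ n).2.1 (τ (n + 1)).2.2
      have h1 := hpiece (τ n) (τ (n + 1)) (hτm n.le_succ) hsub p fun t ht =>
        hp (a := ⟨t, hsub ht⟩) ⟨ht.1, ht.2⟩
      refine ((ih.add h1).congr_of_eventuallyEq ?_).congr_deriv (by ring)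
      filter_upwards [Ioo_mem_nhds h0ε.1 h0ε.2] with r hr
      exact (intervalIntegral.integral_add_adjacent_intervals
        (hint r hr _ (left_mem_Icc.2 h01.le) _ (τ n).2)
        (hint r hr _ (τ n).2 _ (τ (n + 1)).2)).symm
  have hfin := hind N
  rw [hN N le_rfl, hend t₁ (right_mem_Icc.2 h01.le) (fun r hr => (hQ.2.2.1 r hr).2.2),
    hend t₀ (left_mem_Icc.2 h01.le) (fun r hr => (hQ.2.2.1 r hr).2.1), sub_zero] at hfin
  exact hfin

end EisenhartData

section BumpVariation

variable {d : ℕ} {S : Type*} [TopologicalSpace S] [ChartedSpace (EuclideanSpace ℝ (Fin d)) S]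

theorem contDiffOn_chart_transition [IsManifold (𝓡 d) 2 S] (p p' : S) :
    ContDiffOn ℝ 2 (fun z => extChartAt (𝓡 d) p' ((extChartAt (𝓡 d) p).symm z))
      ((extChartAt (𝓡 d) p).target ∩ (extChartAt (𝓡 d) p).symm ⁻¹'
        (chartAt (EuclideanSpace ℝ (Fin d)) p').source) := by
  rw [← contMDiffOn_iff_contDiffOn]
  exact (contMDiffOn_extChartAt (x := p')).comp
    ((contMDiffOn_extChartAt_symm p).mono inter_subset_left) fun z hz => hz.2

theorem isOpen_chart_transition (p p' : S) :
    IsOpen ((extChartAt (𝓡 d) p).target ∩ (extChartAt (𝓡 d) p).symm ⁻¹'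
        (chartAt (EuclideanSpace ℝ (Fin d)) p').source) :=
  (continuousOn_extChartAt_symm p).isOpen_inter_preimage (isOpen_extChartAt_target p)
    (chartAt (EuclideanSpace ℝ (Fin d)) p').open_source

open Classical in
/-- The variation of `q` which moves `q t` by `r * η t` in the direction `e`, in the chart
around `p`. -/
def bumpVariation (q : ℝ → S) (p : S) (η : ℝ → ℝ) (e : EuclideanSpace ℝ (Fin d)) (r t : ℝ) : S :=
  if t ∈ tsupport η then
    (extChartAt (𝓡 d) p).symm (extChartAt (𝓡 d) p (q t) + (r * η t) • e)
  else q t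

variable {q : ℝ → S} {p : S} {η : ℝ → ℝ} {e : EuclideanSpace ℝ (Fin d)} {a b t₀ t₁ : ℝ}

theorem bumpVariation_of_notMem {t : ℝ} (ht : t ∉ tsupport η) (r : ℝ) :
    bumpVariation q p η e r t = q t := if_neg ht

theorem bumpVariation_of_mem
    (hp : ∀ t ∈ Icc a b, q t ∈ (chartAt (EuclideanSpace ℝ (Fin d)) p).source) {t : ℝ}
    (ht : t ∈ Icc a b) (r : ℝ) : bumpVariation q p η e r t =
      (extChartAt (𝓡 d) p).symm (extChartAt (𝓡 d) p (q t) + (r * η t) • e) := by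
  by_cases h : t ∈ tsupport η
  · exact if_pos h
  · rw [bumpVariation_of_notMem h, image_eq_zero_of_notMem_tsupport h, mul_zero, zero_smul,
      add_zero, (extChartAt (𝓡 d) p).left_inv (by rw [extChartAt_source]; exact hp t ht)]

theorem exists_bumpVariation_isVariation [IsManifold (𝓡 d) 2 S] (h01 : t₀ < t₁)
    (hsub : Icc a b ⊆ Icc t₀ t₁) (hq : ContMDiffOn 𝓘(ℝ, ℝ) (𝓡 d) 1 q (Icc t₀ t₁))
    (hp : ∀ t ∈ Icc a b, q t ∈ (chartAt (EuclideanSpace ℝ (Fin d)) p).source)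
    (hη : ContDiff ℝ ∞ η) (hηs : tsupport η ⊆ Ioo a b) (e : EuclideanSpace ℝ (Fin d)) :
    ∃ ε : ℝ, IsVariation (d := d) t₀ t₁ q ε (bumpVariation q p η e) ∧
      ∀ r ∈ Ioo (-ε) ε, ∀ t ∈ Icc a b,
        extChartAt (𝓡 d) p (q t) + (r * η t) • e ∈ (extChartAt (𝓡 d) p).target := by
  have hUD := uniqueDiffOn_Icc h01
  set ζ : ℝ → EuclideanSpace ℝ (Fin d) := fun t => extChartAt (𝓡 d) p (q t) with hζ
  have hηd : ∀ t, HasDerivAt η (deriv η t) t := fun t =>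
    (hη.differentiable (by simp) t).hasDerivAt
  have hηc : Continuous (deriv η) := hη.continuous_deriv (by simp)
  have hζd : ∀ t ∈ Icc a b, ContDiffWithinAt ℝ 1 ζ (Icc t₀ t₁) t := fun t ht =>
    ((contMDiffWithinAt_curve_iff (hp t ht)).1 (hq t (hsub ht))).2
  have hζ' : ∀ t ∈ Icc a b, HasDerivWithinAt ζ (derivWithin ζ (Icc t₀ t₁) t) (Icc t₀ t₁) t :=
    fun t ht => ((hζd t ht).differentiableWithinAt one_ne_zero).hasDerivWithinAt
  have hζc : ∀ t ∈ Icc a b, ContinuousWithinAt (derivWithin ζ (Icc t₀ t₁)) (Icc t₀ t₁) t :=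
    fun t ht => (continuousWithinAt_snd.comp (t := univ)
      (EisenhartData.continuousWithinAt_chartJet hUD hq (hsub ht) (hp t ht)) (mapsTo_univ _ _))
  obtain ⟨ε, hε, hεt⟩ : ∃ ε > 0, ∀ r ∈ Ioo (-ε) ε, ∀ t ∈ Icc a b,
      ζ t + (r * η t) • e ∈ (extChartAt (𝓡 d) p).target := by
    have h1 : ∀ᶠ r in 𝓝 (0 : ℝ), ∀ t ∈ Icc a b, t ∈ Icc a b →
        ζ t + (r * η t) • e ∈ (extChartAt (𝓡 d) p).target := by
      refine isCompact_Icc.eventually_forall_of_forall_eventually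
        (P := fun r t => t ∈ Icc a b →
          ζ t + (r * η t) • e ∈ (extChartAt (𝓡 d) p).target) fun t ht => ?_
      have h2 : ContinuousWithinAt (fun z : ℝ × ℝ => ζ z.2 + (z.1 * η z.2) • e)
          (univ ×ˢ Icc a b) (0, t) := by
        have h3 : ContinuousWithinAt (fun z : ℝ × ℝ => ζ z.2) (univ ×ˢ Icc a b) (0, t) :=
          ContinuousWithinAt.comp (g := ζ) (f := Prod.snd) (x := ((0 : ℝ), t))
            ((hζd t ht).continuousWithinAt.mono hsub) continuousWithinAt_snd fun z hz => hz.2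
        have h4 : Continuous (fun z : ℝ × ℝ => (z.1 * η z.2) • e) := by
          have := hη.continuous
          fun_prop
        exact h3.add h4.continuousWithinAt
      have h3 := h2 ((isOpen_extChartAt_target p).mem_nhds (by
        simp only [zero_mul, zero_smul, add_zero]
        exact (extChartAt (𝓡 d) p).map_source (by rw [extChartAt_source]; exact hp t ht)))
      filter_upwards [eventually_nhdsWithin_iff.1 h3] with z hz hz1
      exact hz ⟨trivial, hz1⟩
    obtain ⟨δ, hδ, h2⟩ := Metric.eventually_nhds_iff.1 h1
    refine ⟨δ, hδ, fun r hr t ht => h2 ?_ t ht ht⟩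
    simpa [abs_lt] using hr
  have hsuppI : tsupport η ⊆ Icc a b := hηs.trans Ioo_subset_Icc_self
  have hopen : IsOpen (tsupport η)ᶜ := (isClosed_tsupport η).isOpen_compl
  have hWr : ∀ r : ℝ, ∀ t ∈ Icc a b, HasDerivWithinAt (fun t => ζ t + (r * η t) • e)
      (derivWithin ζ (Icc t₀ t₁) t + (r * deriv η t) • e) (Icc t₀ t₁) t := fun r t ht =>
    (hζ' t ht).add ((((hηd t).hasDerivWithinAt).const_mul r).smul_const e)
  have hWt : ∀ r t : ℝ, HasDerivAt (fun r => ζ t + (r * η t) • e) (η t • e) r := fun r t => by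
    simpa using (((hasDerivAt_id r).mul_const (η t)).smul_const e).const_add (ζ t)
  have hWc : ∀ (Ω : Set (ℝ × ℝ)) (z : ℝ × ℝ), MapsTo Prod.snd Ω (Icc t₀ t₁) → z.2 ∈ Icc a b →
      ContinuousWithinAt (fun z : ℝ × ℝ => ζ z.2 + (z.1 * η z.2) • e) Ω z := by
    intro Ω z hm hz
    have h3 : ContinuousWithinAt (fun z : ℝ × ℝ => ζ z.2) Ω z :=
      (hζd z.2 hz).continuousWithinAt.comp continuousWithinAt_snd hm
    have h4 : Continuous (fun z : ℝ × ℝ => (z.1 * η z.2) • e) := by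
      have := hη.continuous
      fun_prop
    exact h3.add h4.continuousWithinAt
  have hnear : ∀ t ∈ tsupport η, ∀ᶠ t' in 𝓝 t, t' ∈ Icc a b := fun t ht =>
    Filter.mem_of_superset (Ioo_mem_nhds (hηs ht).1 (hηs ht).2) Ioo_subset_Icc_self
  refine ⟨ε, ⟨hε, ?_, ?_, ?_, ?_⟩, hεt⟩
  · intro t ht
    by_cases h : t ∈ tsupport η
    · rw [bumpVariation_of_mem hp (hsuppI h), zero_mul, zero_smul, add_zero,
        (extChartAt (𝓡 d) p).left_inv (by rw [extChartAt_source]; exact hp t (hsuppI h))]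
    · exact bumpVariation_of_notMem h 0
  · intro r hr
    have hends : ∀ t, t ∉ Ioo a b → bumpVariation q p η e r t = q t := fun t ht =>
      bumpVariation_of_notMem (fun h => ht (hηs h)) r
    refine ⟨fun t ht => ?_, hends t₀ ?_, hends t₁ ?_⟩
    · by_cases h : t ∈ tsupport η
      · have h1 : ContMDiffWithinAt 𝓘(ℝ, ℝ) 𝓘(ℝ, EuclideanSpace ℝ (Fin d)) 1
            (fun t => ζ t + (r * η t) • e) (Icc t₀ t₁) t := by
          refine ContDiffWithinAt.contMDiffWithinAt ?_
          have h2 : ContDiff ℝ 1 (fun t => (r * η t) • e) :=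
            (contDiff_const.mul (hη.of_le (by simp))).smul contDiff_const
          exact (hζd t (hsuppI h)).add h2.contDiffWithinAt
        have h2 := ((contMDiffOn_extChartAt_symm (I := 𝓡 d) (n := 1) p).contMDiffAt
          ((isOpen_extChartAt_target p).mem_nhds (hεt r hr t (hsuppI h))))
        refine (ContMDiffAt.comp_contMDiffWithinAt t h2 h1).congr_of_eventuallyEq ?_ ?_
        · filter_upwards [nhdsWithin_le_nhds (hnear t h)] with t' ht'
          exact bumpVariation_of_mem hp ht' r
        · exact bumpVariation_of_mem hp (hsuppI h) r
      · refine (hq t ht).congr_of_eventuallyEq ?_ (bumpVariation_of_notMem h r)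
        filter_upwards [nhdsWithin_le_nhds (hopen.mem_nhds h)] with t' ht'
        exact bumpVariation_of_notMem ht' r
    · exact fun h => absurd (hsub ⟨le_rfl, (h.1.trans h.2).le⟩).1 (not_le.2 h.1)
    · exact fun h => absurd (hsub ⟨(h.1.trans h.2).le, le_rfl⟩).2 (not_le.2 h.2)
  · rintro ⟨r, t⟩ ⟨hr, ht⟩
    by_cases h : t ∈ tsupport η
    · have h1 := hWc (Ioo (-ε) ε ×ˢ Icc t₀ t₁) (r, t) (fun z hz => hz.2) (hsuppI h)
      have h2 := (continuousOn_extChartAt_symm (I := 𝓡 d) p).continuousAt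
          ((isOpen_extChartAt_target p).mem_nhds (hεt r hr t (hsuppI h)))
      refine (ContinuousAt.comp_continuousWithinAt (x := (r, t)) h2 h1).congr_of_eventuallyEq ?_ ?_
      · filter_upwards [nhdsWithin_le_nhds (continuousAt_snd (hnear t h))] with z hz
        exact bumpVariation_of_mem hp hz z.1
      · exact bumpVariation_of_mem hp (hsuppI h) r
    · have h1 : ContinuousWithinAt (fun z : ℝ × ℝ => q z.2) (Ioo (-ε) ε ×ˢ Icc t₀ t₁) (r, t) :=
        (hq t ht).continuousWithinAt.comp (x := (r, t)) continuousWithinAt_snd fun z hz => hz.2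
      refine h1.congr_of_eventuallyEq ?_ (bumpVariation_of_notMem h r)
      filter_upwards [nhdsWithin_le_nhds (continuousAt_snd (hopen.mem_nhds h))] with z hz
      exact bumpVariation_of_notMem hz z.1
  · intro p'
    classical
    set Φ : EuclideanSpace ℝ (Fin d) → EuclideanSpace ℝ (Fin d) :=
      fun z => extChartAt (𝓡 d) p' ((extChartAt (𝓡 d) p).symm z) with hΦ
    set O := (extChartAt (𝓡 d) p).target ∩ (extChartAt (𝓡 d) p).symm ⁻¹'
        (chartAt (EuclideanSpace ℝ (Fin d)) p').source with hO
    have hOo : IsOpen O := isOpen_chart_transition p p'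
    have hΦ2 : ContDiffOn ℝ 2 Φ O := contDiffOn_chart_transition p p'
    have hΦd : ∀ z ∈ O, HasFDerivAt Φ (fderiv ℝ Φ z) z := fun z hz =>
      ((hΦ2.differentiableOn (by norm_num)).differentiableAt (hOo.mem_nhds hz)).hasFDerivAt
    have hΦ1 : ContDiffOn ℝ 1 (fderiv ℝ Φ) O := hΦ2.fderiv_of_isOpen hOo (by norm_num)
    have hΦdd : ∀ z ∈ O, HasFDerivAt (fderiv ℝ Φ) (fderiv ℝ (fderiv ℝ Φ) z) z := fun z hz =>
      ((hΦ1.differentiableOn one_ne_zero).differentiableAt (hOo.mem_nhds hz)).hasFDerivAt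
    have hΦc : ∀ z ∈ O, ContinuousAt (fderiv ℝ Φ) z := fun z hz =>
      hΦ1.continuousOn.continuousAt (hOo.mem_nhds hz)
    have hΦcc : ∀ z ∈ O, ContinuousAt (fderiv ℝ (fderiv ℝ Φ)) z := fun z hz =>
      (hΦ1.continuousOn_fderiv_of_isOpen hOo le_rfl).continuousAt (hOo.mem_nhds hz)
    set W : ℝ × ℝ → EuclideanSpace ℝ (Fin d) := fun z => ζ z.2 + (z.1 * η z.2) • e with hW
    set u₁ : ℝ × ℝ → EuclideanSpace ℝ (Fin d) := fun z =>
      fderiv ℝ Φ (W z) (derivWithin ζ (Icc t₀ t₁) z.2 + (z.1 * deriv η z.2) • e) with hu₁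
    set v₁ : ℝ × ℝ → EuclideanSpace ℝ (Fin d) := fun z => fderiv ℝ Φ (W z) (η z.2 • e) with hv₁
    set w₁ : ℝ × ℝ → EuclideanSpace ℝ (Fin d) := fun z =>
      fderiv ℝ (fderiv ℝ Φ) (W z) (η z.2 • e)
        (derivWithin ζ (Icc t₀ t₁) z.2 + (z.1 * deriv η z.2) • e)
        + fderiv ℝ Φ (W z) (deriv η z.2 • e) with hw₁
    set u₂ : ℝ → EuclideanSpace ℝ (Fin d) :=
      derivWithin (fun t => extChartAt (𝓡 d) p' (q t)) (Icc t₀ t₁) with hu₂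
    set Ω : Set (ℝ × ℝ) := {z | z ∈ Ioo (-ε) ε ×ˢ Icc t₀ t₁ ∧
      bumpVariation q p η e z.1 z.2 ∈ (chartAt (EuclideanSpace ℝ (Fin d)) p').source} with hΩ
    have hΩW : ∀ z ∈ Ω, z.2 ∈ Icc a b → W z ∈ O := by
      intro z hz hz2
      refine ⟨hεt z.1 hz.1.1 z.2 hz2, ?_⟩
      rw [mem_preimage, ← bumpVariation_of_mem hp hz2]
      exact hz.2
    have hΩs : MapsTo Prod.snd Ω (Icc t₀ t₁) := fun z hz => hz.1.2
    have hagree : ∀ z ∈ Ω, z.2 ∈ Icc a b → z.2 ∉ tsupport η →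
        u₁ z = u₂ z.2 ∧ v₁ z = 0 ∧ w₁ z = 0 := by
      intro z hz hzI hzs
      have e1 : η z.2 = 0 := image_eq_zero_of_notMem_tsupport hzs
      have e2 : deriv η z.2 = 0 := by
        have h := (notMem_tsupport_iff_eventuallyEq.1 hzs).deriv_eq
        rw [h]
        simp
      refine ⟨?_, by simp [hv₁, e1], by simp [hw₁, e1, e2]⟩
      have hqz : q z.2 ∈ (chartAt (EuclideanSpace ℝ (Fin d)) p').source := by
        rw [← bumpVariation_of_notMem (q := q) (p := p) (e := e) hzs z.1]
        exact hz.2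
      have hWz : W z = ζ z.2 := by simp [hW, e1]
      have h1 : HasDerivWithinAt (fun t => Φ (ζ t))
          (fderiv ℝ Φ (W z) (derivWithin ζ (Icc t₀ t₁) z.2)) (Icc t₀ t₁) z.2 := by
        have h2 := hΦd _ (hΩW z hz hzI)
        rw [hWz] at h2 ⊢
        exact h2.comp_hasDerivWithinAt z.2 (hζ' z.2 hzI)
      have h3 : HasDerivWithinAt (fun t => extChartAt (𝓡 d) p' (q t))
          (fderiv ℝ Φ (W z) (derivWithin ζ (Icc t₀ t₁) z.2)) (Icc t₀ t₁) z.2 := by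
        refine h1.congr_of_eventuallyEq_of_mem ?_ (hΩs hz)
        filter_upwards [eventually_mem_chart_source (hq z.2 (hΩs hz)).continuousWithinAt
          (hp z.2 hzI)] with t ht
        simp only [hΦ, hζ]
        rw [(extChartAt (𝓡 d) p).left_inv (by rwa [extChartAt_source])]
      rw [hu₂, h3.derivWithin (hUD _ (hΩs hz))]
      simp [hu₁, e2]
    have hcont : ∀ f₁ f₂ : ℝ × ℝ → EuclideanSpace ℝ (Fin d),
        (∀ z ∈ Ω, z.2 ∈ tsupport η → ContinuousWithinAt f₁ Ω z) →
        (∀ z ∈ Ω, z.2 ∉ tsupport η → ContinuousWithinAt f₂ Ω z) →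
        (∀ z ∈ Ω, z.2 ∈ Icc a b → z.2 ∉ tsupport η → f₁ z = f₂ z) →
        ContinuousOn (fun z => if z.2 ∈ tsupport η then f₁ z else f₂ z) Ω := by
      intro f₁ f₂ h₁ h₂ h₁₂ z hz
      by_cases h : z.2 ∈ tsupport η
      · refine (h₁ z hz h).congr_of_eventuallyEq ?_ (if_pos h)
        filter_upwards [nhdsWithin_le_nhds (continuousAt_snd (hnear z.2 h)),
          self_mem_nhdsWithin] with z' hz' hz'Ω
        by_cases h' : z'.2 ∈ tsupport η
        · exact if_pos h'
        · rw [if_neg h', h₁₂ z' hz'Ω hz' h']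
      · refine (h₂ z hz h).congr_of_eventuallyEq ?_ (if_neg h)
        filter_upwards [nhdsWithin_le_nhds (continuousAt_snd (hopen.mem_nhds h))] with z' hz'
        exact if_neg hz'
    have hηcΩ : ∀ z, ContinuousWithinAt (fun z : ℝ × ℝ => η z.2 • e) Ω z := fun z =>
      ((hη.continuous.comp continuous_snd).smul continuous_const).continuousWithinAt
    have hη'cΩ : ∀ z, ContinuousWithinAt (fun z : ℝ × ℝ => deriv η z.2 • e) Ω z := fun z =>
      ((hηc.comp continuous_snd).smul continuous_const).continuousWithinAt
    have hUc : ∀ z ∈ Ω, z.2 ∈ tsupport η → ContinuousWithinAt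
        (fun z : ℝ × ℝ => derivWithin ζ (Icc t₀ t₁) z.2 + (z.1 * deriv η z.2) • e) Ω z := by
      intro z hz h
      have h1 : ContinuousWithinAt (fun z : ℝ × ℝ => derivWithin ζ (Icc t₀ t₁) z.2) Ω z :=
        (hζc z.2 (hsuppI h)).comp continuousWithinAt_snd hΩs
      exact h1.add (((continuous_fst.mul (hηc.comp continuous_snd)).smul
        continuous_const).continuousWithinAt)
    have hDc : ∀ z ∈ Ω, z.2 ∈ tsupport η →
        ContinuousWithinAt (fun z => fderiv ℝ Φ (W z)) Ω z := fun z hz h =>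
      (hΦc _ (hΩW z hz (hsuppI h))).comp_continuousWithinAt (hWc Ω z hΩs (hsuppI h))
    have hDDc : ∀ z ∈ Ω, z.2 ∈ tsupport η →
        ContinuousWithinAt (fun z => fderiv ℝ (fderiv ℝ Φ) (W z)) Ω z := fun z hz h =>
      (hΦcc _ (hΩW z hz (hsuppI h))).comp_continuousWithinAt (hWc Ω z hΩs (hsuppI h))
    refine ⟨fun z => if z.2 ∈ tsupport η then u₁ z else u₂ z.2,
      fun z => if z.2 ∈ tsupport η then v₁ z else 0,
      fun z => if z.2 ∈ tsupport η then w₁ z else 0, ?_, ?_, ?_, ?_⟩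
    · refine hcont u₁ (fun z => u₂ z.2) (fun z hz h => (hDc z hz h).clm_apply (hUc z hz h)) ?_
        fun z hz h h' => (hagree z hz h h').1
      intro z hz h
      have hqz : q z.2 ∈ (chartAt (EuclideanSpace ℝ (Fin d)) p').source := by
        rw [← bumpVariation_of_notMem (q := q) (p := p) (e := e) h z.1]
        exact hz.2
      have h1 : ContinuousWithinAt u₂ (Icc t₀ t₁) z.2 :=
        continuousWithinAt_snd.comp (t := univ)
          (EisenhartData.continuousWithinAt_chartJet hUD hq (hΩs hz) hqz) (mapsTo_univ _ _)
      exact h1.comp continuousWithinAt_snd hΩs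
    · exact hcont v₁ (fun _ => 0) (fun z hz h => (hDc z hz h).clm_apply (hηcΩ z))
        (fun z _ _ => continuousWithinAt_const) fun z hz h h' => (hagree z hz h h').2.1
    · exact hcont w₁ (fun _ => 0)
        (fun z hz h => (((hDDc z hz h).clm_apply (hηcΩ z)).clm_apply (hUc z hz h)).add
          ((hDc z hz h).clm_apply (hη'cΩ z)))
        (fun z _ _ => continuousWithinAt_const) fun z hz h h' => (hagree z hz h h').2.2
    · rintro ⟨r, t⟩ hz
      have htI : t ∈ Icc t₀ t₁ := hΩs hz
      by_cases h : t ∈ tsupport η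
      · have hO' := hΩW _ hz (hsuppI h)
        simp only [if_pos h]
        refine ⟨?_, ?_, ?_⟩
        · have h1 : HasDerivWithinAt (fun t' => Φ (W (r, t'))) (u₁ (r, t)) (Icc t₀ t₁) t :=
            HasFDerivAt.comp_hasDerivWithinAt (l := Φ) (f := fun t' => W (r, t')) t (hΦd _ hO')
              (hWr r t (hsuppI h))
          refine h1.congr_of_eventuallyEq_of_mem ?_ htI
          filter_upwards [nhdsWithin_le_nhds (hnear t h)] with t' ht'
          rw [bumpVariation_of_mem hp ht' r]
        · have h1 : HasDerivAt (fun r' => Φ (W (r', t))) (v₁ (r, t)) r :=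
            HasFDerivAt.comp_hasDerivAt (l := Φ) (f := fun r' => W (r', t)) r (hΦd _ hO') (hWt r t)
          refine h1.congr_of_eventuallyEq (Filter.Eventually.of_forall fun r' => ?_)
          dsimp only
          rw [bumpVariation_of_mem hp (hsuppI h) r']
        · have h1 : HasDerivAt (fun r' => fderiv ℝ Φ (W (r', t)))
              (fderiv ℝ (fderiv ℝ Φ) (W (r, t)) (η t • e)) r :=
            (hΦdd _ hO').comp_hasDerivAt r (hWt r t)
          have h2 : HasDerivAt
              (fun r' : ℝ => derivWithin ζ (Icc t₀ t₁) t + (r' * deriv η t) • e)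
              (deriv η t • e) r := by
            simpa using (((hasDerivAt_id r).mul_const (deriv η t)).smul_const e).const_add
              (derivWithin ζ (Icc t₀ t₁) t)
          exact h1.clm_apply h2
      · simp only [if_neg h]
        have hqz : q t ∈ (chartAt (EuclideanSpace ℝ (Fin d)) p').source := by
          rw [← bumpVariation_of_notMem (q := q) (p := p) (e := e) h r]
          exact hz.2
        refine ⟨?_, ?_, hasDerivAt_const r _⟩
        · refine (hq.hasDerivWithinAt_chart htI hqz).congr_of_eventuallyEq_of_mem ?_ htI
          filter_upwards [nhdsWithin_le_nhds (hopen.mem_nhds h)] with t' ht'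
          rw [bumpVariation_of_notMem ht' r]
        · refine (hasDerivAt_const r (extChartAt (𝓡 d) p' (q t))).congr_of_eventuallyEq
            (Filter.Eventually.of_forall fun r' => ?_)
          dsimp only
          rw [bumpVariation_of_notMem h r']

end BumpVariation

namespace EisenhartData

variable {d : ℕ} {S : Type*} [TopologicalSpace S] [ChartedSpace (EuclideanSpace ℝ (Fin d)) S]
  [IsManifold (𝓡 d) 2 S] {D : EisenhartData d S} {q : ℝ → S} {p : S} {a b t₀ t₁ κ : ℝ}

theorem lagrangianAlong_bumpVariation (h01 : t₀ < t₁)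
    (hq : ContMDiffOn 𝓘(ℝ, ℝ) (𝓡 d) 1 q (Icc t₀ t₁)) {η : ℝ → ℝ}
    {e : EuclideanSpace ℝ (Fin d)} {r t c : ℝ} (ht : t ∈ Icc t₀ t₁) (hη : t ∉ tsupport η)
    (hQ : ContMDiffOn 𝓘(ℝ, ℝ) (𝓡 d) 1 (bumpVariation q p η e r) (Icc t₀ t₁)) :
    D.lagrangianAlong c (Icc t₀ t₁) (bumpVariation q p η e r) t =
      D.lagrangianAlong c (Icc t₀ t₁) q t := by
  have hu := uniqueDiffOn_Icc h01
  have h0 : bumpVariation q p η e r t = q t := bumpVariation_of_notMem hη r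
  have hp := mem_chart_source (EuclideanSpace ℝ (Fin d)) (q t)
  rw [lagrangianAlong_eq (p := q t) hu hQ ht (by rwa [h0]), lagrangianAlong_eq hu hq ht hp]
  have h1 : chartJet (q t) (Icc t₀ t₁) (bumpVariation q p η e r) t =
      chartJet (d := d) (q t) (Icc t₀ t₁) q t := by
    rw [chartJet, chartJet, h0]
    refine Prod.ext rfl (Filter.EventuallyEq.derivWithin_eq_of_mem ?_ ht)
    filter_upwards [nhdsWithin_le_nhds ((isClosed_tsupport η).isOpen_compl.mem_nhds hη)] with t' ht'
    rw [bumpVariation_of_notMem ht' r]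
  rw [h1]

/-- The weak form of the Euler–Lagrange equations on a piece of the curve contained in a chart. -/
theorem IsStationary.integral_eq_zero (h01 : t₀ < t₁) (hT : Icc t₀ t₁ ⊆ D.T)
    (hq : ContMDiffOn 𝓘(ℝ, ℝ) (𝓡 d) 1 q (Icc t₀ t₁)) (hs : D.IsStationary κ t₀ t₁ q)
    (hab : a < b) (hsub : Icc a b ⊆ Icc t₀ t₁)
    (hp : ∀ t ∈ Icc a b, q t ∈ (chartAt (EuclideanSpace ℝ (Fin d)) p).source)
    {η : ℝ → ℝ} (hη : ContDiff ℝ ∞ η) (hηs : tsupport η ⊆ Ioo a b)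
    (e : EuclideanSpace ℝ (Fin d)) :
    ∫ t in a..b, (D.force (κ ^ 2 / 2) p (chartJet p (Icc t₀ t₁) q t) (η t • e) +
      D.momentum p (chartJet p (Icc t₀ t₁) q t) (deriv η t • e)) = 0 := by
  have hu := uniqueDiffOn_Icc h01
  obtain ⟨ε, hQ, hεt⟩ := exists_bumpVariation_isVariation h01 hsub hq hp hη hηs e
  have h0ε : (0 : ℝ) ∈ Ioo (-ε) ε := ⟨by linarith [hQ.1], hQ.1⟩
  obtain ⟨v, w, hv, hvw, hwc, hd⟩ := exists_firstVariation hQ h01 hT hab hsub hp (κ ^ 2 / 2)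
  have hηd : ∀ t, HasDerivAt η (deriv η t) t := fun t =>
    (hη.differentiable (by simp) t).hasDerivAt
  have hv' : ∀ t ∈ Icc a b, v t = η t • e := by
    intro t ht
    refine (hv t ht).unique ?_
    have h1 : HasDerivAt (fun r => extChartAt (𝓡 d) p (q t) + (r * η t) • e) (η t • e) 0 := by
      simpa using (((hasDerivAt_id (0 : ℝ)).mul_const (η t)).smul_const e).const_add
        (extChartAt (𝓡 d) p (q t))
    refine h1.congr_of_eventuallyEq ?_
    filter_upwards [Ioo_mem_nhds h0ε.1 h0ε.2] with r hr
    rw [bumpVariation_of_mem hp ht, (extChartAt (𝓡 d) p).right_inv (hεt r hr t ht)]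
  have hw' : ∀ t ∈ Icc a b, w t = deriv η t • e := fun t ht =>
    ((uniqueDiffOn_Icc hab) t ht).eq_deriv _ (hvw t ht)
      (((hηd t).smul_const e).hasDerivWithinAt.congr_of_mem hv' ht)
  have haI := hsub (left_mem_Icc.2 hab.le)
  have hbI := hsub (right_mem_Icc.2 hab.le)
  have hint : ∀ r ∈ Ioo (-ε) ε, ∀ a ∈ Icc t₀ t₁, ∀ b ∈ Icc t₀ t₁, IntervalIntegrable
      (D.lagrangianAlong (κ ^ 2 / 2) (Icc t₀ t₁) (bumpVariation q p η e r))
      MeasureTheory.volume a b := by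
    intro r hr a ha b hb
    refine ((continuousOn_lagrangianAlong hu hT (hQ.2.2.1 r hr).1).mono ?_).intervalIntegrable
    exact ordConnected_Icc.uIcc_subset ha hb
  have hout : ∀ r ∈ Ioo (-ε) ε, ∀ t ∈ Icc t₀ t₁, t ∉ Ioo a b →
      D.lagrangianAlong (κ ^ 2 / 2) (Icc t₀ t₁) (bumpVariation q p η e r) t =
        D.lagrangianAlong (κ ^ 2 / 2) (Icc t₀ t₁) q t := fun r hr t ht htab =>
    lagrangianAlong_bumpVariation h01 hq ht (fun h => htab (hηs h)) (hQ.2.2.1 r hr).1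
  have haction : HasDerivAt (fun r => D.action κ t₀ t₁ (bumpVariation q p η e r))
      (∫ t in a..b, (D.force (κ ^ 2 / 2) p (chartJet p (Icc t₀ t₁) q t) (v t) +
        D.momentum p (chartJet p (Icc t₀ t₁) q t) (w t))) 0 := by
    refine ((hd.const_add (∫ t in t₀..a, D.lagrangianAlong (κ ^ 2 / 2) (Icc t₀ t₁) q t)).add_const
      (∫ t in b..t₁, D.lagrangianAlong (κ ^ 2 / 2) (Icc t₀ t₁) q t)).congr_of_eventuallyEq ?_
    filter_upwards [Ioo_mem_nhds h0ε.1 h0ε.2] with r hr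
    have h0I : t₀ ∈ Icc t₀ t₁ := left_mem_Icc.2 h01.le
    have h1I : t₁ ∈ Icc t₀ t₁ := right_mem_Icc.2 h01.le
    rw [action_eq, ← intervalIntegral.integral_add_adjacent_intervals (hint r hr t₀ h0I b hbI)
      (hint r hr b hbI t₁ h1I), ← intervalIntegral.integral_add_adjacent_intervals
      (hint r hr t₀ h0I a haI) (hint r hr a haI b hbI)]
    congr 1
    · congr 1
      refine intervalIntegral.integral_congr fun t ht => ?_
      rw [uIcc_of_le haI.1] at ht
      exact hout r hr t ⟨ht.1, ht.2.trans haI.2⟩ fun h => absurd h.1 (not_lt.2 ht.2)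
    · refine intervalIntegral.integral_congr fun t ht => ?_
      rw [uIcc_of_le hbI.2] at ht
      exact hout r hr t ⟨hbI.1.trans ht.1, ht.2⟩ fun h => absurd h.2 (not_lt.2 ht.1)
  rw [← haction.unique (hs.2 ε _ hQ)]
  refine intervalIntegral.integral_congr fun t ht => ?_
  rw [uIcc_of_le hab.le] at ht
  rw [hv' t ht, hw' t ht]

theorem isEulerLagrange_of_isStationary (h01 : t₀ < t₁) (hT : Icc t₀ t₁ ⊆ D.T)
    (hq : ContMDiffOn 𝓘(ℝ, ℝ) (𝓡 d) 2 q (Icc t₀ t₁)) (hs : D.IsStationary κ t₀ t₁ q) :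
    D.IsEulerLagrange (κ ^ 2 / 2) (Icc t₀ t₁) q := by
  intro p t ht hpt
  have hu := uniqueDiffOn_Icc h01
  have hq1 := hq.of_le (by norm_num : (1 : ℕ∞ω) ≤ 2)
  set M : ℝ → EuclideanSpace ℝ (Fin d) →L[ℝ] ℝ :=
    fun t' => D.momentum p (chartJet p (Icc t₀ t₁) q t') with hM
  have hM1 : ∀ t ∈ Icc t₀ t₁, q t ∈ (chartAt (EuclideanSpace ℝ (Fin d)) p).source →
      ContDiffWithinAt ℝ 1 M (Icc t₀ t₁) t := fun t ht hp =>
    (D.contDiffOn_momentum p).comp_chartJet hu hq ht (hT ht) hp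
  have hMd : ∀ t ∈ Icc t₀ t₁, q t ∈ (chartAt (EuclideanSpace ℝ (Fin d)) p).source →
      HasDerivWithinAt M (derivWithin M (Icc t₀ t₁) t) (Icc t₀ t₁) t := fun t ht hp =>
    ((hM1 t ht hp).differentiableWithinAt one_ne_zero).hasDerivWithinAt
  refine (hMd t ht hpt).congr_deriv ?_
  obtain ⟨δ, hδ, hδp⟩ := Metric.eventually_nhds_iff.1 (eventually_nhdsWithin_iff.1
    (eventually_mem_chart_source (hq1 t ht).continuousWithinAt hpt))
  obtain ⟨a, b, hab, htab, hsub, hp⟩ : ∃ a b : ℝ, a < b ∧ t ∈ Icc a b ∧ Icc a b ⊆ Icc t₀ t₁ ∧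
      ∀ t ∈ Icc a b, q t ∈ (chartAt (EuclideanSpace ℝ (Fin d)) p).source := by
    refine ⟨max t₀ (t - δ / 2), min t₁ (t + δ / 2), ?_, ?_, ?_, ?_⟩
    · rw [max_lt_iff, lt_min_iff, lt_min_iff]
      exact ⟨⟨h01, by linarith [ht.1]⟩, by linarith [ht.2], by linarith⟩
    · exact ⟨max_le ht.1 (by linarith), le_min ht.2 (by linarith)⟩
    · exact Icc_subset_Icc (le_max_left _ _) (min_le_left _ _)
    · intro t' ht'
      have h1 := (max_le_iff.1 ht'.1)
      have h2 := (le_min_iff.1 ht'.2)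
      refine hδp ?_ ⟨h1.1, h2.1⟩
      rw [Real.dist_eq, abs_lt]
      exact ⟨by linarith [h1.2], by linarith [h2.2]⟩
  ext e
  have hjet : ContinuousOn (chartJet (d := d) p (Icc t₀ t₁) q) (Icc a b) := fun t ht =>
    (continuousWithinAt_chartJet hu hq1 (hsub ht) (hp t ht)).mono hsub
  have hmem : MapsTo (chartJet (d := d) p (Icc t₀ t₁) q) (Icc a b) (D.lagrangianDomain p) :=
    fun t ht => chartJet_mem (hT (hsub ht)) (hp t ht)
  have hFc : ContinuousOn (fun t => D.force (κ ^ 2 / 2) p (chartJet p (Icc t₀ t₁) q t)) (Icc a b) :=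
    continuousOn_force.comp hjet hmem
  have hMc : ContinuousOn M (Icc a b) := (D.contDiffOn_momentum p).continuousOn.comp hjet hmem
  have hM'c : ContinuousOn (derivWithin M (Icc t₀ t₁)) (Icc a b) := fun t ht => by
    have h1 : ContDiffWithinAt ℝ 0 (derivWithin M (Icc t₀ t₁)) (Icc t₀ t₁) t :=
      ((hM1 t (hsub ht) (hp t ht)).fderivWithin_right hu (m := 0) (by norm_num)
        (hsub ht)).clm_apply contDiffWithinAt_const
    exact h1.continuousWithinAt.mono hsub
  have hGc : ContinuousOn (fun t => derivWithin M (Icc t₀ t₁) t e -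
      D.force (κ ^ 2 / 2) p (chartJet p (Icc t₀ t₁) q t) e) (Icc a b) :=
    (hM'c.clm_apply continuousOn_const).sub (hFc.clm_apply continuousOn_const)
  have hweak : ∀ η : ℝ → ℝ, ContDiff ℝ ∞ η → HasCompactSupport η → tsupport η ⊆ Ioo a b →
      ∫ t, η t • (derivWithin M (Icc t₀ t₁) t e -
        D.force (κ ^ 2 / 2) p (chartJet p (Icc t₀ t₁) q t) e) = 0 := by
    intro η hη _ hηs
    have hηd : ∀ t, HasDerivAt η (deriv η t) t := fun t =>
      (hη.differentiable (by simp) t).hasDerivAt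
    have hηc : Continuous (deriv η) := hη.continuous_deriv (by simp)
    have hzero : ∀ t, t ∉ Ioo a b → η t = 0 := fun t ht =>
      image_eq_zero_of_notMem_tsupport fun h => ht (hηs h)
    have h1 := hs.integral_eq_zero h01 hT hq1 hab hsub hp hη hηs e
    have hc2 : ContinuousOn (fun t => derivWithin M (Icc t₀ t₁) t (η t • e) +
        M t (deriv η t • e)) (Icc a b) :=
      (hM'c.clm_apply (hη.continuous.smul continuous_const).continuousOn).add
        (hMc.clm_apply (hηc.smul continuous_const).continuousOn)
    have hc1 : ContinuousOn (fun t => D.force (κ ^ 2 / 2) p (chartJet p (Icc t₀ t₁) q t) (η t • e) +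
        M t (deriv η t • e)) (Icc a b) :=
      (hFc.clm_apply (hη.continuous.smul continuous_const).continuousOn).add
        (hMc.clm_apply (hηc.smul continuous_const).continuousOn)
    have h2 : ∫ t in a..b, (derivWithin M (Icc t₀ t₁) t (η t • e) + M t (deriv η t • e)) = 0 := by
      rw [integral_eq_sub_of_hasDerivWithinAt_Icc (f := fun t => M t (η t • e)) hab.le _ hc2]
      · rw [hzero a (by simp), hzero b (by simp)]
        simp
      · intro t ht
        exact ((hMd t (hsub ht) (hp t ht)).mono hsub).clm_apply
          ((hηd t).smul_const e).hasDerivWithinAt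
    have h3 : ∫ t in a..b, η t • (derivWithin M (Icc t₀ t₁) t e -
        D.force (κ ^ 2 / 2) p (chartJet p (Icc t₀ t₁) q t) e) = 0 := by
      rw [← sub_zero (0 : ℝ)]
      nth_rewrite 1 [← h2]
      rw [← h1, ← intervalIntegral.integral_sub]
      · refine intervalIntegral.integral_congr fun t _ => ?_
        simp only [map_smul, smul_eq_mul, hM]
        ring
      · exact ContinuousOn.intervalIntegrable (by rwa [uIcc_of_le hab.le])
      · exact ContinuousOn.intervalIntegrable (by rwa [uIcc_of_le hab.le])
    rw [intervalIntegral.integral_of_le hab.le] at h3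
    rw [← h3]
    refine (MeasureTheory.setIntegral_eq_integral_of_forall_compl_eq_zero fun t ht => ?_).symm
    rw [hzero t (fun h => ht (Ioo_subset_Ioc_self h)), zero_smul]
  have hae := isOpen_Ioo.ae_eq_zero_of_integral_contDiff_smul_eq_zero
    ((hGc.mono Ioo_subset_Icc_self).locallyIntegrableOn measurableSet_Ioo) hweak
  have hae' : (fun t => derivWithin M (Icc t₀ t₁) t e -
      D.force (κ ^ 2 / 2) p (chartJet p (Icc t₀ t₁) q t) e) =ᵐ[MeasureTheory.volume.restrict
        (Icc a b)] fun _ => 0 := by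
    rw [← MeasureTheory.restrict_Ioo_eq_restrict_Icc]
    exact (MeasureTheory.ae_restrict_iff' measurableSet_Ioo).2 hae
  have hfin := MeasureTheory.Measure.eqOn_Icc_of_ae_eq MeasureTheory.volume hab.ne hae' hGc
    continuousOn_const htab
  exact sub_eq_zero.1 hfin

end EisenhartData

theorem chartVector_injective {E : Type*} [NormedAddCommGroup E] [NormedSpace ℝ E]
    {H : Type*} [TopologicalSpace H] (I : ModelWithCorners ℝ E H) [I.Boundaryless]
    {M : Type*} [TopologicalSpace M] [ChartedSpace H M] [IsManifold I 1 M] {p : M} {z : E}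
    (hz : z ∈ (extChartAt I p).target) : Function.Injective (chartVector I p z) := by
  have h := mfderiv_extChartAt_comp_mfderivWithin_extChartAt_symm (I := I) hz
  rw [I.range_eq_univ, mfderivWithin_univ] at h
  intro v w hvw
  have hv := DFunLike.congr_fun h v
  have hw := DFunLike.congr_fun h w
  refine hv.symm.trans (Eq.trans ?_ hw)
  exact congrArg (mfderiv I 𝓘(ℝ, E) (extChartAt I p) ((extChartAt I p).symm z)) hvw

/-- A curve whose derivative vanishes in every chart is constant. -/
theorem eq_of_hasDerivWithinAt_chart_zero {E : Type*} [NormedAddCommGroup E] [NormedSpace ℝ E]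
    {H : Type*} [TopologicalSpace H] (I : ModelWithCorners ℝ E H)
    {M : Type*} [TopologicalSpace M] [ChartedSpace H M] {J : Set ℝ} (hJ : J.OrdConnected)
    {y : ℝ → M} (hy : ContinuousOn y J)
    (h : ∀ p, ∀ s ∈ J, y s ∈ (chartAt H p).source →
      HasDerivWithinAt (fun s' => extChartAt I p (y s')) 0 J s) {s s' : ℝ} (hs : s ∈ J)
    (hs' : s' ∈ J) : y s = y s' := by
  have : PreconnectedSpace J := isPreconnected_iff_preconnectedSpace.1 hJ.isPreconnected
  have hloc : IsLocallyConstant (fun r : J => y r) := by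
    rw [IsLocallyConstant.iff_eventually_eq]
    rintro ⟨r, hr⟩
    obtain ⟨δ, hδ, hball⟩ := Metric.mem_nhdsWithin_iff.1
      (eventually_mem_chart_source (hy r hr) (mem_chart_source H (y r)))
    have hsub : Metric.ball (⟨r, hr⟩ : J) δ ∈ 𝓝 (⟨r, hr⟩ : J) := Metric.ball_mem_nhds _ hδ
    filter_upwards [hsub] with r' hr'
    have hconv : Convex ℝ (Metric.ball r δ ∩ J) := (convex_ball r δ).inter hJ.convex
    have hr₁ : (r' : ℝ) ∈ Metric.ball r δ ∩ J := ⟨hr', r'.2⟩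
    have hr₀ : r ∈ Metric.ball r δ ∩ J := ⟨Metric.mem_ball_self hδ, hr⟩
    have hle := hconv.norm_image_sub_le_of_norm_hasDerivWithin_le
      (f := fun s' => extChartAt I (y r) (y s')) (f' := fun _ => 0) (C := 0)
      (fun u hu => (h (y r) u hu.2 (hball hu)).mono inter_subset_right) (by simp) hr₀ hr₁
    refine (extChartAt I (y r)).injOn ?_ ?_ (by simpa [sub_eq_zero] using hle)
    · rw [extChartAt_source]; exact hball hr₁
    · exact mem_extChartAt_source _
  exact hloc.apply_eq_of_preconnectedSpace ⟨s, hs⟩ ⟨s', hs'⟩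

namespace EisenhartData

variable {d : ℕ} {S : Type*} [TopologicalSpace S] [ChartedSpace (EuclideanSpace ℝ (Fin d)) S]
  {D : EisenhartData d S} {J : Set ℝ} {x : ℝ → ℝ × S × ℝ} {q : ℝ → S}

theorem aChart_pos [IsManifold (𝓡 d) 1 S] {p : S} {z : ℝ × EuclideanSpace ℝ (Fin d)}
    (hz : z ∈ D.chartDomain p)
    {v : EuclideanSpace ℝ (Fin d)} (hv : v ≠ 0) : 0 < D.aChart p z v v := by
  refine D.a_pos z.1 hz.1 _ _ fun h0 => hv (chartVector_injective (𝓡 d) hz.2 (h0.trans ?_))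
  exact (map_zero (mfderiv 𝓘(ℝ, EuclideanSpace ℝ (Fin d)) (𝓡 d) (extChartAt (𝓡 d) p).symm z.2)).symm

variable [IsManifold (𝓡 d) 2 S]

/-- A nonspacelike curve orthogonal to the Killing field is contained in a flow line. -/
theorem exists_flow_line (hJ : J.OrdConnected) (hn : J.Nontrivial)
    (hT : ∀ s ∈ J, (x s).1 ∈ D.T) (hx : ContMDiffOn 𝓘(ℝ, ℝ) (eisModel d) 2 x J)
    (h0 : ∀ s ∈ J, D.metric (x s) (killingN (x s)) (curveVelocity (eisModel d) J x s) = 0)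
    (hm : ∀ s ∈ J, D.metric (x s) (curveVelocity (eisModel d) J x s)
      (curveVelocity (eisModel d) J x s) ≤ 0) :
    ∃ e : ℝ × S, ∀ s ∈ J, ((x s).1, (x s).2.1) = e := by
  have hu := hJ.uniqueDiffOn_real hn
  have ht : ∀ s ∈ J, HasDerivWithinAt (fun s => (x s).1) 0 J s := fun s hs =>
    (hasDerivWithinAt_time hJ hn hT hx (k := 0) (by simpa using h0) s hs).congr_deriv (by simp)
  obtain ⟨s₀, hs₀⟩ := hn.nonempty
  refine ⟨((x s₀).1, (x s₀).2.1), fun s hs => ?_⟩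
  rw [eqOn_const_of_hasDerivWithinAt_zero hJ ht hs hs₀]
  refine congrArg _ (eq_of_hasDerivWithinAt_chart_zero (𝓡 d) hJ (y := fun s => (x s).2.1)
    ((contMDiff_fst.comp contMDiff_snd).comp_contMDiffOn hx).continuousOn ?_ hs hs₀)
  intro p s hs hp
  obtain ⟨h1, h2, -⟩ := hasDerivWithinAt_components (p := ((0 : ℝ), p, (0 : ℝ))) hx hs hp
  have hz : ((extChartAt (eisModel d) (0, p, 0) (x s)).1,
      (extChartAt (eisModel d) (0, p, 0) (x s)).2.1) ∈ D.chartDomain p := by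
    rw [extChartAt_eisModel]
    exact mem_chartDomain (hT s hs) hp
  have hE := hm s hs
  rw [metric_velocity_velocity hu hx hs (p := (0, p, 0))
      (mem_chartAt_source_eisModel.2 hp),
    D.metricInChart_metric _ hz.2, (hu s hs).eq_deriv _ h1 (ht s hs)] at hE
  refine h2.congr_deriv ?_
  by_contra hne
  have := aChart_pos hz hne
  simp only [mul_zero, zero_mul, sub_zero] at hE
  exact absurd hE (not_le.2 this)

end EisenhartData

namespace EisenhartData

variable {d : ℕ} {S : Type*} [TopologicalSpace S] [ChartedSpace (EuclideanSpace ℝ (Fin d)) S]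
  {D : EisenhartData d S} {J : Set ℝ} {x : ℝ → ℝ × S × ℝ} {q : ℝ → S} {κ t₀ t₁ y₀ : ℝ}

theorem continuousOn_ψ_comp (hT : J ⊆ D.T) (hq : ContinuousOn q J) :
    ContinuousOn (fun t => D.ψ t (q t)) J :=
  D.contMDiffOn_ψ.continuousOn.comp (continuousOn_id.prodMk hq) fun _ ht => ⟨hT ht, mem_univ _⟩

variable [IsManifold (𝓡 d) 2 S]

/-- The velocity of a curve of the form `(t, q(t), Y(t))`, `Y` being a lift of `q`. -/
theorem curveVelocity_of_height (hu : UniqueDiffOn ℝ J) (hT : J ⊆ D.T)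
    (hq : ContMDiffOn 𝓘(ℝ, ℝ) (𝓡 d) 2 q J) {Y : ℝ → ℝ} {κ2 : ℝ}
    (hY : ∀ (p : S), ∀ t ∈ J, q t ∈ (chartAt (EuclideanSpace ℝ (Fin d)) p).source →
      HasDerivWithinAt Y (D.lagrangian (-κ2 / 2) p (chartJet p J q t)) J t)
    (hx : ∀ t ∈ J, x t = (t, q t, Y t)) {t : ℝ} (ht : t ∈ J) :
    curveVelocity (eisModel d) J x t ≠ 0 ∧
    D.metric (x t) (curveVelocity (eisModel d) J x t) (curveVelocity (eisModel d) J x t) =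
        -κ2 * D.ψ t (q t) ^ 2 := by
  have hq1 := hq.of_le (by norm_num : (1 : ℕ∞ω) ≤ 2)
  have hx1 : ∀ t ∈ J, (x t).1 = t := fun t ht => by rw [hx t ht]
  have hx2 : ContMDiffOn 𝓘(ℝ, ℝ) (eisModel d) 2 x J := by
    refine ContMDiffOn.congr (f := fun t => (t, q t, Y t)) ?_ hx
    exact contMDiffOn_id.prodMk (hq.prodMk (contDiffOn_two_height hu hT hq hY).contMDiffOn)
  have h21 : ∀ t ∈ J, (x t).2.1 = q (x t).1 := fun t ht => by rw [hx t ht]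
  have hp : q (x t).1 ∈ (chartAt (EuclideanSpace ℝ (Fin d)) (x t).2.1).source := by
    rw [← h21 t ht]
    exact mem_chart_source _ _
  obtain ⟨hv1, hv2, hv3⟩ := velocity_of_lift (ρ := fun _ => 1) hu hx2
    (fun s hs => by dsimp only; rwa [hx1 s hs]) hq1 hY (fun s hs => by rw [hx s hs])
    (fun s hs => (hasDerivWithinAt_id s J).congr_of_mem hx1 hs) (x t) ht hp
  have hz : ((extChartAt (eisModel d) (x t) (x t)).1, (extChartAt (eisModel d) (x t) (x t)).2.1) ∈
      D.chartDomain (x t).2.1 := by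
    rw [extChartAt_eisModel, hx1 t ht]
    exact mem_chartDomain (hT ht) (mem_chart_source _ _)
  have hsP := mem_chart_source (ModelProd ℝ (ModelProd (EuclideanSpace ℝ (Fin d)) ℝ)) (x t)
  constructor
  · intro h0
    have h1 := (hx2.of_le (by norm_num : (1 : ℕ∞ω) ≤ 2)).curveVelocity_eq hu ht hsP
    have h2 := h1.symm.trans h0
    rw [chartVector_eisModel _ hz.2] at h2
    have h3 : (1 : ℝ) = 0 := hv1.symm.trans (congrArg Prod.fst h2)
    exact one_ne_zero h3
  · have hψ := ψChart_extChartAt_eisModel (D := D) (h21 t ht) hp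
    rw [hx1 t ht] at hψ
    have h0 := (D.ψ_pos t (hT ht) (q t)).ne'
    have h1 := div_self h0
    nth_rw 2 [← hψ] at h1
    rw [metric_velocity_velocity hu hx2 ht hsP]
    rw [← h1] at hv1 hv2 hv3
    exact (metricInChart_energy hz h0 hv1 hv2).2 hv3

/-- Lifts of solutions of the Euler–Lagrange equations are unparametrized geodesics. -/
theorem isUnparamGeodesicOn_lift (h01 : t₀ < t₁) (hT : Icc t₀ t₁ ⊆ D.T)
    (hq : ContMDiffOn 𝓘(ℝ, ℝ) (𝓡 d) 2 q (Icc t₀ t₁))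
    (hEL : D.IsEulerLagrange (κ ^ 2 / 2) (Icc t₀ t₁) q) :
    IsUnparamGeodesicOn (eisModel d) D.metric (Icc t₀ t₁) (D.lift κ t₀ t₁ y₀ q) := by
  have hu := uniqueDiffOn_Icc h01
  have hψc := continuousOn_ψ_comp hT hq.continuousOn
  have hpos : ∀ t ∈ Icc t₀ t₁, 0 < D.ψ t (q t) := fun t ht => D.ψ_pos t (hT ht) _
  set σ : ℝ → ℝ := fun t => ∫ s in t₀..t, D.ψ s (q s) with hσdef
  have hσ : ∀ t ∈ Icc t₀ t₁, HasDerivWithinAt σ (D.ψ t (q t)) (Icc t₀ t₁) t := fun t ht =>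
    hasDerivWithinAt_integral_of_continuousOn h01 hψc ht
  have hd : ∀ t ∈ Icc t₀ t₁, derivWithin σ (Icc t₀ t₁) t = D.ψ t (q t) := fun t ht =>
    (hσ t ht).derivWithin (hu t ht)
  have hinj : InjOn σ (Icc t₀ t₁) :=
    (interval_inverse ordConnected_Icc (⟨t₀, left_mem_Icc.2 h01.le, t₁, right_mem_Icc.2 h01.le, h01.ne⟩) hσ (Or.inl hpos)).1.elim
      StrictMonoOn.injOn StrictAntiOn.injOn
  have hx : ∀ t ∈ Icc t₀ t₁,
      (D.lift κ t₀ t₁ y₀ q ∘ Function.invFunOn σ (Icc t₀ t₁)) (σ t) = D.lift κ t₀ t₁ y₀ q t :=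
    fun t ht => congrArg _ (hinj.leftInvOn_invFunOn ht)
  refine ⟨σ, _, ?_, fun t ht => by rw [hd t ht]; exact hpos t ht, hx, ?_⟩
  · rw [contDiffOn_one_iff_derivWithin hu]
    exact ⟨fun t ht => (hσ t ht).differentiableWithinAt, hψc.congr hd⟩
  · exact (geodesic_of_isEulerLagrange (K := 1) (κ2 := κ ^ 2) ordConnected_Icc
      (⟨t₀, left_mem_Icc.2 h01.le, t₁, right_mem_Icc.2 h01.le, h01.ne⟩) hT one_pos hq hEL
      (fun p t ht hp => D.hasDerivWithinAt_lift (κ := κ) (y₀ := y₀) h01 hT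
        (hq.of_le (by norm_num)) ht hp)
      (fun t ht => (hσ t ht).congr_deriv (one_mul _).symm)
      (fun t ht => (hx t ht).trans (lift_eq D κ t₀ t₁ y₀ q t))).1

/-- A curve whose lift is an unparametrized geodesic solves the Euler–Lagrange equations. -/
theorem isEulerLagrange_of_isUnparamGeodesicOn_lift (h01 : t₀ < t₁) (hT : Icc t₀ t₁ ⊆ D.T)
    (hq : ContMDiffOn 𝓘(ℝ, ℝ) (𝓡 d) 1 q (Icc t₀ t₁))
    (hγ : IsUnparamGeodesicOn (eisModel d) D.metric (Icc t₀ t₁) (D.lift κ t₀ t₁ y₀ q)) :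
    ContMDiffOn 𝓘(ℝ, ℝ) (𝓡 d) 2 q (Icc t₀ t₁) ∧
      D.IsEulerLagrange (κ ^ 2 / 2) (Icc t₀ t₁) q := by
  obtain ⟨σ, x, hσ1, hpos, hx, hg⟩ := hγ
  have hσ : ∀ t ∈ Icc t₀ t₁, HasDerivWithinAt σ (derivWithin σ (Icc t₀ t₁) t) (Icc t₀ t₁) t :=
    fun t ht => (hσ1.differentiableOn one_ne_zero t ht).hasDerivWithinAt
  obtain ⟨-, hJ, hJn, hinv⟩ := interval_inverse ordConnected_Icc (⟨t₀, left_mem_Icc.2 h01.le, t₁, right_mem_Icc.2 h01.le, h01.ne⟩) hσ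
    (Or.inl hpos)
  have hx' : ∀ t ∈ Icc t₀ t₁, x (σ t) = _ := fun t ht =>
    (hx t ht).trans (lift_eq D κ t₀ t₁ y₀ q t)
  have hgl : ∀ t ∈ Icc t₀ t₁, (x (σ t)).1 = t := fun t ht => by rw [hx' t ht]
  obtain ⟨hθ, -⟩ := hinv (fun s => (x s).1) hgl
  set J := σ '' Icc t₀ t₁ with hJdef
  have hu := hJ.uniqueDiffOn_real hJn
  have hmaps : MapsTo (fun s => (x s).1) J (Icc t₀ t₁) := by
    rintro _ ⟨t, ht, rfl⟩
    dsimp only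
    rwa [hgl t ht]
  have himage : (fun s => (x s).1) '' J = Icc t₀ t₁ := by
    refine hmaps.image_subset.antisymm fun t ht => ⟨σ t, mem_image_of_mem σ ht, hgl t ht⟩
  have hTJ : ∀ s ∈ J, (x s).1 ∈ D.T := fun s hs => hT (hmaps hs)
  have h21 : ∀ s ∈ J, (x s).2.1 = q (x s).1 := by
    rintro _ ⟨t, ht, rfl⟩
    rw [hx' t ht]
  have hxJ : ∀ s ∈ J, x s = ((x s).1, q (x s).1,
      (fun t => y₀ + ∫ t' in t₀..t, D.lagrangianAlong (-κ ^ 2 / 2) (Icc t₀ t₁) q t') (x s).1) := by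
    rintro _ ⟨t, ht, rfl⟩
    rw [hx' t ht]
  obtain ⟨h, m, hhm⟩ := eq_const_of_geodesic hJ hJn hTJ hg
  have hk : ∀ s ∈ J, D.metric (x s) (killingN (x s)) (curveVelocity (eisModel d) J x s) = -(-h) :=
    fun s hs => by rw [neg_neg]; exact (hhm s hs).1
  have hθk := hasDerivWithinAt_time hJ hJn hTJ hg.1 hk
  have hk0 : -h ≠ 0 := by
    intro h0
    have ht := left_mem_Icc.2 h01.le
    have hs := mem_image_of_mem σ ht
    have h1 := (hu _ hs).eq_deriv _ (hθk _ hs) (hθ _ ht)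
    rw [h0, zero_div] at h1
    exact (inv_pos.2 (hpos _ ht)).ne h1
  have hm : ∀ s ∈ J, D.metric (x s) (curveVelocity (eisModel d) J x s)
      (curveVelocity (eisModel d) J x s) = -κ ^ 2 * (-h) ^ 2 := by
    intro s hs
    have hp : q (x s).1 ∈ (chartAt (EuclideanSpace ℝ (Fin d)) (x s).2.1).source := by
      rw [← h21 s hs]
      exact mem_chart_source _ _
    have hz : ((extChartAt (eisModel d) (x s) (x s)).1, (extChartAt (eisModel d) (x s) (x s)).2.1) ∈
        D.chartDomain (x s).2.1 := by
      rw [extChartAt_eisModel]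
      exact mem_chartDomain (hTJ s hs) (mem_chart_source _ _)
    obtain ⟨hv1, hv2, hv3⟩ := velocity_of_lift hu hg.1 hmaps hq
      (fun p t ht hp => D.hasDerivWithinAt_lift (κ := κ) (y₀ := y₀) h01 hT hq ht hp) hxJ hθk (x s)
      hs hp
    have hψ := ψChart_extChartAt_eisModel (D := D) (p := x s) (h21 s hs) hp
    rw [← h21 s hs] at hψ
    rw [← hψ] at hv1 hv2 hv3
    rw [metric_velocity_velocity hu hg.1 hs (mem_chart_source _ _)]
    exact (metricInChart_energy hz hk0 hv1 hv2).2 hv3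
  have := isEulerLagrange_of_geodesic hJ hJn hTJ hg hk0 hk hm fun s hs => (h21 s hs).symm
  rwa [himage] at this

end EisenhartData

namespace EisenhartData

variable {d : ℕ} {S : Type*} [TopologicalSpace S] [ChartedSpace (EuclideanSpace ℝ (Fin d)) S]
  [IsManifold (𝓡 d) 2 S] {D : EisenhartData d S} {J : Set ℝ} {x : ℝ → ℝ × S × ℝ}

/-- Causal geodesics project to stationary points of the functional. -/
theorem exists_isStationary_of_causalGeodesic (hJ : J.OrdConnected) (hn : J.Nontrivial)
    (hg : D.IsCausalGeodesicOn J x) (he : ¬ ∃ e : ℝ × S, ∀ s ∈ J, ((x s).1, (x s).2.1) = e) :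
    ∃ κ : ℝ, 0 ≤ κ ∧
      (∀ s ∈ J,
        D.metric (x s) (killingN (x s)) (curveVelocity (eisModel d) J x s) ≠ 0 ∧
        κ = √(-(D.metric (x s) (curveVelocity (eisModel d) J x s)
              (curveVelocity (eisModel d) J x s)))
            / |D.metric (x s) (killingN (x s)) (curveVelocity (eisModel d) J x s)|) ∧
      (StrictMonoOn (fun s => (x s).1) J ∨ StrictAntiOn (fun s => (x s).1) J) ∧
      ∃ q : ℝ → S, (∀ s ∈ J, q (x s).1 = (x s).2.1) ∧
        ContMDiffOn 𝓘(ℝ, ℝ) (𝓡 d) 2 q ((fun s => (x s).1) '' J) ∧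
        ∀ t₀ ∈ (fun s => (x s).1) '' J, ∀ t₁ ∈ (fun s => (x s).1) '' J, t₀ < t₁ →
          D.IsStationary κ t₀ t₁ q := by
  obtain ⟨hT, hg, hc⟩ := hg
  obtain ⟨h, m, hhm⟩ := eq_const_of_geodesic hJ hn hT hg
  have hh : h ≠ 0 := by
    rintro rfl
    exact he (exists_flow_line hJ hn hT hg.1 (fun s hs => (hhm s hs).1) fun s hs => (hc s hs).2)
  have hm0 : m ≤ 0 := by
    obtain ⟨s, hs⟩ := hn.nonempty
    rw [← (hhm s hs).2]
    exact (hc s hs).2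
  have hκ : -(√(-m) / |h|) ^ 2 * (-h) ^ 2 = m := by
    rw [div_pow, Real.sq_sqrt (neg_nonneg.2 hm0), sq_abs, neg_sq]
    field_simp
  have hk : ∀ s ∈ J, D.metric (x s) (killingN (x s)) (curveVelocity (eisModel d) J x s) = -(-h) :=
    fun s hs => by rw [neg_neg]; exact (hhm s hs).1
  have hk0 : -h ≠ 0 := neg_ne_zero.2 hh
  have hsign : (∀ s ∈ J, 0 < -h / D.ψ (x s).1 (x s).2.1) ∨
      (∀ s ∈ J, -h / D.ψ (x s).1 (x s).2.1 < 0) := by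
    rcases hk0.lt_or_gt with h | h
    · exact Or.inr fun s hs => div_neg_of_neg_of_pos h (D.ψ_pos _ (hT s hs) _)
    · exact Or.inl fun s hs => div_pos h (D.ψ_pos _ (hT s hs) _)
  obtain ⟨hmono, hI, -, -⟩ := interval_inverse hJ hn (hasDerivWithinAt_time hJ hn hT hg.1 hk) hsign
  have hinj : InjOn (fun s => (x s).1) J := hmono.elim StrictMonoOn.injOn StrictAntiOn.injOn
  have hq : ∀ s ∈ J, ((fun s => (x s).2.1) ∘ Function.invFunOn (fun s => (x s).1) J) (x s).1 =
      (x s).2.1 := fun s hs => congrArg (fun s => (x s).2.1) (hinj.leftInvOn_invFunOn hs)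
  obtain ⟨hq2, hEL⟩ := isEulerLagrange_of_geodesic hJ hn hT hg hk0 hk
    (fun s hs => (hhm s hs).2.trans hκ.symm) hq
  refine ⟨√(-m) / |h|, by positivity, fun s hs => ?_, hmono, _, hq, hq2,
    fun t₀ ht₀ t₁ ht₁ h01 => ?_⟩
  · rw [(hhm s hs).1, (hhm s hs).2]
    exact ⟨hh, rfl⟩
  · have hsub := hI.out ht₀ ht₁
    have hq1 := hq2.of_le (by norm_num : (1 : ℕ∞ω) ≤ 2)
    refine isStationary_of_isEulerLagrange h01 (fun t ht => ?_) (hq1.mono hsub)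
      (hEL.mono (uniqueDiffOn_Icc h01) hsub hq1)
    obtain ⟨s, hs, rfl⟩ := hsub ht
    exact hT s hs

end EisenhartData

end

theorem mainTheorem3 {d : ℕ} {S : Type*} [TopologicalSpace S] [T2Space S]
    [ChartedSpace (EuclideanSpace ℝ (Fin d)) S] [IsManifold (𝓡 d) 2 S]
    (D : EisenhartData d S) :
    -- every causal geodesic, not coincident with a flow line of `n`
    (∀ (J : Set ℝ) (x : ℝ → ℝ × S × ℝ), J.OrdConnected → J.Nontrivial →
      D.IsCausalGeodesicOn J x →
      (¬ ∃ e : ℝ × S, ∀ s ∈ J, ((x s).1, (x s).2.1) = e) →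
      ∃ κ : ℝ, 0 ≤ κ ∧
        (∀ s ∈ J,
          D.metric (x s) (killingN (x s)) (curveVelocity (eisModel d) J x s) ≠ 0 ∧
          κ = √(-(D.metric (x s) (curveVelocity (eisModel d) J x s)
                (curveVelocity (eisModel d) J x s)))
              / |D.metric (x s) (killingN (x s)) (curveVelocity (eisModel d) J x s)|) ∧
        (StrictMonoOn (fun s => (x s).1) J ∨ StrictAntiOn (fun s => (x s).1) J) ∧
        ∃ q : ℝ → S, (∀ s ∈ J, q (x s).1 = (x s).2.1) ∧
          ContMDiffOn 𝓘(ℝ, ℝ) (𝓡 d) 2 q ((fun s => (x s).1) '' J) ∧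
          ∀ t₀ ∈ (fun s => (x s).1) '' J, ∀ t₁ ∈ (fun s => (x s).1) '' J, t₀ < t₁ →
            D.IsStationary κ t₀ t₁ q) ∧
    -- stationary points and their lifts
    (∀ κ t₀ t₁ y₀ : ℝ, 0 ≤ κ → t₀ < t₁ → Icc t₀ t₁ ⊆ D.T →
      ∀ q : ℝ → S, ContMDiffOn 𝓘(ℝ, ℝ) (𝓡 d) 1 q (Icc t₀ t₁) →
      ((ContMDiffOn 𝓘(ℝ, ℝ) (𝓡 d) 2 q (Icc t₀ t₁) ∧ D.IsStationary κ t₀ t₁ q) ↔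
        IsUnparamGeodesicOn (eisModel d) D.metric (Icc t₀ t₁) (D.lift κ t₀ t₁ y₀ q)) ∧
      (IsUnparamGeodesicOn (eisModel d) D.metric (Icc t₀ t₁) (D.lift κ t₀ t₁ y₀ q) →
        (κ ≠ 0 →
          (∀ t ∈ Icc t₀ t₁,
            D.metric (D.lift κ t₀ t₁ y₀ q t)
              (curveVelocity (eisModel d) (Icc t₀ t₁) (D.lift κ t₀ t₁ y₀ q) t)
              (curveVelocity (eisModel d) (Icc t₀ t₁) (D.lift κ t₀ t₁ y₀ q) t) < 0) ∧
          ∀ (τ : ℝ → ℝ) (x : ℝ → ℝ × S × ℝ),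
            (∀ t ∈ Icc t₀ t₁, HasDerivWithinAt τ (κ * D.ψ t (q t)) (Icc t₀ t₁) t) →
            (∀ t ∈ Icc t₀ t₁, x (τ t) = D.lift κ t₀ t₁ y₀ q t) →
            IsGeodesicOn (eisModel d) D.metric (τ '' Icc t₀ t₁) x ∧
            ∀ s ∈ τ '' Icc t₀ t₁,
              D.metric (x s) (curveVelocity (eisModel d) (τ '' Icc t₀ t₁) x s)
                (curveVelocity (eisModel d) (τ '' Icc t₀ t₁) x s) = -1) ∧
        (κ = 0 →
          (∀ t ∈ Icc t₀ t₁,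
            curveVelocity (eisModel d) (Icc t₀ t₁) (D.lift κ t₀ t₁ y₀ q) t ≠ 0 ∧
            D.metric (D.lift κ t₀ t₁ y₀ q t)
              (curveVelocity (eisModel d) (Icc t₀ t₁) (D.lift κ t₀ t₁ y₀ q) t)
              (curveVelocity (eisModel d) (Icc t₀ t₁) (D.lift κ t₀ t₁ y₀ q) t) = 0) ∧
          ∀ (l : ℝ → ℝ) (x : ℝ → ℝ × S × ℝ),
            (∀ t ∈ Icc t₀ t₁, HasDerivWithinAt l (D.ψ t (q t)) (Icc t₀ t₁) t) →
            (∀ t ∈ Icc t₀ t₁, x (l t) = D.lift κ t₀ t₁ y₀ q t) →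
            IsGeodesicOn (eisModel d) D.metric (l '' Icc t₀ t₁) x))) := by
  refine ⟨fun J x hJ hn hg he => EisenhartData.exists_isStationary_of_causalGeodesic hJ hn hg he,
    fun κ t₀ t₁ y₀ hκ h01 hT q hq => ⟨⟨fun h => ?_, fun h => ?_⟩, fun h => ?_⟩⟩
  · exact EisenhartData.isUnparamGeodesicOn_lift h01 hT h.1
      (EisenhartData.isEulerLagrange_of_isStationary h01 hT h.1 h.2)
  · obtain ⟨h2, hEL⟩ := EisenhartData.isEulerLagrange_of_isUnparamGeodesicOn_lift h01 hT hq h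
    exact ⟨h2, EisenhartData.isStationary_of_isEulerLagrange h01 hT hq hEL⟩
  obtain ⟨h2, hEL⟩ := EisenhartData.isEulerLagrange_of_isUnparamGeodesicOn_lift h01 hT hq h
  have hY := fun p t ht hp => D.hasDerivWithinAt_lift (κ := κ) (y₀ := y₀) (p := p) (t := t)
    h01 hT hq ht hp
  have hvel := fun t ht => EisenhartData.curveVelocity_of_height (uniqueDiffOn_Icc h01) hT h2 hY
    (fun t _ => EisenhartData.lift_eq D κ t₀ t₁ y₀ q t) (t := t) ht
  have hgeo : ∀ {K : ℝ}, 0 < K → ∀ {σ : ℝ → ℝ} {x : ℝ → ℝ × S × ℝ},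
      (∀ t ∈ Icc t₀ t₁, HasDerivWithinAt σ (K * D.ψ t (q t)) (Icc t₀ t₁) t) →
      (∀ t ∈ Icc t₀ t₁, x (σ t) = D.lift κ t₀ t₁ y₀ q t) →
      IsGeodesicOn (eisModel d) D.metric (σ '' Icc t₀ t₁) x ∧ ∀ s ∈ σ '' Icc t₀ t₁,
        D.metric (x s) (curveVelocity (eisModel d) (σ '' Icc t₀ t₁) x s)
          (curveVelocity (eisModel d) (σ '' Icc t₀ t₁) x s) = -κ ^ 2 * K⁻¹ ^ 2 :=
    fun hK σ x hσ hx => EisenhartData.geodesic_of_isEulerLagrange ordConnected_Icc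
      ⟨t₀, left_mem_Icc.2 h01.le, t₁, right_mem_Icc.2 h01.le, h01.ne⟩ hT hK h2 hEL hY hσ
      fun t ht => (hx t ht).trans (EisenhartData.lift_eq D κ t₀ t₁ y₀ q t)
  refine ⟨fun hκ0 => ⟨fun t ht => ?_, fun τ x hτ hx => ?_⟩,
    fun hκ0 => ⟨fun t ht => ⟨(hvel t ht).1, (hvel t ht).2.trans ?_⟩, fun l x hl hx => ?_⟩⟩
  · rw [(hvel t ht).2]
    have := D.ψ_pos t (hT ht) (q t)
    have : 0 < κ ^ 2 * D.ψ t (q t) ^ 2 := by positivity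
    linarith
  · obtain ⟨h3, h4⟩ := hgeo (hκ.lt_of_ne' hκ0) hτ hx
    refine ⟨h3, fun s hs => (h4 s hs).trans ?_⟩
    field_simp
  · simp [hκ0]
  · exact (hgeo one_pos (fun t ht => (hl t ht).congr_deriv (one_mul _).symm) hx).1
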